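/- **Setting.** Let $W=(W_z)_{z\in\mathcal X}$ be a centred Gaussian process on a set $\mathcal X$ (the unit scale prior; for scale $c>0$ the prior is the law of $\sqrt c\,W$). We consider sample sizes $n$ tending to infinity along a given sequence of integers $n=N_k$, $k\to\infty$ (ordinarily $N_k=k$), design points $x_{1,n},\dots,x_{n,n}\in\mathcal X$, and a fixed function $f:\mathcal X\to\mathbb R$. For $g:\mathcal X\to\mathbb R$ write $\vec g_n=(g(x_{1,n}),\dots,g(x_{n,n}))^T$. The data are $\vec Y_n=\vec f_n+\vec\varepsilon_n$, where the coordinates of $\vec\varepsilon_n$ are independent standard normal; $P_f$ is the corresponding probability. Let $U_n=(\operatorname{cov}(W_{x_{i,n}},W_{x_{j,n}}))_{i,j}$, with orthonormal eigenbasis $e_{j,n}$ and eigenvalues $\lambda_{j,n}$, $1\le j\le n$; let $f_{j,n}=e_{j,n}^T\vec f_n$ and $Z_{j,n}=e_{j,n}^T\vec\varepsilon_n$. Put $\Sigma_{n,c}=I+cU_n$ and, for a fixed real $m\ge1$, $I_n=[\log n/n,\,n^{m-1}]$. **Procedure.** Given $c$, the posterior law of $\vec f_n$ is $\mathcal N_n(\hat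 f_{n,c},I-\Sigma_{n,c}^{-1})$ with $\hat f_{n,c}=(I-\Sigma_{n,c}^{-1})\vec Y_n$. Let $r_n(c,\eta)$ be the $\eta$-quantile of $\|\xi\|$ (Euclidean norm) for $\xi\sim\mathcal N_n(0,I-\Sigma_{n,c}^{-1})$. The scale $c$ has the inverse gamma prior truncated to $I_n$, with density proportional to $c^{-1-\kappa}e^{-\tau/c}$ on $I_n$, for fixed $\kappa,\tau>0$, so its posterior density on $I_n$ is proportional to $(\det\Sigma_{n,c})^{-1/2}e^{-\frac12\vec Y_n^T\Sigma_{n,c}^{-1}\vec Y_n}c^{-1-\kappa}e^{-\tau/c}$. For $0<\alpha_1<\alpha_2<1$ let $\hat c_{1,n}<\hat c_{2,n}$ be the $\alpha_1$- and $\alpha_2$-quantiles of this posterior distribution of $c$. The hierarchical Bayes credible set is $$\hat C_{n,\eta,M}=\bigcup_{\hat c_{1,n}<c<\hat c_{2,n}}\bigl\{g:\mathcal X\to\mathbb R:\ \|\vec g_n-\hat f_{n,c}\|<M\,r_n(c,\eta)\bigr\}.$$ **Notation.** All sums are over $1\le j\le n$, and $$D_{1,n}^L(c)=\sum_j\frac{f_{j,n}^2}{1+c\lambda_{j,n}},\qquad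 D_{2,n}^L(c)=\sum_j\Bigl[\log(1+c\lambda_{j,n})-\frac{c\lambda_{j,n}}{1+c\lambda_{j,n}}\Bigr],\qquad D_n^L=D_{1,n}^L+D_{2,n}^L,$$ $$D_{2,n}^R(c)=\sum_j\frac{(c\lambda_{j,n})^2}{(1+c\lambda_{j,n})^2},\qquad s_n^2(c)=\sum_j\frac{c\lambda_{j,n}}{1+c\lambda_{j,n}},\qquad N_n(c)=\sum_j\frac{c\lambda_{j,n}Z_{j,n}^2}{1+c\lambda_{j,n}},$$ $$R_{1,n}^L(c)=2\sum_j\frac{Z_{j,n}f_{j,n}}{1+c\lambda_{j,n}},\qquad R_{2,n}^L(c)=-\sum_j\frac{(Z_{j,n}^2-1)c\lambda_{j,n}}{1+c\lambda_{j,n}},$$ $$R_{3,n}(c)=-2\sum_j\frac{c\lambda_{j,n}Z_{j,n}f_{j,n}}{(1+c\lambda_{j,n})^2},\qquad R_{4,n}(c)=\sum_j\frac{(c\lambda_{j,n})^2(Z_{j,n}^2-1)}{(1+c\lambda_{j,n})^2}.$$ **Conditions.** 1. $\displaystyle\sup_{c\in I_n}\frac{|R_{1,n}^L(c)|+|R_{2,n}^L(c)|}{D_n^L(c)}\to0$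 and $\displaystyle\sup_{c\in I_n}\frac{|R_{3,n}(c)|+|R_{4,n}(c)|}{D_n^L(c)}\to0$ in probability. 2. $\displaystyle\sup_{c\in I_n}\Bigl|\frac{N_n(c)}{s_n^2(c)}-1\Bigr|\to0$ in probability. 3. There are constants $b,B,B'>0$ such that for all large $n$, $Br^bD_{2,n}^L(c)\le D_{2,n}^L(rc)\le B'r^bD_{2,n}^L(c)$ whenever $0<r<1$ and $c,rc\in I_n$; and for all large $n$, $D_{2,n}^L(c)\ge\log(nc)$ for all $c\in I_n$. 4. For all large $n$ there is a minimizer $c_n(f)$ of $c\mapsto D_n^L(c)+2\tau/c$ over $c\in(0,\infty)$ with $c_n(f)\in I_n$ and $2c_n(f)\in I_n$. 5. $D_{2,n}^R(c)\asymp D_{2,n}^L(c)\asymp s_n^2(c)$ uniformly in $c\in I_n$ (that is, for all large $n$ the ratios lie between two positive constants that do not depend on $c$ and $n$). 6. (Good bias.) There is a constant $a>0$ such that for all large $n$, $D_{1,n}^L(Kc)\le K^{-a}D_{1,n}^L(c)$ for all $c\in I_n$ and $K>1$. **Theorem (Coverage, hierarchical Bayes).** If conditions 1–6 hold, then there is $M_0$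 such that for every $M\ge M_0$, all $0<\alpha_1<\alpha_2<1$ and all $\eta\in(0,1)$, $$P_f\bigl(f\in\hat C_{n,\eta,M}\bigr)\to1 .$$ In particular, the same conclusion holds if conditions 4 and 6 hold together with one of the following eigenvalue conditions (with the same $m$ as in $I_n$), in which $\asymp$ means that for all large $k$ the ratio lies between two positive constants not depending on the indices: - $\lambda_{j,n}\asymp n/j^m$ for $1\le j\le n$, $n=N_k$; - $n=N_k=k^2$ and the eigenvalues of $U_n$ can be enumerated as $\lambda_{i,j}$, $(i,j)\in\{1,\dots,k\}^2$, with $\lambda_{i,j}\asymp k^2/(i^mj^m)$; - $n=N_k=k^2$ and the eigenvalues of $U_n$ can be enumerated as $\lambda_{i,j}$, $(i,j)\in\{1,\dots,k\}^2$, with $\lambda_{i,j}\asymp k^2/(i^2+j^2)^m$. -/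

import Mathlib

open MeasureTheory ProbabilityTheory Filter Topology Set

namespace HBayes

noncomputable section

/-! ### The regression model and the Bayesian procedure at one sample size `n` -/

/-- The vector of values of a function at the design points. -/
def designVec {𝒳 : Type*} {n : ℕ} (x : Fin n → 𝒳) (g : 𝒳 → ℝ) : EuclideanSpace ℝ (Fin n) :=
  WithLp.toLp 2 fun i => g (x i)

/-- `U_n`: the covariance matrix of the unit scale prior process `W` at the design points. -/
def priorCov {𝒳 Ω' : Type*} [MeasurableSpace Ω'] {n : ℕ} (W : 𝒳 → Ω' → ℝ) (Q : Measure Ω')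
    (x : Fin n → 𝒳) : Matrix (Fin n) (Fin n) ℝ :=
  Matrix.of fun i j => cov[W (x i), W (x j); Q]

/-- `Σ_{n,c} = I + c U_n`. -/
def sigmaMat {n : ℕ} (U : Matrix (Fin n) (Fin n) ℝ) (c : ℝ) : Matrix (Fin n) (Fin n) ℝ :=
  1 + c • U

/-- The posterior mean `(I - Σ_{n,c}⁻¹) y` of the vector of function values, given `c`. -/
def postMean {n : ℕ} (U : Matrix (Fin n) (Fin n) ℝ) (c : ℝ) (y : EuclideanSpace ℝ (Fin n)) :
    EuclideanSpace ℝ (Fin n) :=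
  Matrix.toEuclideanLin (1 - (sigmaMat U c)⁻¹) y

/-- `r_n(c, η)`: the `η`-quantile of the Euclidean norm under the centred posterior law
`N(0, I - Σ_{n,c}⁻¹)` given `c`. -/
def credRadius {n : ℕ} (U : Matrix (Fin n) (Fin n) ℝ) (c η : ℝ) : ℝ :=
  sInf {r : ℝ | 0 ≤ r ∧
    η ≤ (multivariateGaussian 0 (1 - (sigmaMat U c)⁻¹)).real (Metric.closedBall 0 r)}

/-- `I_n = [log n / n, n ^ (m - 1)]`. -/
def scaleInterval (m : ℝ) (n : ℕ) : Set ℝ :=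
  Set.Icc (Real.log n / n) ((n : ℝ) ^ (m - 1))

/-- The marginal likelihood of `c`, up to a factor free of `c`: the density of `N(0, Σ_{n,c})`
at `y`. -/
def margLik {n : ℕ} (U : Matrix (Fin n) (Fin n) ℝ) (y : EuclideanSpace ℝ (Fin n)) (c : ℝ) : ℝ :=
  (sigmaMat U c).det ^ (-(1 / 2) : ℝ) *
    Real.exp (-(1 / 2) * inner ℝ y (Matrix.toEuclideanLin (sigmaMat U c)⁻¹ y))

/-- The inverse gamma density with shape `κ` and scale `τ`, up to a constant. -/
def invGammaWeight (κ τ c : ℝ) : ℝ := c ^ (-1 - κ) * Real.exp (-τ / c)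

/-- Marginal likelihood times prior, as an unnormalised measure on `I_n`. -/
def scalePosteriorUnnorm {n : ℕ} (U : Matrix (Fin n) (Fin n) ℝ) (κ τ m : ℝ)
    (y : EuclideanSpace ℝ (Fin n)) : Measure ℝ :=
  (volume.restrict (scaleInterval m n)).withDensity
    fun c => ENNReal.ofReal (margLik U y c * invGammaWeight κ τ c)

/-- The posterior distribution of the scale `c` given the data `y`, for the inverse gamma prior
truncated to `I_n`. -/
def scalePosterior {n : ℕ} (U : Matrix (Fin n) (Fin n) ℝ) (κ τ m : ℝ)
    (y : EuclideanSpace ℝ (Fin n)) : Measure ℝ :=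
  (scalePosteriorUnnorm U κ τ m y Set.univ)⁻¹ • scalePosteriorUnnorm U κ τ m y

/-- The `α`-quantile of a distribution on the real line. -/
def quantile (μ : Measure ℝ) (α : ℝ) : ℝ := sInf {t : ℝ | α ≤ μ.real (Set.Iic t)}

/-- The hierarchical Bayes credible set: the union, over `c` strictly between the posterior
quantiles of `c` at levels `α₁` and `α₂`, of the credible balls with radius blown up by `M`. -/
def credibleSet {𝒳 : Type*} {n : ℕ} (x : Fin n → 𝒳) (U : Matrix (Fin n) (Fin n) ℝ)
    (κ τ m : ℝ) (y : EuclideanSpace ℝ (Fin n)) (α₁ α₂ η M : ℝ) : Set (𝒳 → ℝ) :=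
  ⋃ c ∈ Set.Ioo (quantile (scalePosterior U κ τ m y) α₁) (quantile (scalePosterior U κ τ m y) α₂),
    {g | ‖designVec x g - postMean U c y‖ < M * credRadius U c η}

/-! ### Deterministic and stochastic terms, in the eigenbasis of `U_n`

`l` are the eigenvalues of `U_n`; `v` and `Z` are the coordinates of the vector of function values
and of the error vector in the eigenbasis. -/

section Terms

variable {ι : Type*} [Fintype ι]

def D1R (l v : ι → ℝ) (c : ℝ) : ℝ := ∑ j, v j ^ 2 / (1 + c * l j) ^ 2

def D2R (l : ι → ℝ) (c : ℝ) : ℝ := ∑ j, (c * l j) ^ 2 / (1 + c * l j) ^ 2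

def D1L (l v : ι → ℝ) (c : ℝ) : ℝ := ∑ j, v j ^ 2 / (1 + c * l j)

def D2L (l : ι → ℝ) (c : ℝ) : ℝ := ∑ j, (Real.log (1 + c * l j) - c * l j / (1 + c * l j))

def DL (l v : ι → ℝ) (c : ℝ) : ℝ := D1L l v c + D2L l c

def R1L (l v Z : ι → ℝ) (c : ℝ) : ℝ := 2 * ∑ j, Z j * v j / (1 + c * l j)

def R2L (l Z : ι → ℝ) (c : ℝ) : ℝ := -∑ j, (Z j ^ 2 - 1) * (c * l j) / (1 + c * l j)

def R3 (l v Z : ι → ℝ) (c : ℝ) : ℝ := -2 * ∑ j, (c * l j) * Z j * v j / (1 + c * l j) ^ 2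

def R4 (l Z : ι → ℝ) (c : ℝ) : ℝ := ∑ j, (c * l j) ^ 2 * (Z j ^ 2 - 1) / (1 + c * l j) ^ 2

/-- The posterior variance `s_n²(c)`. -/
def postVar (l : ι → ℝ) (c : ℝ) : ℝ := ∑ j, c * l j / (1 + c * l j)

/-- `N_n(c)`, distributed as the squared norm of the centred posterior given `c`. -/
def normSqVar (l Z : ι → ℝ) (c : ℝ) : ℝ := ∑ j, c * l j * Z j ^ 2 / (1 + c * l j)

end Terms

/-! ### Asymptotic conditions along a sequence (`k → ∞`) of intervals `I k` -/

/-- `sup_{c ∈ I k} F k c` tends to zero in probability (`F` nonnegative). -/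
def SupTendstoZeroInProb {Ω : Type*} [MeasurableSpace Ω] (P : Measure Ω) (I : ℕ → Set ℝ)
    (F : ℕ → ℝ → Ω → ℝ) : Prop :=
  ∀ ε : ℝ, 0 < ε → Tendsto (fun k => P {ω | ∃ c ∈ I k, ε < F k c ω}) atTop (𝓝 0)

/-- `g ≍ h` uniformly over `I k`. -/
def AsympEquivOn (I : ℕ → Set ℝ) (g h : ℕ → ℝ → ℝ) : Prop :=
  ∃ C₁ C₂ : ℝ, 0 < C₁ ∧ 0 < C₂ ∧
    ∀ᶠ k in atTop, ∀ c ∈ I k, C₁ * h k c ≤ g k c ∧ g k c ≤ C₂ * h k c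

/-- Good bias condition for the functions `D k`. -/
def GoodBias (I : ℕ → Set ℝ) (D : ℕ → ℝ → ℝ) : Prop :=
  ∃ a : ℝ, 0 < a ∧
    ∀ᶠ k in atTop, ∀ c ∈ I k, ∀ K : ℝ, 1 < K → D k (K * c) ≤ K ^ (-a) * D k c

/-- Good variance functions: two-sided polynomial growth, at pairs of points of `I k`. -/
def GoodVariance (I : ℕ → Set ℝ) (D : ℕ → ℝ → ℝ) : Prop :=
  ∃ b B B' : ℝ, 0 < b ∧ 0 < B ∧ 0 < B' ∧
    ∀ᶠ k in atTop, ∀ c ∈ I k, ∀ r : ℝ, 0 < r → r < 1 → r * c ∈ I k →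
      B * r ^ b * D k c ≤ D k (r * c) ∧ D k (r * c) ≤ B' * r ^ b * D k c

/-- There is a minimiser `c` over `(0, ∞)` of `D k c + 2 τ / c` such that `c` and `2 c` belong
to `I k`. -/
def SuitableMinimizer (I : ℕ → Set ℝ) (τ : ℝ) (D : ℕ → ℝ → ℝ) : Prop :=
  ∀ᶠ k in atTop, ∃ c : ℝ, 0 < c ∧ IsMinOn (fun c => D k c + 2 * τ / c) (Set.Ioi 0) c ∧
    c ∈ I k ∧ 2 * c ∈ I k

/-! ### The three eigenvalue conditions

`Fin` counts from zero, so that `j : Fin n` stands for the index `j + 1`. -/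

/-- `λ_{j,n} ≍ n / j^m` for sample sizes `n = N k`. -/
def EigPoly (m : ℝ) (N : ℕ → ℕ) (l : ∀ k, Fin (N k) → ℝ) : Prop :=
  ∃ δ Δ : ℝ, 0 < δ ∧ 0 < Δ ∧ ∀ᶠ k in atTop, ∀ j : Fin (N k),
    δ * (N k / ((j : ℝ) + 1) ^ m) ≤ l k j ∧ l k j ≤ Δ * (N k / ((j : ℝ) + 1) ^ m)

/-- `λ_{i,j,k} ≍ k² / (i^m j^m)`, the sample size being `N k = k²` and the eigenvalues being
enumerated by the pairs `(i, j)`. -/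
def EigTensor (m : ℝ) (N : ℕ → ℕ) (l : ∀ k, Fin (N k) → ℝ) : Prop :=
  ∃ (σ : ∀ k, Fin k × Fin k ≃ Fin (N k)) (δ Δ : ℝ), 0 < δ ∧ 0 < Δ ∧
    ∀ᶠ k : ℕ in atTop, ∀ i j : Fin k,
      δ * ((k : ℝ) ^ 2 / (((i : ℝ) + 1) ^ m * ((j : ℝ) + 1) ^ m)) ≤ l k (σ k (i, j)) ∧
      l k (σ k (i, j)) ≤ Δ * ((k : ℝ) ^ 2 / (((i : ℝ) + 1) ^ m * ((j : ℝ) + 1) ^ m))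

/-- `λ_{i,j,k} ≍ k² / (i² + j²)^m`, the sample size being `N k = k²` and the eigenvalues being
enumerated by the pairs `(i, j)`. -/
def EigSobolev (m : ℝ) (N : ℕ → ℕ) (l : ∀ k, Fin (N k) → ℝ) : Prop :=
  ∃ (σ : ∀ k, Fin k × Fin k ≃ Fin (N k)) (δ Δ : ℝ), 0 < δ ∧ 0 < Δ ∧
    ∀ᶠ k : ℕ in atTop, ∀ i j : Fin k,
      δ * ((k : ℝ) ^ 2 / (((i : ℝ) + 1) ^ 2 + ((j : ℝ) + 1) ^ 2) ^ m) ≤ l k (σ k (i, j)) ∧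
      l k (σ k (i, j)) ≤ Δ * ((k : ℝ) ^ 2 / (((i : ℝ) + 1) ^ 2 + ((j : ℝ) + 1) ^ 2) ^ m)

/-- For all sufficiently large `M`, the credible sets computed from the data
`Y = (f(x_i) + ε_i)_i` contain `f` with probability tending to one, whatever the nontrivial
quantile levels `0 < α₁ < α₂ < 1` and the credible level `η ∈ (0, 1)`. -/
def CoverageHB {𝒳 Ω : Type*} [MeasurableSpace Ω] (P : Measure Ω) (N : ℕ → ℕ)
    (x : ∀ k, Fin (N k) → 𝒳) (U : ∀ k, Matrix (Fin (N k)) (Fin (N k)) ℝ)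
    (ε : ∀ k, Fin (N k) → Ω → ℝ) (κ τ m : ℝ) (f : 𝒳 → ℝ) : Prop :=
  ∃ M₀ : ℝ, ∀ M : ℝ, M₀ ≤ M → ∀ α₁ α₂ η : ℝ, 0 < α₁ → α₁ < α₂ → α₂ < 1 → 0 < η → η < 1 →
    Tendsto (fun k => P {ω | f ∈ credibleSet (x k) (U k) κ τ m
      (WithLp.toLp 2 fun i => f (x k i) + ε k i ω) α₁ α₂ η M}) atTop (𝓝 1)

end

end HBayes

/-! In the eigenbasis of `U_n` everything is diagonal. The posterior density of the scale is a
factor free of `c` times exp(-(E(c) + R(c))/2) c^(-1-κ), where E = `DL` + 2τ/c and R = `R1L` + `R2L`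
is small relative to `DL`. So the posterior of `c` is governed by the deterministic energy E and its
minimiser c₀.

Comparing E at c₀ and 2c₀, the good bias condition shows that bias and penalty at c₀ are at most
multiples of D = `D2L`(c₀); hence E is of order at most D on [c₀, 2c₀] (`energy_le_near_minimizer`).
Call a scale bad if there `D1L` > A `D2L`, for a large constant A. A bad scale lies to the left of
c₀ and has E ≥ L D, with L as large as desired (`le_energy_of_bias_dominates`). Bad scales are
therefore exponentially penalised in D. Since D ≥ log(n c₀) and n c₀ ≥ log n, this also beats the
polynomial prior factor and leaves a posterior mass of order 1 / log n
(`scalePosterior_bias_dominates`).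

The posterior of `c` has no atoms, so an interquantile interval of mass α₂ - α₁ must then contain a
scale that is not bad (`exists_mem_Ioo_quantile`). At such a scale the squared error `D1R` + `R3` +
`R4` + `D2R` is at most a constant times s_n², while r_n² ≥ s_n²/2 because the squared posterior
norm concentrates at s_n². A fixed large M thus covers f (`norm_sub_postMean_lt`), and M depends
neither on the quantile levels nor on η. This is `coverageHB_of_conditions`.

For the concrete eigenvalues, write λ_j ≍ n / q_j^m and x = (nc)^(1/m), so that cλ_j ≍ (x/q_j)^m.
Then `D2L` and s_n² are both of the order of the number of q_j ≤ x, and the three cases reduce to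
counting integers, lattice points under a hyperbola and lattice points in a disc
(`EigRegular.conditions`). The stochastic suprema are bounded on dyadic blocks of scales by a second
moment inequality for a process with smooth coefficients; polynomial growth of `D2L` makes the block
bounds sum geometrically (`supTendstoZeroInProb_of_orthogonal`). -/

namespace HBayes

/-! ### The function `log (1 + x) - x / (1 + x)` -/

/-- The summand of `D2L`. -/
noncomputable def logGap (x : ℝ) : ℝ := Real.log (1 + x) - x / (1 + x)

lemma D2L_eq_sum_logGap {ι : Type*} [Fintype ι] (l : ι → ℝ) (c : ℝ) :
    D2L l c = ∑ j, logGap (c * l j) := rfl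

lemma logGap_zero : logGap 0 = 0 := by simp [logGap]

lemma hasDerivAt_logGap {x : ℝ} (hx : 0 ≤ x) : HasDerivAt logGap (x / (1 + x) ^ 2) x := by
  have h1 : HasDerivAt (fun y : ℝ => 1 + y) 1 x := (hasDerivAt_id x).const_add 1
  have h0 : (1 + x) ≠ 0 := by positivity
  have h := (h1.log h0).sub ((hasDerivAt_id x).div h1 h0)
  refine h.congr_deriv ?_
  simp only [id]
  field_simp
  ring

/-- A function vanishing at `0` with nonnegative derivative on `[0, ∞)` is nonnegative there. -/
lemma nonneg_of_deriv_nonneg {g g' : ℝ → ℝ} (h0 : g 0 = 0)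
    (hg : ∀ x, 0 ≤ x → HasDerivAt g (g' x) x) (hg' : ∀ x, 0 ≤ x → 0 ≤ g' x) {x : ℝ}
    (hx : 0 ≤ x) : 0 ≤ g x := by
  have hm : MonotoneOn g (Ici 0) := by
    refine monotoneOn_of_hasDerivWithinAt_nonneg (f' := g') (convex_Ici 0)
      (fun y hy => (hg y hy).continuousAt.continuousWithinAt) ?_ ?_
    · intro y hy
      exact (hg y (interior_subset hy)).hasDerivWithinAt
    · intro y hy
      exact hg' y (interior_subset hy)
  simpa [h0] using hm (mem_Ici.2 le_rfl) (mem_Ici.2 hx) hx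

lemma logGap_nonneg {x : ℝ} (hx : 0 ≤ x) : 0 ≤ logGap x :=
  nonneg_of_deriv_nonneg logGap_zero (fun _ h => hasDerivAt_logGap h)
    (fun x h => by positivity) hx

lemma logGap_mono {x y : ℝ} (hx : 0 ≤ x) (hxy : x ≤ y) : logGap x ≤ logGap y := by
  have hm : MonotoneOn logGap (Ici 0) := by
    refine monotoneOn_of_hasDerivWithinAt_nonneg (f' := fun x => x / (1 + x) ^ 2) (convex_Ici 0)
      (fun y hy => (hasDerivAt_logGap hy).continuousAt.continuousWithinAt) ?_ ?_
    · intro y hy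
      exact (hasDerivAt_logGap (interior_subset hy)).hasDerivWithinAt
    · intro y hy
      have : 0 ≤ y := interior_subset (s := Ici (0 : ℝ)) hy
      positivity
  exact hm hx (mem_Ici.2 (hx.trans hxy)) hxy

lemma logGap_pos {x : ℝ} (hx : 0 < x) : 0 < logGap x := by
  have h := Real.log_lt_sub_one_of_pos (x := (1 + x)⁻¹) (by positivity)
    (by rw [Ne, inv_eq_one]; linarith)
  rw [Real.log_inv] at h
  have : x / (1 + x) = 1 - (1 + x)⁻¹ := by field_simp; ring
  rw [logGap, this]
  linarith

/-- The difference of the two sides has x-derivative r²x((1 + rx)⁻² - (1 + x)⁻²) ≥ 0. This bounds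
the growth of `D2L` by a quadratic rate without any condition on the eigenvalues. -/
lemma sq_mul_logGap_le {r x : ℝ} (hr : 0 ≤ r) (hr1 : r ≤ 1) (hx : 0 ≤ x) :
    r ^ 2 * logGap x ≤ logGap (r * x) := by
  have key := nonneg_of_deriv_nonneg (g := fun x => logGap (r * x) - r ^ 2 * logGap x)
    (g' := fun x => r * x / (1 + r * x) ^ 2 * r - r ^ 2 * (x / (1 + x) ^ 2))
    (by simp [logGap_zero]) ?_ ?_ hx
  · linarith
  · intro y hy
    have h1 : HasDerivAt (fun y => r * y) r y := by
      simpa using (hasDerivAt_id y).const_mul r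
    exact ((hasDerivAt_logGap (mul_nonneg hr hy)).comp y h1).sub
      ((hasDerivAt_logGap hy).const_mul _)
  · intro y hy
    have h1 : r * y ≤ y := mul_le_of_le_one_left hy hr1
    have h2 : y / (1 + y) ^ 2 ≤ y / (1 + r * y) ^ 2 := by
      have : 0 ≤ r * y := mul_nonneg hr hy
      gcongr
    have h3 : r * y / (1 + r * y) ^ 2 * r = r ^ 2 * (y / (1 + r * y) ^ 2) := by ring
    rw [h3]
    nlinarith [sq_nonneg r]

/-- The left side has derivative x/(1 + x)³, at most x/(1 + x)². Through this bound `D2L` dominates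
the squared coefficients of the chi-square terms. -/
lemma half_sq_le_logGap {x : ℝ} (hx : 0 ≤ x) : (x / (1 + x)) ^ 2 / 2 ≤ logGap x := by
  have key := nonneg_of_deriv_nonneg (g := fun x => logGap x - (x / (1 + x)) ^ 2 / 2)
    (g' := fun x => x / (1 + x) ^ 2 - x / (1 + x) ^ 3)
    (by simp [logGap_zero]) ?_ ?_ hx
  · linarith
  · intro y hy
    have h1 : HasDerivAt (fun y : ℝ => 1 + y) 1 y := (hasDerivAt_id y).const_add 1
    have h0 : (1 + y) ≠ 0 := by positivity
    have h := (hasDerivAt_logGap hy).sub ((((hasDerivAt_id y).div h1 h0).pow 2).div_const 2)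
    refine h.congr_deriv ?_
    simp only [id, Pi.div_apply, Nat.cast_ofNat, Nat.add_one_sub_one, pow_one]
    field_simp
    ring
  · intro y hy
    rw [sub_nonneg]
    have : (1 + y) ^ 2 ≤ (1 + y) ^ 3 := pow_le_pow_right₀ (by linarith) (by norm_num)
    gcongr

lemma logGap_le_sq {x : ℝ} (hx : 0 ≤ x) : logGap x ≤ x ^ 2 := by
  have key := nonneg_of_deriv_nonneg (g := fun x => x ^ 2 - logGap x)
    (g' := fun x => 2 * x - x / (1 + x) ^ 2)
    (by simp [logGap_zero]) ?_ ?_ hx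
  · linarith
  · intro y hy
    have h := (hasDerivAt_pow 2 y).sub (hasDerivAt_logGap hy)
    simp only [Nat.cast_ofNat, Nat.add_one_sub_one, pow_one] at h
    exact h
  · intro y hy
    have : y / (1 + y) ^ 2 ≤ y := div_le_self hy (one_le_pow₀ (by linarith))
    linarith

lemma logGap_le_log {x : ℝ} (hx : 0 ≤ x) : logGap x ≤ Real.log (1 + x) := by
  have : 0 ≤ x / (1 + x) := by positivity
  rw [logGap]; linarith

/-! ### Monotonicity and comparison of the deterministic terms -/

section Terms

variable {ι : Type*} [Fintype ι] {l v : ι → ℝ} {c d r : ℝ}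

lemma D1L_nonneg (hl : ∀ j, 0 ≤ l j) (hc : 0 ≤ c) : 0 ≤ D1L l v c :=
  Finset.sum_nonneg fun j _ => by have := mul_nonneg hc (hl j); positivity

lemma D2L_nonneg (hl : ∀ j, 0 ≤ l j) (hc : 0 ≤ c) : 0 ≤ D2L l c :=
  Finset.sum_nonneg fun j _ => logGap_nonneg (mul_nonneg hc (hl j))

lemma D1L_anti (hl : ∀ j, 0 ≤ l j) (hc : 0 ≤ c) (hcd : c ≤ d) : D1L l v d ≤ D1L l v c :=
  Finset.sum_le_sum fun j _ => by
    have := mul_nonneg hc (hl j)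
    have := mul_le_mul_of_nonneg_right hcd (hl j)
    gcongr

lemma D2L_mono (hl : ∀ j, 0 ≤ l j) (hc : 0 ≤ c) (hcd : c ≤ d) : D2L l c ≤ D2L l d :=
  Finset.sum_le_sum fun j _ => logGap_mono (mul_nonneg hc (hl j))
    (mul_le_mul_of_nonneg_right hcd (hl j))

lemma sq_mul_D2L_le (hl : ∀ j, 0 ≤ l j) (hc : 0 ≤ c) (hr : 0 ≤ r) (hr1 : r ≤ 1) :
    r ^ 2 * D2L l c ≤ D2L l (r * c) := by
  rw [D2L_eq_sum_logGap, D2L_eq_sum_logGap, Finset.mul_sum]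
  refine Finset.sum_le_sum fun j _ => ?_
  rw [mul_assoc]
  exact sq_mul_logGap_le hr hr1 (mul_nonneg hc (hl j))

lemma D2L_two_mul_le (hl : ∀ j, 0 ≤ l j) (hc : 0 ≤ c) : D2L l (2 * c) ≤ 4 * D2L l c := by
  have := sq_mul_D2L_le (c := 2 * c) (r := 1 / 2) hl (by positivity) (by norm_num) (by norm_num)
  rw [show 1 / 2 * (2 * c) = c by ring] at this
  linarith

lemma D1L_le_two_mul (hl : ∀ j, 0 ≤ l j) (hc : 0 ≤ c) : D1L l v c ≤ 2 * D1L l v (2 * c) := by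
  rw [D1L, D1L, Finset.mul_sum]
  refine Finset.sum_le_sum fun j _ => ?_
  have h := mul_nonneg hc (hl j)
  rw [mul_div_assoc', div_le_div_iff₀ (by positivity) (by nlinarith)]
  nlinarith [mul_nonneg h (sq_nonneg (v j)), sq_nonneg (v j)]

lemma D1R_le_D1L (hl : ∀ j, 0 ≤ l j) (hc : 0 ≤ c) : D1R l v c ≤ D1L l v c :=
  Finset.sum_le_sum fun j _ => by
    have := mul_nonneg hc (hl j)
    gcongr
    nlinarith

lemma D2R_le_postVar (hl : ∀ j, 0 ≤ l j) (hc : 0 ≤ c) : D2R l c ≤ postVar l c :=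
  Finset.sum_le_sum fun j _ => by
    have := mul_nonneg hc (hl j)
    rw [div_le_div_iff₀ (by positivity) (by positivity)]
    nlinarith [mul_nonneg this (by positivity : 0 ≤ 1 + c * l j)]

lemma DL_nonneg (hl : ∀ j, 0 ≤ l j) (hc : 0 ≤ c) : 0 ≤ DL l v c :=
  add_nonneg (D1L_nonneg hl hc) (D2L_nonneg hl hc)

lemma D2L_le_DL (hl : ∀ j, 0 ≤ l j) (hc : 0 ≤ c) : D2L l c ≤ DL l v c :=
  le_add_of_nonneg_left (D1L_nonneg hl hc)

end Terms

/-! ### The penalised deterministic energy and its minimiser -/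

section Energy

variable {ι : Type*} [Fintype ι] {l v : ι → ℝ} {a τ c₀ : ℝ}

/-- At a minimiser of the penalised deterministic term, the bias and the penalty are dominated by
the variance term. -/
lemma terms_le_at_minimizer (hl : ∀ j, 0 ≤ l j) (ha : 0 < a) (hτ : 0 < τ) (hc₀ : 0 < c₀)
    (hmin : ∀ c, 0 < c → DL l v c₀ + 2 * τ / c₀ ≤ DL l v c + 2 * τ / c)
    (hbias : D1L l v (2 * c₀) ≤ 2 ^ (-a) * D1L l v c₀) :
    D1L l v c₀ ≤ 3 / (1 - 2 ^ (-a)) * D2L l c₀ ∧ τ / c₀ ≤ 3 * D2L l c₀ := by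
  -- Passing from c₀ to 2c₀ gains τ/c₀ in the penalty and a fraction 1 - 2^(-a) of the bias, and
  -- costs at most 3 `D2L`(c₀). By minimality the gain cannot exceed the cost.
  have h2 := hmin (2 * c₀) (by positivity)
  have h3 := D2L_two_mul_le hl hc₀.le
  have h4 : 2 * τ / (2 * c₀) = τ / c₀ := by field_simp
  have h5 : 2 * τ / c₀ = 2 * (τ / c₀) := by ring
  have h6 : (2 : ℝ) ^ (-a) < 1 := Real.rpow_lt_one_of_one_lt_of_neg (by norm_num) (by linarith)
  have h7 : 0 < τ / c₀ := by positivity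
  have h8 := D1L_nonneg (v := v) hl hc₀.le
  have key : (1 - 2 ^ (-a)) * D1L l v c₀ + τ / c₀ ≤ 3 * D2L l c₀ := by
    simp only [DL] at h2
    rw [h4, h5] at h2
    linarith
  constructor
  · rw [div_mul_eq_mul_div, le_div_iff₀ (by linarith)]
    linarith
  · nlinarith

/-- The penalised deterministic term near its minimiser. -/
lemma energy_le_near_minimizer (hl : ∀ j, 0 ≤ l j) (ha : 0 < a) (hτ : 0 < τ) (hc₀ : 0 < c₀)
    (hmin : ∀ c, 0 < c → DL l v c₀ + 2 * τ / c₀ ≤ DL l v c + 2 * τ / c)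
    (hbias : D1L l v (2 * c₀) ≤ 2 ^ (-a) * D1L l v c₀) {c : ℝ} (hc : c ∈ Icc c₀ (2 * c₀)) :
    DL l v c + 2 * τ / c ≤ (3 / (1 - 2 ^ (-a)) + 10) * D2L l c₀ := by
  -- The 10 is 4 from doubling the scale in `D2L` plus 6 from the penalty 2τ/c.
  obtain ⟨h1, h2⟩ := terms_le_at_minimizer hl ha hτ hc₀ hmin hbias
  have h3 := D1L_anti (v := v) hl hc₀.le hc.1
  have h4 := (D2L_mono hl (hc₀.le.trans hc.1) hc.2).trans (D2L_two_mul_le hl hc₀.le)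
  have h5 : τ / c ≤ τ / c₀ := by have := hc.1; gcongr
  have h6 : 2 * τ / c = 2 * (τ / c) := by ring
  rw [DL, h6, add_mul]
  linarith

/-- Where the bias dominates the variance term, the penalised deterministic term is large. -/
lemma le_energy_of_bias_dominates (hl : ∀ j, 0 ≤ l j) {α β K T L : ℝ} (hα : 0 < α) (ha : 0 < a)
    (hτ : 0 < τ) (hK : 1 < K) (hT : 1 < T) (hL : 1 ≤ L) (hTL : 2 * L ≤ T) (hTa : 2 * L ≤ T ^ a)
    (hL' : 3 / (1 - 2 ^ (-a)) ≤ L) (hc₀ : c₀ ∈ Icc α β)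
    (hmin : ∀ c, 0 < c → DL l v c₀ + 2 * τ / c₀ ≤ DL l v c + 2 * τ / c)
    (hbias : ∀ c ∈ Icc α β, ∀ K : ℝ, 1 < K → D1L l v (K * c) ≤ K ^ (-a) * D1L l v c)
    (hgrowth : ∀ c ∈ Icc α β, c / K ∈ Icc α β → D2L l (c / K) ≤ 1 / 2 * D2L l c)
    {c : ℝ} (hc : c ∈ Icc α β) (hbad : L * (K * T) ^ 2 * D2L l c < D1L l v c) :
    L * D2L l c₀ ≤ DL l v c + 2 * τ / c := by
  have hc₀0 : 0 < c₀ := hα.trans_le hc₀.1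
  have hc0 : 0 < c := hα.trans_le hc.1
  have hKT : 1 < K * T := by nlinarith
  -- The bias decreases and the variance term increases in c, so the domination of bias by variance
  -- at c₀ persists to its right.
  have hlt : c < c₀ := by
    by_contra! h
    have h1 := (terms_le_at_minimizer hl ha hτ hc₀0 hmin (hbias _ hc₀ 2 (by norm_num))).1
    have h2 := D1L_anti (v := v) hl hc₀0.le h
    have h3 := D2L_mono hl hc₀0.le h
    have h4 := D2L_nonneg hl hc₀0.le
    have h5 : L ≤ L * (K * T) ^ 2 := le_mul_of_one_le_right (by linarith) (one_le_pow₀ hKT.le)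
    have h6 : 0 ≤ L * (K * T) ^ 2 := by positivity
    nlinarith [mul_le_mul hL' h3 h4 (by linarith), mul_le_mul_of_nonneg_right h5 (h4.trans h3),
      mul_le_mul_of_nonneg_right hL' h4]
  have hτc : 0 < 2 * τ / c := by positivity
  -- Within a factor KT of c₀ the quadratic bound loses only (KT)² in `D2L`, which the factor (KT)²
  -- in the definition of a bad scale compensates. Further to the left, the bias and penalty at c₀/K
  -- are amplified.
  by_cases hcase : c₀ / (K * T) ≤ c
  · have h1 : (K * T)⁻¹ ^ 2 * D2L l c₀ ≤ D2L l c := by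
      refine (sq_mul_D2L_le hl hc₀0.le (by positivity) (inv_le_one_of_one_le₀ hKT.le)).trans ?_
      refine D2L_mono hl (by positivity) ?_
      rwa [inv_mul_eq_div]
    have h2 : L * D2L l c₀ = L * (K * T) ^ 2 * ((K * T)⁻¹ ^ 2 * D2L l c₀) := by
      field_simp
    have h3 : L * (K * T) ^ 2 * ((K * T)⁻¹ ^ 2 * D2L l c₀) ≤ L * (K * T) ^ 2 * D2L l c := by
      gcongr
    have h4 := D2L_nonneg hl hc0.le
    rw [DL]; linarith
  · push Not at hcase
    have hle : c₀ / (K * T) ≤ c₀ / K := by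
      apply div_le_div_of_nonneg_left hc₀0.le (by positivity)
      nlinarith
    have hle' : c₀ / K ≤ c₀ := div_le_self hc₀0.le hK.le
    have hm1 : c₀ / (K * T) ∈ Icc α β :=
      ⟨hc.1.trans hcase.le, (hle.trans hle').trans hc₀.2⟩
    have hm2 : c₀ / K ∈ Icc α β := ⟨hm1.1.trans hle, hle'.trans hc₀.2⟩
    -- At c₀/K the variance term has at least halved, so minimality forces bias plus penalty there
    -- to be at least `D2L`(c₀)/2. Another factor T to the left multiplies the bias by T^a and the
    -- penalty by T, both at least 2L.
    have h1 := hmin (c₀ / K) (by positivity)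
    have h2 := hgrowth c₀ hc₀ hm2
    have h3 := hbias _ hm1 T hT
    rw [show T * (c₀ / (K * T)) = c₀ / K by field_simp, Real.rpow_neg (by positivity),
      inv_mul_eq_div, le_div_iff₀ (by positivity)] at h3
    have h4 := D1L_anti (v := v) hl hc0.le hcase.le
    have h5 : T * (2 * τ / (c₀ / K)) ≤ 2 * τ / c := by
      rw [show T * (2 * τ / (c₀ / K)) = 2 * τ / (c₀ / (K * T)) by field_simp]
      gcongr
    have h6 := D1L_nonneg (v := v) hl hc₀0.le
    have h7 := D1L_nonneg (v := v) hl (c := c₀ / K) (by positivity)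
    have h8 : 0 < 2 * τ / c₀ := by positivity
    have h9 := D2L_nonneg hl hc0.le
    have h10 : 0 < 2 * τ / (c₀ / K) := by positivity
    simp only [DL] at h1 ⊢
    nlinarith [mul_le_mul_of_nonneg_right hTL h10.le, mul_le_mul_of_nonneg_left hTa h7]

end Energy

/-! ### Diagonalisation in the eigenbasis of the prior covariance -/

section LinearAlgebra

variable {n : ℕ} {A U : Matrix (Fin n) (Fin n) ℝ} {a l : Fin n → ℝ} {c : ℝ}
  {e : OrthonormalBasis (Fin n) ℝ (EuclideanSpace ℝ (Fin n))}

lemma inner_toEuclideanLin_of_eigenbasis (h : ∀ j, Matrix.toEuclideanLin A (e j) = a j • e j)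
    (j : Fin n) (y : EuclideanSpace ℝ (Fin n)) :
    inner ℝ (e j) (Matrix.toEuclideanLin A y) = a j * inner ℝ (e j) y := by
  conv_lhs => rw [← e.sum_repr' y]
  simp only [map_sum, map_smul, h, inner_sum, inner_smul_right, e.inner_eq_ite]
  simp [mul_comm]

lemma inner_self_toEuclideanLin_of_eigenbasis
    (h : ∀ j, Matrix.toEuclideanLin A (e j) = a j • e j) (y : EuclideanSpace ℝ (Fin n)) :
    inner ℝ y (Matrix.toEuclideanLin A y) = ∑ j, a j * inner ℝ (e j) y ^ 2 := by
  rw [← e.sum_inner_mul_inner y]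
  refine Finset.sum_congr rfl fun j _ => ?_
  rw [inner_toEuclideanLin_of_eigenbasis h, real_inner_comm]
  ring

lemma det_of_eigenbasis (h : ∀ j, Matrix.toEuclideanLin A (e j) = a j • e j) :
    A.det = ∏ j, a j := by
  have h1 : LinearMap.det (Matrix.toEuclideanLin A) = A.det := by
    exact LinearMap.det_toLin (PiLp.basisFun 2 ℝ (Fin n)) A
  have h2 : LinearMap.toMatrix e.toBasis e.toBasis (Matrix.toEuclideanLin A)
      = Matrix.diagonal a := by
    ext i j
    rw [LinearMap.toMatrix_apply]
    simp only [OrthonormalBasis.coe_toBasis, h, map_smul, Finsupp.smul_apply,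
      OrthonormalBasis.coe_toBasis_repr_apply, OrthonormalBasis.repr_self]
    by_cases hij : i = j
    · subst hij; simp
    · simp [hij]
  rw [← h1, ← LinearMap.det_toMatrix e.toBasis, h2, Matrix.det_diagonal]

lemma posSemidef_of_eigenbasis (h : ∀ j, Matrix.toEuclideanLin A (e j) = a j • e j)
    (ha : ∀ j, 0 ≤ a j) : A.PosSemidef := by
  rw [← Matrix.isPositive_toEuclideanLin_iff]
  constructor
  · intro x y
    rw [← e.sum_inner_mul_inner x, ← e.sum_inner_mul_inner (Matrix.toEuclideanLin A x)]
    refine Finset.sum_congr rfl fun j _ => ?_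
    rw [inner_toEuclideanLin_of_eigenbasis h, real_inner_comm,
      inner_toEuclideanLin_of_eigenbasis h, real_inner_comm x]
    ring
  · intro x
    rw [real_inner_comm, inner_self_toEuclideanLin_of_eigenbasis h]
    have : 0 ≤ ∑ j, a j * inner ℝ (e j) x ^ 2 :=
      Finset.sum_nonneg fun j _ => mul_nonneg (ha j) (sq_nonneg _)
    simpa using this

lemma eigenvalue_nonneg_of_posSemidef (hA : A.PosSemidef)
    (h : ∀ j, Matrix.toEuclideanLin A (e j) = a j • e j) (j : Fin n) : 0 ≤ a j := by
  have h1 := (Matrix.isPositive_toEuclideanLin_iff.2 hA).2 (e j)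
  rw [h, inner_smul_left, e.inner_eq_ite] at h1
  simpa using h1

lemma toEuclideanLin_sigmaMat (h : ∀ j, Matrix.toEuclideanLin U (e j) = l j • e j) (c : ℝ)
    (j : Fin n) :
    Matrix.toEuclideanLin (sigmaMat U c) (e j) = (1 + c * l j) • e j := by
  have h1 : Matrix.toEuclideanLin (1 : Matrix (Fin n) (Fin n) ℝ) (e j) = e j := by
    simp
  rw [sigmaMat, map_add, map_smul, LinearMap.add_apply, LinearMap.smul_apply, h, h1, add_smul,
    one_smul, mul_smul]

lemma toEuclideanLin_sigmaMat_inv (h : ∀ j, Matrix.toEuclideanLin U (e j) = l j • e j)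
    (hl : ∀ j, 0 ≤ l j) (hc : 0 ≤ c) (j : Fin n) :
    Matrix.toEuclideanLin (sigmaMat U c)⁻¹ (e j) = (1 + c * l j)⁻¹ • e j := by
  have hpos : ∀ j, 0 < 1 + c * l j := fun j => by have := mul_nonneg hc (hl j); linarith
  have hdet : IsUnit (sigmaMat U c).det := by
    rw [det_of_eigenbasis (toEuclideanLin_sigmaMat h c), isUnit_iff_ne_zero]
    exact (Finset.prod_pos fun j _ => hpos j).ne'
  have h1 := toEuclideanLin_sigmaMat h c j
  have h2 : Matrix.toEuclideanLin (sigmaMat U c)⁻¹ (Matrix.toEuclideanLin (sigmaMat U c) (e j))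
      = e j := by
    simp only [Matrix.toLpLin_apply, Matrix.mulVec_mulVec, Matrix.nonsing_inv_mul _ hdet,
      Matrix.one_mulVec, WithLp.toLp_ofLp]
  rw [h1, map_smul] at h2
  rw [eq_inv_smul_iff₀ (hpos j).ne', h2]

lemma toEuclideanLin_one_sub_sigmaMat_inv
    (h : ∀ j, Matrix.toEuclideanLin U (e j) = l j • e j)
    (hl : ∀ j, 0 ≤ l j) (hc : 0 ≤ c) (j : Fin n) :
    Matrix.toEuclideanLin (1 - (sigmaMat U c)⁻¹) (e j) = (c * l j / (1 + c * l j)) • e j := by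
  have h1 : Matrix.toEuclideanLin (1 : Matrix (Fin n) (Fin n) ℝ) (e j) = e j := by
    simp
  have h0 : 1 + c * l j ≠ 0 := by have := mul_nonneg hc (hl j); positivity
  have h2 : c * l j / (1 + c * l j) = 1 - (1 + c * l j)⁻¹ := by field_simp; ring
  rw [map_sub, LinearMap.sub_apply, toEuclideanLin_sigmaMat_inv h hl hc, h1, h2, sub_smul,
    one_smul]

lemma posSemidef_one_sub_sigmaMat_inv (h : ∀ j, Matrix.toEuclideanLin U (e j) = l j • e j)
    (hl : ∀ j, 0 ≤ l j) (hc : 0 ≤ c) : (1 - (sigmaMat U c)⁻¹).PosSemidef :=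
  posSemidef_of_eigenbasis (toEuclideanLin_one_sub_sigmaMat_inv h hl hc)
    fun j => by have := mul_nonneg hc (hl j); positivity

/-- Bias-variance decomposition of the squared error of the posterior mean. -/
lemma norm_sub_postMean_sq (h : ∀ j, Matrix.toEuclideanLin U (e j) = l j • e j)
    (hl : ∀ j, 0 ≤ l j) (hc : 0 ≤ c) {θ y : EuclideanSpace ℝ (Fin n)} {v Z : Fin n → ℝ}
    (hv : ∀ j, v j = inner ℝ (e j) θ) (hZ : ∀ j, inner ℝ (e j) y = v j + Z j) :
    ‖θ - postMean U c y‖ ^ 2 = D1R l v c + R3 l v Z c + R4 l Z c + D2R l c := by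
  rw [← e.sum_sq_norm_inner_right, D1R, R3, R4, D2R, Finset.mul_sum, ← Finset.sum_add_distrib,
    ← Finset.sum_add_distrib, ← Finset.sum_add_distrib]
  refine Finset.sum_congr rfl fun j _ => ?_
  have h0 : 1 + c * l j ≠ 0 := by have := mul_nonneg hc (hl j); positivity
  rw [Real.norm_eq_abs, sq_abs, inner_sub_right, postMean,
    inner_toEuclideanLin_of_eigenbasis (toEuclideanLin_one_sub_sigmaMat_inv h hl hc), hZ, ← hv]
  field_simp
  ring

/-- The marginal likelihood in terms of the deterministic and stochastic terms. -/
lemma margLik_eq_exp (h : ∀ j, Matrix.toEuclideanLin U (e j) = l j • e j)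
    (hl : ∀ j, 0 ≤ l j) (hc : 0 ≤ c) {y : EuclideanSpace ℝ (Fin n)} {v Z : Fin n → ℝ}
    (hZ : ∀ j, inner ℝ (e j) y = v j + Z j) :
    margLik U y c = Real.exp (-(1 / 2) * ∑ j, Z j ^ 2) *
      Real.exp (-(1 / 2) * (DL l v c + (R1L l v Z c + R2L l Z c))) := by
  have hpos : ∀ j, 0 < 1 + c * l j := fun j => by have := mul_nonneg hc (hl j); linarith
  rw [margLik, det_of_eigenbasis (toEuclideanLin_sigmaMat h c),
    inner_self_toEuclideanLin_of_eigenbasis (toEuclideanLin_sigmaMat_inv h hl hc),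
    Real.rpow_def_of_pos (Finset.prod_pos fun j _ => hpos j),
    Real.log_prod fun j _ => (hpos j).ne', ← Real.exp_add, ← Real.exp_add]
  congr 1
  rw [mul_comm _ (-(1 / 2) : ℝ), ← mul_add, ← mul_add]
  congr 1
  rw [DL, D1L, D2L, R1L, R2L, Finset.mul_sum, ← Finset.sum_neg_distrib, ← Finset.sum_add_distrib,
    ← Finset.sum_add_distrib, ← Finset.sum_add_distrib, ← Finset.sum_add_distrib,
    ← Finset.sum_add_distrib]
  refine Finset.sum_congr rfl fun j _ => ?_
  have h0 := (hpos j).ne'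
  rw [hZ]
  field_simp
  ring

end LinearAlgebra

/-! ### Gaussian vectors and the credible radius -/

section Gaussian

open scoped MatrixOrder

variable {n : ℕ}

/-- The quadratic form at `a` is the variance of ∑ aᵢ W(xᵢ). Gaussianity enters only through square
integrability. -/
lemma posSemidef_priorCov {𝒳 Ω' : Type*} [MeasurableSpace Ω'] {Q : Measure Ω'}
    [IsProbabilityMeasure Q] {W : 𝒳 → Ω' → ℝ} (hW : IsGaussianProcess W Q) (x : Fin n → 𝒳) :
    (priorCov W Q x).PosSemidef := by
  have hmem : ∀ z, MemLp (W z) 2 Q := fun z => (hW.hasGaussianLaw_eval z).memLp_two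
  rw [Matrix.posSemidef_iff_dotProduct_mulVec]
  refine ⟨?_, fun a => ?_⟩
  · ext i j
    simp [priorCov, Matrix.conjTranspose_apply, covariance_comm]
  · have h1 : star a ⬝ᵥ (priorCov W Q x).mulVec a
        = cov[fun ω => ∑ i, a i * W (x i) ω, fun ω => ∑ i, a i * W (x i) ω; Q] := by
      rw [covariance_fun_sum_fun_sum (fun i => (hmem _).const_mul _)
        (fun i => (hmem _).const_mul _)]
      simp only [covariance_const_mul_left, covariance_const_mul_right, dotProduct,
        Matrix.mulVec, Finset.mul_sum, priorCov, Matrix.of_apply, Pi.star_apply, star_trivial]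
      refine Finset.sum_congr rfl fun i _ => Finset.sum_congr rfl fun j _ => ?_
      ring
    rw [h1, covariance_self]
    · exact variance_nonneg _ _
    · exact Finset.aemeasurable_fun_sum _ fun i _ =>
        ((hW.aemeasurable (x i)).const_mul _)

variable {Ω : Type*} [MeasurableSpace Ω] {P : Measure Ω} {ε : Fin n → Ω → ℝ}

lemma hasLaw_toLp_stdGaussian [IsProbabilityMeasure P] (hε : ∀ i, HasLaw (ε i) (gaussianReal 0 1) P)
    (hindep : iIndepFun ε P) :
    HasLaw (fun ω => WithLp.toLp 2 fun i => ε i ω)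
      (stdGaussian (EuclideanSpace ℝ (Fin n))) P where
  aemeasurable := by
    have : AEMeasurable (fun ω i => ε i ω) P :=
      aemeasurable_pi_lambda _ fun i => (hε i).aemeasurable
    exact (WithLp.measurable_toLp 2 _).comp_aemeasurable this
  map_eq := by
    have h0 : AEMeasurable (fun ω i => ε i ω) P :=
      aemeasurable_pi_lambda _ fun i => (hε i).aemeasurable
    have h1 := (iIndepFun_iff_map_fun_eq_pi_map fun i => (hε i).aemeasurable).1 hindep
    simp only [(hε _).map_eq] at h1
    rw [← map_pi_eq_stdGaussian, ← h1, AEMeasurable.map_map_of_aemeasurable _ h0]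
    · rfl
    · exact (WithLp.measurable_toLp 2 _).aemeasurable

/-- The coordinates of a standard Gaussian vector in an orthonormal basis. -/
lemma hasLaw_coord (e : OrthonormalBasis (Fin n) ℝ (EuclideanSpace ℝ (Fin n)))
    {ξ : Ω → EuclideanSpace ℝ (Fin n)} (hξ : HasLaw ξ (stdGaussian _) P) :
    HasLaw (fun ω j => inner ℝ (e j) (ξ ω)) (Measure.pi fun _ => gaussianReal 0 1) P where
  aemeasurable := by
    have : Measurable fun (y : EuclideanSpace ℝ (Fin n)) (j : Fin n) => inner ℝ (e j) y := by
      fun_prop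
    exact this.comp_aemeasurable hξ.aemeasurable
  map_eq := by
    have hm : Measurable fun (y : EuclideanSpace ℝ (Fin n)) (j : Fin n) => inner ℝ (e j) y := by
      fun_prop
    have h1 := AEMeasurable.map_map_of_aemeasurable hm.aemeasurable hξ.aemeasurable
    rw [hξ.map_eq, stdGaussian_eq_map_pi_orthonormalBasis e, Measure.map_map hm (by fun_prop)] at h1
    have h2 : ((fun (y : EuclideanSpace ℝ (Fin n)) (j : Fin n) => inner ℝ (e j) y) ∘
        fun x : Fin n → ℝ => ∑ i, x i • e i) = id := by
      ext x j
      simp [inner_sum, inner_smul_right, e.inner_eq_ite]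
    rw [h2, Measure.map_id] at h1
    exact h1.symm

/-- The root is self-adjoint, so one copy moves across the inner product. Since
`multivariateGaussian` is the image of a standard Gaussian under this root, norms under it depend on
`S` alone and the root need not be diagonalised. -/
lemma norm_sqrt_apply_sq {S : Matrix (Fin n) (Fin n) ℝ} (hS : S.PosSemidef)
    (y : EuclideanSpace ℝ (Fin n)) :
    ‖Matrix.toEuclideanCLM (𝕜 := ℝ) (CFC.sqrt S) y‖ ^ 2
      = inner ℝ y (Matrix.toEuclideanLin S y) := by
  have h1 : CFC.sqrt S * CFC.sqrt S = S := CFC.sqrt_mul_sqrt_self _ hS.nonneg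
  have h2 : IsSelfAdjoint (Matrix.toEuclideanCLM (𝕜 := ℝ) (CFC.sqrt S)) :=
    (CFC.sqrt_nonneg S).isSelfAdjoint.map _
  rw [← real_inner_self_eq_norm_sq, ← ContinuousLinearMap.adjoint_inner_right, h2.adjoint_eq,
    ← ContinuousLinearMap.comp_apply, ← ContinuousLinearMap.mul_def, ← map_mul, h1]
  rfl

variable {U : Matrix (Fin n) (Fin n) ℝ} {l : Fin n → ℝ} {c : ℝ}
  {e : OrthonormalBasis (Fin n) ℝ (EuclideanSpace ℝ (Fin n))}

/-- The squared norm of the centred posterior is distributed as `normSqVar`. -/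
lemma multivariateGaussian_closedBall (h : ∀ j, Matrix.toEuclideanLin U (e j) = l j • e j)
    (hl : ∀ j, 0 ≤ l j) (hc : 0 ≤ c) {ξ : Ω → EuclideanSpace ℝ (Fin n)}
    (hξ : HasLaw ξ (stdGaussian _) P) {r : ℝ} (hr : 0 ≤ r) :
    multivariateGaussian 0 (1 - (sigmaMat U c)⁻¹) (Metric.closedBall 0 r)
      = P {ω | normSqVar l (fun j => inner ℝ (e j) (ξ ω)) c ≤ r ^ 2} := by
  have hS := posSemidef_one_sub_sigmaMat_inv h hl hc
  have hm : Measurable fun x : EuclideanSpace ℝ (Fin n) =>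
      (0 : EuclideanSpace ℝ (Fin n)) +
        Matrix.toEuclideanCLM (𝕜 := ℝ) (CFC.sqrt (1 - (sigmaMat U c)⁻¹)) x := by fun_prop
  rw [multivariateGaussian, Measure.map_apply hm Metric.isClosed_closedBall.measurableSet,
    ← hξ.map_eq, Measure.map_apply_of_aemeasurable hξ.aemeasurable
      (hm Metric.isClosed_closedBall.measurableSet)]
  congr 1
  ext ω
  simp only [mem_preimage, zero_add, mem_closedBall_zero_iff, mem_ofPred_eq]
  rw [← pow_le_pow_iff_left₀ (norm_nonneg _) hr two_ne_zero, norm_sqrt_apply_sq hS,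
    inner_self_toEuclideanLin_of_eigenbasis (toEuclideanLin_one_sub_sigmaMat_inv h hl hc),
    normSqVar]
  simp only [div_mul_eq_mul_div]

/-- Lower bound for the quantile radius. -/
lemma le_credRadius {η ρ : ℝ} (hη : η < 1)
    (h : ∀ r, 0 ≤ r → r < ρ →
      (multivariateGaussian 0 (1 - (sigmaMat U c)⁻¹)).real (Metric.closedBall 0 r) < η) :
    ρ ≤ credRadius U c η := by
  refine le_csInf ?_ ?_
  -- The set defining the quantile must be nonempty, since `sInf ∅ = 0` would spoil the lower bound;
  -- this is where η < 1 enters.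
  · have h1 : Tendsto (fun r : ℕ => (multivariateGaussian 0 (1 - (sigmaMat U c)⁻¹))
        (Metric.closedBall 0 (r : ℝ))) atTop (𝓝 1) := by
      have := tendsto_measure_iUnion_atTop (μ := multivariateGaussian 0 (1 - (sigmaMat U c)⁻¹))
        (s := fun r : ℕ => Metric.closedBall (0 : EuclideanSpace ℝ (Fin n)) (r : ℝ))
        (fun a b hab => Metric.closedBall_subset_closedBall (by exact_mod_cast hab))
      rwa [Metric.iUnion_closedBall_nat, measure_univ] at this
    have h2 := (ENNReal.tendsto_toReal ENNReal.one_ne_top).comp h1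
    obtain ⟨r, hr⟩ := (h2.eventually (lt_mem_nhds (a := η) (by simpa using hη))).exists
    exact ⟨r, Nat.cast_nonneg r, hr.le⟩
  · rintro r ⟨hr, hr'⟩
    by_contra! hlt
    exact absurd (h r hr hlt) (not_lt.2 hr')

end Gaussian

/-! ### Quantiles of a probability measure on the line -/

section Quantile

variable {μ : Measure ℝ} [IsProbabilityMeasure μ] {α : ℝ}

lemma quantile_set_nonempty (hα : α < 1) : {t : ℝ | α ≤ μ.real (Iic t)}.Nonempty := by
  have h := tendsto_cdf_atTop μ
  obtain ⟨t, ht⟩ := (h.eventually (lt_mem_nhds hα)).exists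
  exact ⟨t, by rw [mem_ofPred_eq, ← cdf_eq_real]; exact ht.le⟩

lemma quantile_set_bddBelow (hα : 0 < α) : BddBelow {t : ℝ | α ≤ μ.real (Iic t)} := by
  have h := tendsto_cdf_atBot μ
  obtain ⟨t, ht⟩ := (h.eventually (gt_mem_nhds hα)).exists
  refine ⟨t, fun s hs => ?_⟩
  by_contra! hst
  rw [mem_ofPred_eq, ← cdf_eq_real] at hs
  exact absurd (hs.trans (monotone_cdf μ hst.le)) (not_le.2 ht)

/-- The distribution function is at least α at every point to the right of the quantile, and it is
right continuous. -/
lemma le_measure_Iic_quantile (hα0 : 0 < α) (hα : α < 1) :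
    α ≤ μ.real (Iic (quantile μ α)) := by
  rw [← cdf_eq_real]
  have h := ((cdf μ).right_continuous (quantile μ α)).mono_left
    (nhdsWithin_mono _ Ioi_subset_Ici_self)
  refine ge_of_tendsto h ?_
  filter_upwards [self_mem_nhdsWithin] with t ht
  obtain ⟨s, hs, hst⟩ := (csInf_lt_iff (quantile_set_bddBelow hα0) (quantile_set_nonempty hα)).1
    (show sInf _ < t from ht)
  rw [mem_ofPred_eq, ← cdf_eq_real] at hs
  exact hs.trans (monotone_cdf μ hst.le)

/-- The mass strictly below a point is the left limit of the distribution function, whose values to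
the left of the quantile are below α. -/
lemma measure_Iio_quantile_le (hα0 : 0 < α) : μ (Iio (quantile μ α)) ≤ ENNReal.ofReal α := by
  have hI := StieltjesFunction.measure_Iio (cdf μ) (tendsto_cdf_atBot μ) (quantile μ α)
  rw [measure_cdf, sub_zero] at hI
  rw [hI]
  refine ENNReal.ofReal_le_ofReal ?_
  refine le_of_tendsto ((monotone_cdf μ).tendsto_leftLim _) ?_
  filter_upwards [self_mem_nhdsWithin] with t ht
  by_contra! h
  rw [cdf_eq_real] at h
  exact absurd (csInf_le (quantile_set_bddBelow hα0) h.le) (not_le.2 ht)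

/-- If all but a small mass of an atomless distribution sits on `G`, then `G` meets every
interquantile interval of larger mass. -/
lemma exists_mem_Ioo_quantile [NullSingletonClass μ] {α₁ α₂ : ℝ} (h1 : 0 < α₁)
    (h12 : α₁ < α₂) (h2 : α₂ < 1)
    {G : Set ℝ} (hG : μ Gᶜ < ENNReal.ofReal (α₂ - α₁)) :
    ∃ c ∈ Ioo (quantile μ α₁) (quantile μ α₂), c ∈ G := by
  by_contra! hno
  set q₁ := quantile μ α₁
  set q₂ := quantile μ α₂
  -- If `G` misses the open interval, the half-line up to q₂ is covered by {c < q₁}, two null points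
  -- and the complement of `G`, so α₂ ≤ α₁ + μ(Gᶜ). The order of q₁ and q₂ plays no role.
  have hsub : Iic q₂ ⊆ Iio q₁ ∪ ({q₁} ∪ {q₂} ∪ Gᶜ) := by
    intro c hc
    rcases lt_trichotomy c q₁ with h | h | h
    · exact Or.inl h
    · exact Or.inr (Or.inl (Or.inl h))
    · rcases lt_or_eq_of_le (show c ≤ q₂ from hc) with h' | h'
      · exact Or.inr (Or.inr (hno c ⟨h, h'⟩))
      · exact Or.inr (Or.inl (Or.inr h'))
  have hle : μ (Iic q₂) ≤ μ (Iio q₁) + μ Gᶜ := by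
    have h0 : μ ({q₁} ∪ {q₂}) = 0 := measure_union_null (measure_singleton _) (measure_singleton _)
    refine (measure_mono hsub).trans ((measure_union_le (μ := μ) _ _).trans ?_)
    have h0' := measure_union_le (μ := μ) ({q₁} ∪ {q₂}) Gᶜ
    rw [h0, zero_add] at h0'
    exact add_le_add_right h0' _
  have h3 : ENNReal.ofReal α₂ ≤ μ (Iic q₂) := by
    rw [← ENNReal.ofReal_toReal (measure_ne_top μ (Iic q₂))]
    exact ENNReal.ofReal_le_ofReal (le_measure_Iic_quantile (h1.trans h12) h2)
  have h4 : μ (Iio q₁) ≤ ENNReal.ofReal α₁ := measure_Iio_quantile_le h1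
  have h5 : μ (Iio q₁) + μ Gᶜ < ENNReal.ofReal α₁ + ENNReal.ofReal (α₂ - α₁) :=
    ENNReal.add_lt_add_of_le_of_lt (measure_ne_top _ _) h4 hG
  rw [← ENNReal.ofReal_add h1.le (by linarith), add_sub_cancel] at h5
  exact absurd (h3.trans hle) (not_le.2 h5)

end Quantile

/-! ### Posterior mass of sets of scales -/

section PosteriorMass

variable {α β κ X : ℝ} {w : ℝ → ℝ}

/-- The prior tail is integrated over all of (α, ∞), so the bound is free of β. No measurability of
`S` is needed. -/
lemma withDensity_Icc_le (hα : 0 < α) (hκ : 0 < κ) (hX : 0 ≤ X) {S : Set ℝ}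
    (hw : ∀ c ∈ Icc α β, c ∈ S → w c ≤ X * c ^ (-1 - κ)) :
    (volume.restrict (Icc α β)).withDensity (fun c => ENNReal.ofReal (w c)) S
      ≤ ENNReal.ofReal (X * (α ^ (-κ) / κ)) := by
  rw [withDensity_apply', Measure.restrict_restrict' measurableSet_Icc]
  have hint : IntegrableOn (fun c : ℝ => X * c ^ (-1 - κ)) (Ioi α) :=
    (integrableOn_Ioi_rpow_of_lt (by linarith) hα).const_mul X
  calc ∫⁻ c in S ∩ Icc α β, ENNReal.ofReal (w c)
      ≤ ∫⁻ c in S ∩ Icc α β, ENNReal.ofReal (X * c ^ (-1 - κ)) := by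
        refine setLIntegral_mono (by fun_prop) fun c hc => ?_
        exact ENNReal.ofReal_le_ofReal (hw c hc.2 hc.1)
    _ ≤ ∫⁻ c in Ici α, ENNReal.ofReal (X * c ^ (-1 - κ)) :=
        lintegral_mono_set fun c hc => hc.2.1
    _ = ∫⁻ c in Ioi α, ENNReal.ofReal (X * c ^ (-1 - κ)) := by
        rw [Measure.restrict_congr_set Ioi_ae_eq_Ici]
    _ = ENNReal.ofReal (∫ c in Ioi α, X * c ^ (-1 - κ)) := by
        rw [ofReal_integral_eq_lintegral_ofReal hint]
        filter_upwards [ae_restrict_mem measurableSet_Ioi] with c hc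
        have : 0 < c := hα.trans hc
        positivity
    _ = ENNReal.ofReal (X * (α ^ (-κ) / κ)) := by
        rw [integral_const_mul, integral_Ioi_rpow_of_lt (by linarith) hα]
        rw [show -1 - κ + 1 = -κ by ring, neg_div_neg_eq]

/-- The interval [c₀, 2c₀] has length c₀ and the power of c is smallest at its right end. -/
lemma le_withDensity_Icc {c₀ : ℝ} (hc₀ : 0 < c₀) (hκ : 0 < κ) (hX : 0 ≤ X)
    (hsub : Icc c₀ (2 * c₀) ⊆ Icc α β)
    (hw : ∀ c ∈ Icc c₀ (2 * c₀), X * c ^ (-1 - κ) ≤ w c) :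
    ENNReal.ofReal (X * (2 ^ (-1 - κ) * c₀ ^ (-κ)))
      ≤ (volume.restrict (Icc α β)).withDensity (fun c => ENNReal.ofReal (w c)) univ := by
  rw [withDensity_apply', Measure.restrict_univ]
  calc ENNReal.ofReal (X * (2 ^ (-1 - κ) * c₀ ^ (-κ)))
      = ∫⁻ _ in Icc c₀ (2 * c₀), ENNReal.ofReal (X * (2 * c₀) ^ (-1 - κ)) := by
        rw [setLIntegral_const, Real.volume_Icc, ← ENNReal.ofReal_mul (by positivity)]
        congr 1
        rw [Real.mul_rpow (by norm_num) hc₀.le, show 2 * c₀ - c₀ = c₀ by ring,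
          show -κ = -1 - κ + 1 by ring, Real.rpow_add hc₀, Real.rpow_one]
        ring
    _ ≤ ∫⁻ c in Icc c₀ (2 * c₀), ENNReal.ofReal (w c) := by
        refine setLIntegral_mono' measurableSet_Icc fun c hc => ENNReal.ofReal_le_ofReal ?_
        refine le_trans ?_ (hw c hc)
        gcongr X * ?_
        exact Real.rpow_le_rpow_of_nonpos (hc₀.trans_le hc.1) hc.2 (by linarith)
    _ ≤ _ := lintegral_mono_set hsub

end PosteriorMass

section Posterior

variable {n : ℕ} {U : Matrix (Fin n) (Fin n) ℝ} {κ τ m : ℝ} {y : EuclideanSpace ℝ (Fin n)}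

lemma isProbabilityMeasure_scalePosterior (h0 : scalePosteriorUnnorm U κ τ m y univ ≠ 0)
    (htop : scalePosteriorUnnorm U κ τ m y univ ≠ ⊤) :
    IsProbabilityMeasure (scalePosterior U κ τ m y) where
  measure_univ := by
    rw [scalePosterior, Measure.smul_apply, smul_eq_mul, ENNReal.inv_mul_cancel h0 htop]

lemma nullSingletonClass_scalePosterior : NullSingletonClass (scalePosterior U κ τ m y) where
  measure_singleton c := by
    rw [scalePosterior, Measure.smul_apply, scalePosteriorUnnorm]
    have := (withDensity_absolutelyContinuous (volume.restrict (scaleInterval m n))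
      (fun c => ENNReal.ofReal (margLik U y c * invGammaWeight κ τ c)))
      (measure_singleton (μ := volume.restrict (scaleInterval m n)) c)
    rw [this, smul_zero]

end Posterior

section PosteriorConcentration

variable {n : ℕ} {U : Matrix (Fin n) (Fin n) ℝ} {l v Z : Fin n → ℝ} {κ τ m a : ℝ}
  {y : EuclideanSpace ℝ (Fin n)} {e : OrthonormalBasis (Fin n) ℝ (EuclideanSpace ℝ (Fin n))}

/-- The prior factor exp(-τ/c) joins the energy as the penalty 2τ/c. The factor in Z is free of c
and cancels on normalisation. -/
lemma density_eq (h : ∀ j, Matrix.toEuclideanLin U (e j) = l j • e j) (hl : ∀ j, 0 ≤ l j) {c : ℝ}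
    (hc : 0 ≤ c) (hZ : ∀ j, inner ℝ (e j) y = v j + Z j) :
    margLik U y c * invGammaWeight κ τ c = Real.exp (-(1 / 2) * ∑ j, Z j ^ 2) *
      Real.exp (-(1 / 2) * (DL l v c + (R1L l v Z c + R2L l Z c) + 2 * τ / c)) *
        c ^ (-1 - κ) := by
  rw [margLik_eq_exp h hl hc hZ, invGammaWeight, mul_add (-(1 / 2)) (DL l v c + _) (2 * τ / c),
    Real.exp_add (-(1 / 2) * (DL l v c + _)), show -(1 / 2) * (2 * τ / c) = -τ / c by ring]
  ring

/-- The posterior distribution of the scale puts little mass on scales at which the bias dominates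
the variance term. -/
lemma scalePosterior_bias_dominates (h : ∀ j, Matrix.toEuclideanLin U (e j) = l j • e j)
    (hl : ∀ j, 0 ≤ l j) (hZ : ∀ j, inner ℝ (e j) y = v j + Z j) (hκ : 0 < κ) (hτ : 0 < τ)
    (ha : 0 < a) (hn : 1 < Real.log n) {K T L c₀ : ℝ} (hK : 1 < K) (hT : 1 < T)
    (hL : 3 * (3 / (1 - 2 ^ (-a)) + 10) + 4 * κ + 4 ≤ L) (hTL : 2 * L ≤ T) (hTa : 2 * L ≤ T ^ a)
    (hc₀ : c₀ ∈ scaleInterval m n) (h2c₀ : 2 * c₀ ∈ scaleInterval m n)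
    (hmin : ∀ c, 0 < c → DL l v c₀ + 2 * τ / c₀ ≤ DL l v c + 2 * τ / c)
    (hbias : ∀ c ∈ scaleInterval m n, ∀ K : ℝ, 1 < K → D1L l v (K * c) ≤ K ^ (-a) * D1L l v c)
    (hgrowth : ∀ c ∈ scaleInterval m n, c / K ∈ scaleInterval m n →
      D2L l (c / K) ≤ 1 / 2 * D2L l c)
    (hlog : ∀ c ∈ scaleInterval m n, Real.log (n * c) ≤ D2L l c)
    (hR : ∀ c ∈ scaleInterval m n, |R1L l v Z c| + |R2L l Z c| ≤ 1 / 2 * DL l v c) :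
    IsProbabilityMeasure (scalePosterior U κ τ m y) ∧
      scalePosterior U κ τ m y
          {c | c ∈ scaleInterval m n ∧ D1L l v c ≤ L * (K * T) ^ 2 * D2L l c}ᶜ
        ≤ ENNReal.ofReal (2 ^ (1 + κ) / (κ * Real.log n)) := by
  have hn0 : (0 : ℝ) < n := by
    rcases Nat.eq_zero_or_pos n with rfl | h
    · simp at hn; linarith
    · exact_mod_cast h
  have hα : 0 < Real.log n / n := by have := hn; positivity
  have h2a : 0 < 3 / (1 - (2 : ℝ) ^ (-a)) := by
    have : (2 : ℝ) ^ (-a) < 1 := Real.rpow_lt_one_of_one_lt_of_neg (by norm_num) (by linarith)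
    have : 0 < 1 - (2 : ℝ) ^ (-a) := by linarith
    positivity
  set C₃ := 3 / (1 - (2 : ℝ) ^ (-a)) + 10 with hC₃
  have hpos : ∀ c ∈ scaleInterval m n, 0 < c := fun c hc => hα.trans_le hc.1
  have hc₀0 := hpos c₀ hc₀
  set D := D2L l c₀ with hD
  set e₀ := Real.exp (-(1 / 2) * ∑ j, Z j ^ 2) with he₀
  have he₀pos : 0 < e₀ := Real.exp_pos _
  have hRabs : ∀ c ∈ scaleInterval m n, |R1L l v Z c + R2L l Z c| ≤ 1 / 2 * DL l v c :=
    fun c hc => (abs_add_le _ _).trans (hR c hc)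
  -- The stochastic terms remove at most half of `DL`, so half of the energy L D survives; the
  -- likelihood contributes another factor 1/2, whence 1/4. For the lower bound near c₀ the same
  -- reasoning gives 3/2 times 1/2, that is 3/4.
  have hbad : ∀ c ∈ Icc (Real.log n / n) ((n : ℝ) ^ (m - 1)),
      c ∈ {c | c ∈ scaleInterval m n ∧ D1L l v c ≤ L * (K * T) ^ 2 * D2L l c}ᶜ →
      margLik U y c * invGammaWeight κ τ c
        ≤ e₀ * Real.exp (-(1 / 4) * L * D) * c ^ (-1 - κ) := by
    intro c hc hcb
    have hc0 := hpos c hc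
    have hlt : L * (K * T) ^ 2 * D2L l c < D1L l v c := by
      by_contra! hle
      exact hcb ⟨hc, hle⟩
    have hE := le_energy_of_bias_dominates hl hα ha hτ hK hT (by linarith) hTL hTa (by linarith)
      hc₀ hmin hbias hgrowth hc hlt
    rw [density_eq h hl hc0.le hZ]
    have := abs_le.1 (hRabs c hc)
    have : 0 < 2 * τ / c := by positivity
    gcongr e₀ * Real.exp ?_ * _
    linarith
  -- This crude bound serves only to show that the total mass is finite.
  have hall : ∀ c ∈ Icc (Real.log n / n) ((n : ℝ) ^ (m - 1)), c ∈ univ →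
      margLik U y c * invGammaWeight κ τ c ≤ e₀ * c ^ (-1 - κ) := by
    intro c hc _
    have hc0 := hpos c hc
    rw [density_eq h hl hc0.le hZ]
    have := abs_le.1 (hRabs c hc)
    have : 0 < 2 * τ / c := by positivity
    have := DL_nonneg (v := v) hl hc0.le
    gcongr ?_ * _
    refine mul_le_of_le_one_right he₀pos.le (Real.exp_le_one_iff.2 ?_)
    linarith
  have hsub : Icc c₀ (2 * c₀) ⊆ Icc (Real.log n / n) ((n : ℝ) ^ (m - 1)) :=
    Icc_subset_Icc hc₀.1 h2c₀.2
  have hnear : ∀ c ∈ Icc c₀ (2 * c₀), e₀ * Real.exp (-(3 / 4) * C₃ * D) * c ^ (-1 - κ)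
      ≤ margLik U y c * invGammaWeight κ τ c := by
    intro c hc
    have hc0 := hpos c (hsub hc)
    have hE := energy_le_near_minimizer hl ha hτ hc₀0 hmin (hbias _ hc₀ 2 (by norm_num)) hc
    rw [density_eq h hl hc0.le hZ]
    have := abs_le.1 (hRabs c (hsub hc))
    have : 0 < 2 * τ / c := by positivity
    gcongr e₀ * Real.exp ?_ * _
    linarith
  have hκ1 := withDensity_Icc_le hα hκ (by positivity) hbad
  have hκ2 := withDensity_Icc_le hα hκ he₀pos.le hall
  have hκ3 := le_withDensity_Icc hc₀0 hκ (by positivity) hsub hnear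
  have hY : 0 < e₀ * Real.exp (-(3 / 4) * C₃ * D) * (2 ^ (-1 - κ) * c₀ ^ (-κ)) := by positivity
  have h0 : scalePosteriorUnnorm U κ τ m y univ ≠ 0 :=
    ((ENNReal.ofReal_pos.2 hY).trans_le hκ3).ne'
  have htop : scalePosteriorUnnorm U κ τ m y univ ≠ ⊤ :=
    (hκ2.trans_lt ENNReal.ofReal_lt_top).ne
  refine ⟨isProbabilityMeasure_scalePosterior h0 htop, ?_⟩
  rw [scalePosterior, Measure.smul_apply, smul_eq_mul, ENNReal.inv_mul_le_iff h0 htop]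
  refine hκ1.trans (le_trans ?_ (mul_le_mul_left hκ3 _))
  rw [← ENNReal.ofReal_mul hY.le]
  refine ENNReal.ofReal_le_ofReal ?_
  have hnc : Real.log n ≤ n * c₀ := by
    have := hc₀.1
    rwa [div_le_iff₀' hn0] at this
  have hnc0 : 0 < n * c₀ := by positivity
  have hexp : n * c₀ ≤ Real.exp D := by
    rw [← Real.log_le_iff_le_exp hnc0]
    exact hlog c₀ hc₀
  have hD0 : 0 ≤ D := D2L_nonneg hl hc₀0.le
  have hratio : (c₀ / (Real.log n / n)) ^ κ ≤ Real.exp (κ * D) := by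
    rw [mul_comm κ, Real.exp_mul]
    refine Real.rpow_le_rpow (by positivity) ?_ hκ.le
    refine le_trans ?_ hexp
    rw [div_div_eq_mul_div, mul_comm]
    exact div_le_self hnc0.le hn.le
  -- In L ≥ 3C₃ + 4κ + 4 the three terms pay for the energy near c₀, for the prior ratio (at most
  -- exp(κD)), and for a spare factor log n ≤ n c₀ ≤ exp(D). The spare factor makes the final bound
  -- vanish.
  have hkey : Real.log n * (c₀ / (Real.log n / n)) ^ κ * Real.exp (-(1 / 4) * L * D)
      ≤ Real.exp (-(3 / 4) * C₃ * D) := by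
    calc Real.log n * (c₀ / (Real.log n / n)) ^ κ * Real.exp (-(1 / 4) * L * D)
        ≤ Real.exp D * Real.exp (κ * D) * Real.exp (-(1 / 4) * L * D) := by
          gcongr
          exact hnc.trans hexp
      _ = Real.exp (D + κ * D + -(1 / 4) * L * D) := by rw [Real.exp_add, Real.exp_add]
      _ ≤ _ := by
          refine Real.exp_le_exp.2 ?_
          nlinarith
  have hdiv : (c₀ / (Real.log n / n)) ^ κ = (Real.log n / n) ^ (-κ) / c₀ ^ (-κ) := by
    rw [Real.div_rpow hc₀0.le hα.le, Real.rpow_neg hα.le, Real.rpow_neg hc₀0.le, inv_div_inv]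
  have h2 : (2 : ℝ) ^ (1 + κ) * 2 ^ (-1 - κ) = 1 := by
    rw [← Real.rpow_add (by norm_num)]
    simp
  have hck : 0 < c₀ ^ (-κ) := by positivity
  rw [hdiv] at hkey
  calc e₀ * Real.exp (-(1 / 4) * L * D) * ((Real.log n / n) ^ (-κ) / κ)
      = e₀ * (Real.log n * ((Real.log n / n) ^ (-κ) / c₀ ^ (-κ)) * Real.exp (-(1 / 4) * L * D)) *
          (c₀ ^ (-κ) / (κ * Real.log n)) := by
        have : Real.log n ≠ 0 := by linarith
        field_simp
    _ ≤ e₀ * Real.exp (-(3 / 4) * C₃ * D) * (c₀ ^ (-κ) / (κ * Real.log n)) := by gcongr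
    _ = e₀ * Real.exp (-(3 / 4) * C₃ * D) * (c₀ ^ (-κ) / (κ * Real.log n)) *
          (2 ^ (1 + κ) * 2 ^ (-1 - κ)) := by rw [h2, mul_one]
    _ = _ := by ring

end PosteriorConcentration

/-! ### Coverage from the abstract conditions -/

/-- Only subadditivity, 1 ≤ P(S) + P(B), is used, so the coverage event need not be shown
measurable. -/
lemma tendsto_measure_one_of_compl_subset {Ω : Type*} [MeasurableSpace Ω] {P : Measure Ω}
    [IsProbabilityMeasure P] {S B : ℕ → Set Ω} (hB : Tendsto (fun k => P (B k)) atTop (𝓝 0))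
    (hSB : ∀ᶠ k in atTop, (S k)ᶜ ⊆ B k) : Tendsto (fun k => P (S k)) atTop (𝓝 1) := by
  have h1 : Tendsto (fun k => 1 - P (B k)) atTop (𝓝 1) := by
    have := ENNReal.Tendsto.sub (tendsto_const_nhds (x := (1 : ENNReal)) (f := atTop)) hB
      (Or.inl ENNReal.one_ne_top)
    rwa [tsub_zero] at this
  refine tendsto_of_tendsto_of_tendsto_of_le_of_le' h1 tendsto_const_nhds ?_
    (Eventually.of_forall fun k => prob_le_one)
  filter_upwards [hSB] with k hk
  rw [tsub_le_iff_right, ← measure_univ (μ := P)]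
  refine (measure_mono ?_).trans (measure_union_le _ _)
  intro ω _
  by_cases hω : ω ∈ S k
  · exact Or.inl hω
  · exact Or.inr (hk hω)

lemma tendsto_measure_union_zero {Ω : Type*} [MeasurableSpace Ω] {P : Measure Ω}
    {A B : ℕ → Set Ω} (hA : Tendsto (fun k => P (A k)) atTop (𝓝 0))
    (hB : Tendsto (fun k => P (B k)) atTop (𝓝 0)) :
    Tendsto (fun k => P (A k ∪ B k)) atTop (𝓝 0) := by
  refine tendsto_of_tendsto_of_tendsto_of_le_of_le tendsto_const_nhds
    (by simpa using hA.add hB) (fun _ => bot_le) fun k => measure_union_le _ _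

/-- On the event that the stochastic terms are small, a credible ball contains the truth at every
scale at which the bias is dominated by the variance term. -/
lemma norm_sub_postMean_lt {n : ℕ} {U : Matrix (Fin n) (Fin n) ℝ} {l v Z : Fin n → ℝ}
    {e : OrthonormalBasis (Fin n) ℝ (EuclideanSpace ℝ (Fin n))}
    (h : ∀ j, Matrix.toEuclideanLin U (e j) = l j • e j) (hl : ∀ j, 0 ≤ l j) {c : ℝ} (hc : 0 ≤ c)
    {θ y : EuclideanSpace ℝ (Fin n)} (hv : ∀ j, v j = inner ℝ (e j) θ)
    (hZ : ∀ j, inner ℝ (e j) y = v j + Z j) {A C M r : ℝ} (hA : 0 ≤ A)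
    (hbias : D1L l v c ≤ A * D2L l c) (hC : D2L l c ≤ C * postVar l c)
    (hR : |R3 l v Z c| + |R4 l Z c| ≤ 1 / 2 * DL l v c) (hs : 0 < postVar l c)
    (hr : √(postVar l c / 2) ≤ r) (hM0 : 1 ≤ M) (hM : 2 * (3 / 2 * (1 + A) * C + 1) < M) :
    ‖θ - postMean U c y‖ < M * r := by
  have hr0 : 0 < r := (Real.sqrt_pos.2 (by positivity)).trans_le hr
  have hr2 : postVar l c / 2 ≤ r ^ 2 := (Real.sqrt_le_left hr0.le).1 hr
  refine lt_of_pow_lt_pow_left₀ 2 (by positivity) ?_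
  have h1 := norm_sub_postMean_sq h hl hc hv hZ
  have h2 := D1R_le_D1L (v := v) hl hc
  have h3 := D2R_le_postVar hl hc
  have h4 := le_abs_self (R3 l v Z c)
  have h5 := le_abs_self (R4 l Z c)
  have h6 : (1 + A) * D2L l c ≤ (1 + A) * (C * postVar l c) := by gcongr
  have hD2 := D2L_nonneg hl hc
  have h7 : ‖θ - postMean U c y‖ ^ 2 ≤ (3 / 2 * (1 + A) * C + 1) * postVar l c := by
    rw [h1]
    simp only [DL] at hR
    nlinarith
  have h8 : (3 / 2 * (1 + A) * C + 1) * postVar l c < M / 2 * postVar l c := by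
    gcongr
    linarith
  -- As M ≥ 1, a bound linear in M suffices for the comparison of squares.
  have h9 : M * r ^ 2 ≤ M ^ 2 * r ^ 2 := by
    gcongr
    nlinarith
  nlinarith

/-- The common core of both halves of the theorem. Good variance enters only as halving of `D2L`
under division by some K, and the equivalences only as an upper bound of `D2L` by the posterior
variance; these weak forms are what the eigenvalue conditions supply. -/
theorem coverageHB_of_conditions
    {𝒳 Ω : Type*} [MeasurableSpace Ω]
    (N : ℕ → ℕ) (hN : Tendsto N atTop atTop) (x : ∀ k, Fin (N k) → 𝒳)
    (U : ∀ k, Matrix (Fin (N k)) (Fin (N k)) ℝ)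
    (P : Measure Ω) [IsProbabilityMeasure P] (ε : ∀ k, Fin (N k) → Ω → ℝ)
    (hε : ∀ k, HasLaw (fun ω => WithLp.toLp 2 fun i => ε k i ω)
      (stdGaussian (EuclideanSpace ℝ (Fin (N k)))) P)
    (m : ℝ) (κ τ : ℝ) (hκ : 0 < κ) (hτ : 0 < τ)
    (e : ∀ k, OrthonormalBasis (Fin (N k)) ℝ (EuclideanSpace ℝ (Fin (N k))))
    (l : ∀ k, Fin (N k) → ℝ) (hl : ∀ k j, 0 ≤ l k j)
    (heig : ∀ k j, Matrix.toEuclideanLin (U k) (e k j) = l k j • e k j)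
    (f : 𝒳 → ℝ) (v : ∀ k, Fin (N k) → ℝ)
    (hv : ∀ k j, v k j = inner ℝ (e k j) (designVec (x k) f))
    (Z : ∀ k, Ω → Fin (N k) → ℝ)
    (hZ : ∀ k ω j, Z k ω j = inner ℝ (e k j) (WithLp.toLp 2 fun i => ε k i ω))
    (I : ℕ → Set ℝ) (hI : ∀ k, I k = scaleInterval m (N k))
    (h1 : SupTendstoZeroInProb P I (fun k c ω =>
      (|R1L (l k) (v k) (Z k ω) c| + |R2L (l k) (Z k ω) c|) / DL (l k) (v k) c))
    (h2 : SupTendstoZeroInProb P I (fun k c ω =>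
      (|R3 (l k) (v k) (Z k ω) c| + |R4 (l k) (Z k ω) c|) / DL (l k) (v k) c))
    (h3 : SupTendstoZeroInProb P I (fun k c ω =>
      |normSqVar (l k) (Z k ω) c / postVar (l k) c - 1|))
    (hgrowth : ∃ K : ℝ, 1 < K ∧ ∀ᶠ k in atTop, ∀ c ∈ I k, c / K ∈ I k →
      D2L (l k) (c / K) ≤ 1 / 2 * D2L (l k) c)
    (hlog : ∀ᶠ k in atTop, ∀ c ∈ I k, Real.log (N k * c) ≤ D2L (l k) c)
    (hmin : SuitableMinimizer I τ (fun k => DL (l k) (v k)))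
    (hvar : ∃ C : ℝ, 0 < C ∧ ∀ᶠ k in atTop, ∀ c ∈ I k, D2L (l k) c ≤ C * postVar (l k) c)
    (hbias : GoodBias I (fun k => D1L (l k) (v k))) :
    CoverageHB P N x U ε κ τ m f := by
  obtain rfl : I = fun k => scaleInterval m (N k) := funext hI
  obtain ⟨K, hK, hgrowth⟩ := hgrowth
  obtain ⟨C, hC, hvar⟩ := hvar
  obtain ⟨a, ha, hbias⟩ := hbias
  have h2a : 0 < 3 / (1 - (2 : ℝ) ^ (-a)) := by
    have : (2 : ℝ) ^ (-a) < 1 := Real.rpow_lt_one_of_one_lt_of_neg (by norm_num) (by linarith)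
    have : 0 < 1 - (2 : ℝ) ^ (-a) := by linarith
    positivity
  set L := 3 * (3 / (1 - (2 : ℝ) ^ (-a)) + 10) + 4 * κ + 4 with hL
  have hL1 : 1 ≤ L := by linarith
  -- The penalty needs T ≥ 2L and the bias needs T^a ≥ 2L, hence the maximum.
  obtain ⟨T, hT, hTL, hTa⟩ : ∃ T : ℝ, 1 < T ∧ 2 * L ≤ T ∧ 2 * L ≤ T ^ a := by
    refine ⟨max (2 * L) ((2 * L) ^ a⁻¹), lt_max_of_lt_left (by linarith), le_max_left _ _, ?_⟩
    calc 2 * L = ((2 * L) ^ a⁻¹) ^ a := by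
          rw [← Real.rpow_mul (by linarith), inv_mul_cancel₀ ha.ne', Real.rpow_one]
      _ ≤ _ := Real.rpow_le_rpow (by positivity) (le_max_right _ _) ha.le
  set A := L * (K * T) ^ 2 with hAdef
  have hA : 0 ≤ A := by positivity
  refine ⟨2 * (3 / 2 * (1 + A) * C + 1) + 1, fun M hM α₁ α₂ η hα₁ hα₁₂ hα₂ hη hη1 => ?_⟩
  have hM1 : 1 ≤ M := by
    have : 0 ≤ 2 * (3 / 2 * (1 + A) * C + 1) := by positivity
    linarith
  have hB := tendsto_measure_union_zero
    (tendsto_measure_union_zero (h1 (1 / 2) (by norm_num)) (h2 (1 / 2) (by norm_num)))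
    (h3 (1 / 3) (by norm_num))
  refine tendsto_measure_one_of_compl_subset hB ?_
  have hNreal : Tendsto (fun k => (N k : ℝ)) atTop atTop := tendsto_natCast_atTop_atTop.comp hN
  have hlogN : Tendsto (fun k => Real.log (N k)) atTop atTop := Real.tendsto_log_atTop.comp hNreal
  have hmass : ∀ᶠ k in atTop, 2 ^ (1 + κ) / (κ * Real.log (N k)) < α₂ - α₁ := by
    have : Tendsto (fun k => 2 ^ (1 + κ) / (κ * Real.log (N k))) atTop (𝓝 0) :=
      (hlogN.const_mul_atTop hκ).const_div_atTop _
    exact this.eventually (gt_mem_nhds (by linarith))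
  -- The radius is deterministic, so for it the concentration of `normSqVar` is used through its
  -- probability: the exceptional event eventually has probability below η.
  have h3η := (h3 (1 / 3) (by norm_num)).eventually
    (gt_mem_nhds (ENNReal.ofReal_pos.2 hη))
  filter_upwards [hgrowth, hlog, hmin, hvar, hbias, hmass, h3η, hlogN.eventually_gt_atTop 1]
    with k hgrowth hlog hmin hvar hbias hmass h3η hn
  rw [compl_subset_comm]
  intro ω hω
  simp only [compl_union, mem_inter_iff, mem_compl_iff, mem_ofPred_eq, not_exists, not_and,
    not_lt] at hω
  obtain ⟨⟨hω1, hω2⟩, -⟩ := hω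
  obtain ⟨c₀, hc₀0, hc₀min, hc₀, h2c₀⟩ := hmin
  have hn0 : (0 : ℝ) < N k := by
    rcases Nat.eq_zero_or_pos (N k) with h | h
    · rw [h] at hn; simp at hn; linarith
    · exact_mod_cast h
  have hpos : ∀ c ∈ scaleInterval m (N k), 0 < c := fun c hc =>
    (div_pos (by linarith) hn0).trans_le hc.1
  -- On the interval n c ≥ log n > 1, so the logarithmic lower bound is positive.
  have hD2pos : ∀ c ∈ scaleInterval m (N k), 0 < D2L (l k) c := fun c hc => by
    refine (Real.log_pos ?_).trans_le (hlog c hc)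
    have := hc.1
    rw [div_le_iff₀' hn0] at this
    linarith
  have hDLpos : ∀ c ∈ scaleInterval m (N k), 0 < DL (l k) (v k) c := fun c hc =>
    (hD2pos c hc).trans_le (D2L_le_DL (hl k) (hpos c hc).le)
  have hspos : ∀ c ∈ scaleInterval m (N k), 0 < postVar (l k) c := fun c hc =>
    pos_of_mul_pos_right ((hD2pos c hc).trans_le (hvar c hc)) hC.le
  have hy : (WithLp.toLp 2 fun i => f (x k i) + ε k i ω : EuclideanSpace ℝ (Fin (N k)))
      = designVec (x k) f + WithLp.toLp 2 fun i => ε k i ω := rfl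
  have hcoord : ∀ j, inner ℝ (e k j)
      (WithLp.toLp 2 fun i => f (x k i) + ε k i ω : EuclideanSpace ℝ (Fin (N k)))
        = v k j + Z k ω j := fun j => by
    rw [hy, inner_add_right, hv, hZ]
  have hpost := scalePosterior_bias_dominates (τ := τ) (heig k) (hl k) hcoord hκ hτ ha hn hK hT
    le_rfl hTL hTa hc₀ h2c₀ (fun c hc => hc₀min hc) hbias hgrowth hlog
    (fun c hc => (div_le_iff₀ (hDLpos c hc)).1 (hω1 c hc))
  obtain ⟨hprob, hmassG⟩ := hpost
  have := nullSingletonClass_scalePosterior (U := U k) (κ := κ) (τ := τ) (m := m)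
    (y := WithLp.toLp 2 fun i => f (x k i) + ε k i ω)
  obtain ⟨c, hcI, hcG, hcb⟩ := exists_mem_Ioo_quantile hα₁ hα₁₂ hα₂
    (hmassG.trans_lt ((ENNReal.ofReal_lt_ofReal_iff (by linarith)).2 hmass))
  have hc0 := hpos c hcG
  refine mem_iUnion₂.2 ⟨c, hcI, ?_⟩
  refine norm_sub_postMean_lt (heig k) (hl k) hc0.le (hv k) hcoord hA hcb (hvar c hcG)
    ((div_le_iff₀ (hDLpos c hcG)).1 (hω2 c hcG)) (hspos c hcG) ?_ hM1 (by linarith)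
  refine le_credRadius hη1 fun r hr hrlt => ?_
  rw [Measure.real, multivariateGaussian_closedBall (heig k) (hl k) hc0.le (hε k) hr]
  -- A posterior norm of at most r < √(s²/2) puts `normSqVar`/s² below 1/2, hence further than 1/3
  -- from 1.
  refine (ENNReal.toReal_lt_of_lt_ofReal (lt_of_le_of_lt (measure_mono ?_) h3η))
  intro ω' hω'
  refine ⟨c, hcG, ?_⟩
  have hr2 : r ^ 2 < postVar (l k) c / 2 := (Real.lt_sqrt hr).1 hrlt
  have hZeq : (fun j => inner ℝ (e k j) (WithLp.toLp 2 fun i => ε k i ω' :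
      EuclideanSpace ℝ (Fin (N k)))) = Z k ω' := funext fun j => (hZ k ω' j).symm
  rw [mem_ofPred_eq, hZeq] at hω'
  have hlt : normSqVar (l k) (Z k ω') c / postVar (l k) c < 1 / 2 := by
    rw [div_lt_iff₀ (hspos c hcG)]
    linarith
  rw [abs_of_neg (by linarith)]
  linarith

/-! ### Second moments and a maximal inequality -/

/-- A family of uncorrelated random variables with common second moment `w`. -/
def IsOrthogonalFamily {ι Ω : Type*} [MeasurableSpace Ω] (P : Measure Ω) (Y : Ω → ι → ℝ) (w : ℝ) :
    Prop :=
  ∀ i j, Integrable (fun ω => Y ω i * Y ω j) P ∧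
    (i ≠ j → ∫ ω, Y ω i * Y ω j ∂P = 0) ∧ ∫ ω, Y ω i * Y ω i ∂P = w

section Moments

lemma isOrthogonalFamily_comp {n : ℕ} {Ω : Type*} [MeasurableSpace Ω] {P : Measure Ω}
    {Z : Ω → Fin n → ℝ} (hZ : HasLaw Z (Measure.pi fun _ => gaussianReal 0 1) P) {g : ℝ → ℝ}
    (hg : MemLp g 2 (gaussianReal 0 1)) (hgm : Measurable g)
    (hg0 : ∫ x, g x ∂gaussianReal 0 1 = 0) :
    IsOrthogonalFamily P (fun ω j => g (Z ω j)) (∫ x, g x * g x ∂gaussianReal 0 1) := by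
  intro i j
  have hev : ∀ i : Fin n, MeasurePreserving (fun x : Fin n → ℝ => x i)
      (Measure.pi fun _ => gaussianReal 0 1) (gaussianReal 0 1) := fun i =>
    measurePreserving_eval (fun _ : Fin n => gaussianReal 0 1) i
  have hmem : ∀ i, MemLp (fun ω => g (Z ω i)) 2 P := fun i =>
    MemLp.comp_of_map (g := fun x : Fin n → ℝ => g (x i))
      (by rw [hZ.map_eq]; exact hg.comp_measurePreserving (hev i)) hZ.aemeasurable
  have hmeas : ∀ i j, AEStronglyMeasurable (fun x : Fin n → ℝ => g (x i) * g (x j))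
      (Measure.pi fun _ => gaussianReal 0 1) := fun i j =>
    Measurable.aestronglyMeasurable (by fun_prop)
  have hone : ∀ (F : ℝ → ℝ), Measurable F → ∫ x : Fin n → ℝ, F (x i) ∂Measure.pi
      (fun _ => gaussianReal 0 1) = ∫ x, F x ∂gaussianReal 0 1 := fun F hF =>
    (hev i).hasLaw.integral_comp hF.aestronglyMeasurable
  refine ⟨(hmem i).integrable_mul (hmem j), fun hij => ?_, ?_⟩
  · have h1 := hZ.integral_comp (hmeas i j)
    simp only [Function.comp_def] at h1
    rw [h1]
    have hind : iIndepFun (fun (i : Fin n) (x : Fin n → ℝ) => g (x i))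
        (Measure.pi fun _ => gaussianReal 0 1) := iIndepFun_pi fun _ => hgm.aemeasurable
    rw [(hind.indepFun hij).integral_fun_mul_eq_mul_integral
      (Measurable.aestronglyMeasurable (by fun_prop))
      (Measurable.aestronglyMeasurable (by fun_prop)), hone g hgm, hg0, zero_mul]
  · have h1 := hZ.integral_comp (hmeas i i)
    simp only [Function.comp_def] at h1
    rw [h1, hone (fun x => g x * g x) (by fun_prop)]

lemma memLp_sq_sub_one : MemLp (fun x : ℝ => x ^ 2 - 1) 2 (gaussianReal 0 1) := by
  refine MemLp.sub ?_ (memLp_const 1)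
  have h4 := memLp_id_gaussianReal' (μ := 0) (v := 1) 4 (by simp)
  have h : MemLp (fun x : ℝ => x * x) 2 (gaussianReal 0 1) := by
    have : ENNReal.HolderTriple 4 4 2 := ⟨by
      rw [← two_mul, ← ENNReal.toReal_eq_toReal_iff' (by simp [ENNReal.mul_eq_top]) (by simp)]
      simp
      norm_num⟩
    exact h4.mul h4
  simpa [pow_two] using h

lemma integral_sq_sub_one : ∫ x, (x ^ 2 - 1) ∂gaussianReal 0 1 = 0 := by
  have h2 : MemLp (fun x : ℝ => x) 2 (gaussianReal 0 1) :=
    memLp_id_gaussianReal' (μ := 0) (v := 1) 2 (by simp)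
  have h := variance_of_integral_eq_zero (μ := gaussianReal 0 1) (X := fun x => x)
    measurable_id.aemeasurable (by simp)
  rw [variance_fun_id_gaussianReal] at h
  rw [integral_sub h2.integrable_sq (integrable_const _), ← h]
  simp

end Moments

section MaximalInequality

variable {ι Ω : Type*} [Fintype ι] [MeasurableSpace Ω] {P : Measure Ω} {Y : Ω → ι → ℝ} {w : ℝ}

lemma IsOrthogonalFamily.integral_quadratic (hY : IsOrthogonalFamily P Y w) (A : ι → ι → ℝ) :
    Integrable (fun ω => ∑ i, ∑ j, Y ω i * Y ω j * A i j) P ∧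
      ∫ ω, ∑ i, ∑ j, Y ω i * Y ω j * A i j ∂P = w * ∑ i, A i i := by
  classical
  have hint : ∀ i j, Integrable (fun ω => Y ω i * Y ω j * A i j) P := fun i j =>
    (hY i j).1.mul_const _
  refine ⟨integrable_finsetSum _ fun i _ => integrable_finsetSum _ fun j _ => hint i j, ?_⟩
  rw [integral_finsetSum _ fun i _ => integrable_finsetSum _ fun j _ => hint i j, Finset.mul_sum]
  refine Finset.sum_congr rfl fun i _ => ?_
  rw [integral_finsetSum _ fun j _ => hint i j, Finset.sum_eq_single i]
  · rw [integral_mul_const, (hY i i).2.2]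
  · intro j _ hj
    rw [integral_mul_const, (hY i j).2.1 (Ne.symm hj), zero_mul]
  · simp

/-- A maximal inequality over a dyadic block for a random linear combination of smooth functions
with uncorrelated coefficients. -/
lemma measure_exists_lt_abs_sum_le [IsFiniteMeasure P] (hY : IsOrthogonalFamily P Y w)
    (hw : 0 ≤ w) {a V t : ℝ} (ha : 0 < a) (ht : 0 < t) {φ φ' : ι → ℝ → ℝ}
    (hφ : ∀ j, ∀ c ∈ Icc a (2 * a), HasDerivAt (φ j) (φ' j c) c)
    (hφ' : ∀ j, ContinuousOn (φ' j) (Icc a (2 * a)))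
    (hV : ∀ c ∈ Icc a (2 * a), ∑ j, φ j c ^ 2 ≤ V)
    (hV' : ∀ c ∈ Icc a (2 * a), ∑ j, (c * φ' j c) ^ 2 ≤ V) :
    P {ω | ∃ c ∈ Icc a (2 * a), t < |∑ j, Y ω j * φ j c|} ≤ ENNReal.ofReal (3 * w * V / t ^ 2) := by
  have h2a : a ≤ 2 * a := by linarith
  have hcont : ∀ j, ContinuousOn (φ j) (Icc a (2 * a)) := fun j c hc =>
    (hφ j c hc).continuousAt.continuousWithinAt
  -- `B` is the kernel of the quadratic form G²/a + aG'² in Y, where G = ∑ Yⱼφⱼ. Adding G(a)² and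
  -- integrating gives `A`, whose expected form involves only its trace.
  set B : ι → ι → ℝ → ℝ := fun i j c => φ i c * φ j c / a + a * (φ' i c * φ' j c) with hB
  have hBcont : ∀ i j, ContinuousOn (B i j) (Icc a (2 * a)) := fun i j =>
    (((hcont i).mul (hcont j)).div_const a).add (((hφ' i).mul (hφ' j)).const_smul a)
  have hBint : ∀ i j, IntervalIntegrable (B i j) volume a (2 * a) := fun i j =>
    ContinuousOn.intervalIntegrable (by rw [uIcc_of_le h2a]; exact hBcont i j)
  set A : ι → ι → ℝ := fun i j => φ i a * φ j a + ∫ c in a..(2 * a), B i j c with hA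
  obtain ⟨hint, hEq⟩ := hY.integral_quadratic A
  set S : Ω → ℝ := fun ω => ∑ i, ∑ j, Y ω i * Y ω j * A i j with hS
  have hSeq : ∀ ω, S ω = (∑ j, Y ω j * φ j a) ^ 2 + ∫ c in a..(2 * a),
      ((∑ j, Y ω j * φ j c) ^ 2 / a + a * (∑ j, Y ω j * φ' j c) ^ 2) := by
    intro ω
    have h1 : ∀ c, (∑ j, Y ω j * φ j c) ^ 2 / a + a * (∑ j, Y ω j * φ' j c) ^ 2
        = ∑ i, ∑ j, Y ω i * Y ω j * B i j c := by
      intro c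
      rw [pow_two, pow_two, Finset.sum_mul_sum, Finset.sum_mul_sum, Finset.sum_div, Finset.mul_sum,
        ← Finset.sum_add_distrib]
      refine Finset.sum_congr rfl fun i _ => ?_
      rw [Finset.sum_div, Finset.mul_sum, ← Finset.sum_add_distrib]
      refine Finset.sum_congr rfl fun j _ => ?_
      simp only [hB]
      ring
    simp only [h1]
    rw [intervalIntegral.integral_finsetSum fun i _ => by
      have : (fun c => ∑ j, Y ω i * Y ω j * B i j c) = ∑ j, fun c => Y ω i * Y ω j * B i j c := by
        ext c; simp
      rw [this]
      exact IntervalIntegrable.sum _ fun j _ => (hBint i j).const_mul _]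
    rw [pow_two, Finset.sum_mul_sum, ← Finset.sum_add_distrib]
    refine Finset.sum_congr rfl fun i _ => ?_
    rw [intervalIntegral.integral_finsetSum fun j _ => (hBint i j).const_mul _,
      ← Finset.sum_add_distrib]
    refine Finset.sum_congr rfl fun j _ => ?_
    rw [intervalIntegral.integral_const_mul]
    simp only [hA]
    ring
  -- The initial point contributes V, and the integral of at most 2V/a over a block of length a
  -- contributes 2V.
  have hAV : ∑ i, A i i ≤ 3 * V := by
    simp only [hA]
    rw [Finset.sum_add_distrib,
      ← intervalIntegral.integral_finsetSum (f := fun i c => B i i c) fun i _ => hBint i i]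
    have h1 : ∑ i, φ i a * φ i a ≤ V := by
      simpa [pow_two] using hV a ⟨le_rfl, h2a⟩
    have h2 : ∫ c in a..(2 * a), ∑ i, B i i c ≤ ∫ _ in a..(2 * a), 2 * V / a := by
      refine intervalIntegral.integral_mono_on h2a ?_ intervalIntegrable_const fun c hc => ?_
      · have : (fun c => ∑ i, B i i c) = ∑ i, fun c => B i i c := by ext c; simp
        rw [this]
        exact IntervalIntegrable.sum _ fun i _ => hBint i i
      · have h3 := hV c hc
        have h4 := hV' c hc
        have h5 : ∑ i, B i i c ≤ (∑ i, φ i c ^ 2) / a + (∑ i, (c * φ' i c) ^ 2) / a := by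
          rw [Finset.sum_div, Finset.sum_div, ← Finset.sum_add_distrib]
          refine Finset.sum_le_sum fun i _ => ?_
          simp only [hB]
          rw [← pow_two, ← pow_two]
          gcongr
          rw [le_div_iff₀ ha, mul_pow]
          have : a ^ 2 ≤ c ^ 2 := by have := hc.1; gcongr
          nlinarith [sq_nonneg (φ' i c)]
        calc _ ≤ _ := h5
          _ ≤ V / a + V / a := by gcongr
          _ = _ := by ring
    rw [intervalIntegral.integral_const, smul_eq_mul] at h2
    have h6 : (2 * a - a) * (2 * V / a) = 2 * V := by field_simp; ring
    rw [h6] at h2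
    linarith
  -- G(c)² = G(a)² + ∫ 2GG', and 2GG' ≤ G²/a + aG'². The resulting bound does not depend on c, so it
  -- controls the supremum.
  have hsup : {ω | ∃ c ∈ Icc a (2 * a), t < |∑ j, Y ω j * φ j c|} ⊆ {ω | t ^ 2 ≤ S ω} := by
    rintro ω ⟨c, hc, hlt⟩
    rw [mem_ofPred_eq, hSeq]
    set G := fun c => ∑ j, Y ω j * φ j c with hG
    set G' := fun c => ∑ j, Y ω j * φ' j c with hG'
    have hGd : ∀ c ∈ Icc a (2 * a), HasDerivAt (fun c => G c ^ 2) (2 * G c * G' c) c := by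
      intro c hc
      have h1 : HasDerivAt G (G' c) c :=
        HasDerivAt.fun_sum fun j _ => (hφ j c hc).const_mul (Y ω j)
      simpa using h1.fun_pow 2
    have hGc : ContinuousOn G (Icc a (2 * a)) :=
      continuousOn_finsetSum _ fun j _ => (hcont j).const_smul (Y ω j)
    have hG'c : ContinuousOn G' (Icc a (2 * a)) :=
      continuousOn_finsetSum _ fun j _ => (hφ' j).const_smul (Y ω j)
    have hsub : Icc a c ⊆ Icc a (2 * a) := Icc_subset_Icc_right hc.2
    have h1 : ∫ s in a..c, 2 * G s * G' s = G c ^ 2 - G a ^ 2 := by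
      refine intervalIntegral.integral_eq_sub_of_hasDerivAt (f := fun c => G c ^ 2)
        (fun s hs => ?_) ?_
      · rw [uIcc_of_le hc.1] at hs
        exact hGd s (hsub hs)
      · refine ContinuousOn.intervalIntegrable ?_
        rw [uIcc_of_le hc.1]
        exact ((continuousOn_const.mul hGc).mul hG'c).mono hsub
    have hRc : ContinuousOn (fun s => G s ^ 2 / a + a * G' s ^ 2) (Icc a (2 * a)) :=
      ((hGc.pow 2).div_const a).add ((hG'c.pow 2).const_smul a)
    have hRi : ∀ u ∈ Icc a (2 * a), ∀ u' ∈ Icc a (2 * a), u ≤ u' →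
        IntervalIntegrable (fun s => G s ^ 2 / a + a * G' s ^ 2) volume u u' := by
      intro u hu u' hu' huu'
      refine ContinuousOn.intervalIntegrable ?_
      rw [uIcc_of_le huu']
      exact hRc.mono (Icc_subset_Icc hu.1 hu'.2)
    have h2 : ∫ s in a..c, 2 * G s * G' s ≤ ∫ s in a..c, (G s ^ 2 / a + a * G' s ^ 2) := by
      refine intervalIntegral.integral_mono_on hc.1 ?_ (hRi a ⟨le_rfl, h2a⟩ c hc hc.1)
        fun s hs => ?_
      · refine ContinuousOn.intervalIntegrable ?_
        rw [uIcc_of_le hc.1]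
        exact ((continuousOn_const.mul hGc).mul hG'c).mono hsub
      · have : G s ^ 2 / a + a * G' s ^ 2 - 2 * G s * G' s = (G s - a * G' s) ^ 2 / a := by
          field_simp
          ring
        have : 0 ≤ (G s - a * G' s) ^ 2 / a := by positivity
        linarith
    have h3 : ∫ s in a..c, (G s ^ 2 / a + a * G' s ^ 2)
        ≤ ∫ s in a..(2 * a), (G s ^ 2 / a + a * G' s ^ 2) := by
      rw [← intervalIntegral.integral_add_adjacent_intervals (hRi a ⟨le_rfl, h2a⟩ c hc hc.1)
        (hRi c hc (2 * a) ⟨h2a, le_rfl⟩ hc.2), le_add_iff_nonneg_right]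
      exact intervalIntegral.integral_nonneg hc.2 fun s _ => by positivity
    have h4 : t ^ 2 ≤ G c ^ 2 := by
      rw [← sq_abs (G c)]
      exact pow_le_pow_left₀ ht.le hlt.le 2
    linarith
  have hS0 : 0 ≤ S := by
    intro ω
    show 0 ≤ S ω
    rw [hSeq]
    exact add_nonneg (sq_nonneg _) (intervalIntegral.integral_nonneg h2a fun s _ => by positivity)
  have hmark := mul_meas_ge_le_integral_of_nonneg (Eventually.of_forall hS0) hint (t ^ 2)
  refine (measure_mono hsup).trans ?_
  rw [← ENNReal.ofReal_toReal (measure_ne_top P {ω | t ^ 2 ≤ S ω})]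
  refine ENNReal.ofReal_le_ofReal ?_
  rw [le_div_iff₀ (by positivity), mul_comm]
  calc t ^ 2 * (P {ω | t ^ 2 ≤ S ω}).toReal ≤ w * ∑ i, A i i := hmark.trans hEq.le
    _ ≤ w * (3 * V) := by gcongr
    _ = 3 * w * V := by ring

end MaximalInequality

/-! ### Uniform negligibility over all scales -/

section Uniform

variable {ι Ω : Type*} [Fintype ι] [MeasurableSpace Ω] {P : Measure Ω} {Y : Ω → ι → ℝ} {w : ℝ}
  {l v : ι → ℝ}

/-- Coefficient functions on `(0, ∞)` whose quadratic variation, together with that of their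
logarithmic derivative, is dominated by `DL`. -/
structure IsDominatedByDL (l v : ι → ℝ) (φ φ' : ι → ℝ → ℝ) : Prop where
  hasDerivAt : ∀ j, ∀ c, 0 < c → HasDerivAt (φ j) (φ' j c) c
  continuousOn : ∀ j, ContinuousOn (φ' j) (Ioi 0)
  sum_sq_le : ∀ c, 0 < c → ∑ j, φ j c ^ 2 ≤ 8 * DL l v c
  sum_deriv_sq_le : ∀ c, 0 < c → ∑ j, (c * φ' j c) ^ 2 ≤ 8 * DL l v c

/-- On a dyadic block `DL` stays between DL(a)/2 and 4 DL(a), since the bias at most halves and the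
variance term at most quadruples. The second moment is of order DL(a) and the squared threshold of
order DL(a)², which leaves 1/DL(a) ≤ 1/D2L(a). -/
lemma measure_block_le [IsFiniteMeasure P] (hl : ∀ j, 0 ≤ l j) (hY : IsOrthogonalFamily P Y w)
    (hw : 0 ≤ w) {φ φ' : ι → ℝ → ℝ} (hφ : IsDominatedByDL l v φ φ') {a ε : ℝ} (ha : 0 < a)
    (hε : 0 < ε) (hD : 0 < D2L l a) :
    P {ω | ∃ c ∈ Icc a (2 * a), ε < |∑ j, Y ω j * φ j c| / DL l v c}
      ≤ ENNReal.ofReal (384 * w / ε ^ 2 / D2L l a) := by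
  have hDL : 0 < DL l v a := hD.trans_le (D2L_le_DL hl ha.le)
  have hupper : ∀ c ∈ Icc a (2 * a), DL l v c ≤ 4 * DL l v a := by
    intro c hc
    have h1 := D1L_anti (v := v) hl ha.le hc.1
    have h2 := (D2L_mono hl (ha.le.trans hc.1) hc.2).trans (D2L_two_mul_le hl ha.le)
    have h3 := D1L_nonneg (v := v) hl ha.le
    simp only [DL]
    linarith
  have hlower : ∀ c ∈ Icc a (2 * a), 1 / 2 * DL l v a ≤ DL l v c := by
    intro c hc
    have h1 := D1L_anti (v := v) hl (ha.le.trans hc.1) hc.2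
    have h2 := D2L_mono hl ha.le hc.1
    have h3 := D1L_le_two_mul (v := v) hl ha.le
    simp only [DL]
    linarith
  have hpos : ∀ c ∈ Icc a (2 * a), 0 < c := fun c hc => ha.trans_le hc.1
  have key := measure_exists_lt_abs_sum_le hY hw ha (V := 32 * DL l v a)
    (t := ε * (1 / 2 * DL l v a)) (by positivity) (fun j c hc => hφ.hasDerivAt j c (hpos c hc))
    (fun j => (hφ.continuousOn j).mono hpos)
    (fun c hc => (hφ.sum_sq_le c (hpos c hc)).trans (by linarith [hupper c hc]))
    (fun c hc => (hφ.sum_deriv_sq_le c (hpos c hc)).trans (by linarith [hupper c hc]))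
  refine (measure_mono ?_).trans (key.trans (ENNReal.ofReal_le_ofReal ?_))
  · rintro ω ⟨c, hc, hlt⟩
    refine ⟨c, hc, ?_⟩
    rw [lt_div_iff₀ (by linarith [hlower c hc])] at hlt
    exact lt_of_le_of_lt (by gcongr; exact hlower c hc) hlt
  · have h1 : 3 * w * (32 * DL l v a) / (ε * (1 / 2 * DL l v a)) ^ 2
        = 384 * w / ε ^ 2 / DL l v a := by
      field_simp
      ring
    rw [h1]
    have := D2L_le_DL (v := v) hl ha.le
    gcongr

lemma measure_exists_lt_div_DL_le [IsFiniteMeasure P] (hl : ∀ j, 0 ≤ l j)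
    (hY : IsOrthogonalFamily P Y w) (hw : 0 ≤ w) {φ φ' : ι → ℝ → ℝ}
    (hφ : IsDominatedByDL l v φ φ') {α β δ p N ε : ℝ} (hα : 0 < α) (hδ : 0 < δ) (hp : 0 < p)
    (hN : 0 < N) (hε : 0 < ε) (hD : ∀ c ∈ Icc α β, δ * (N * c) ^ p ≤ D2L l c) :
    P {ω | ∃ c ∈ Icc α β, ε < |∑ j, Y ω j * φ j c| / DL l v c}
      ≤ ENNReal.ofReal (384 * w / ε ^ 2 / (δ * (N * α) ^ p) * (1 - 2 ^ (-p))⁻¹) := by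
  -- The lower bound on `D2L` is needed only at the left end of a block. The block may extend beyond
  -- β because the other estimates hold for all c > 0.
  set E : ℕ → Set Ω := fun i => {ω | 2 ^ i * α ≤ β ∧
    ∃ c ∈ Icc (2 ^ i * α) (2 * (2 ^ i * α)), ε < |∑ j, Y ω j * φ j c| / DL l v c}
  set q := 384 * w / ε ^ 2 / (δ * (N * α) ^ p) with hq
  have hr0 : (0 : ℝ) < 2 ^ (-p) := by positivity
  have hr1 : (2 : ℝ) ^ (-p) < 1 := Real.rpow_lt_one_of_one_lt_of_neg (by norm_num) (by linarith)
  have hq0 : 0 ≤ q := by positivity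
  have hE : ∀ i, P (E i) ≤ ENNReal.ofReal (q * (2 ^ (-p)) ^ i) := by
    intro i
    by_cases hi : 2 ^ i * α ≤ β
    · have ha : 0 < 2 ^ i * α := by positivity
      have hle : δ * (N * (2 ^ i * α)) ^ p ≤ D2L l (2 ^ i * α) :=
        hD _ ⟨le_mul_of_one_le_left hα.le (one_le_pow₀ (by norm_num)), hi⟩
      have hpos : 0 < δ * (N * (2 ^ i * α)) ^ p := by positivity
      refine (measure_mono ?_).trans ((measure_block_le hl hY hw hφ ha hε
        (hpos.trans_le hle)).trans (ENNReal.ofReal_le_ofReal ?_))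
      · rintro ω ⟨-, h⟩
        exact h
      · calc 384 * w / ε ^ 2 / D2L l (2 ^ i * α)
            ≤ 384 * w / ε ^ 2 / (δ * (N * (2 ^ i * α)) ^ p) := by gcongr
          _ = q * (2 ^ (-p)) ^ i := by
            have hpow : ((2 : ℝ) ^ i) ^ p = (2 ^ p) ^ i := by
              rw [← Real.rpow_natCast, ← Real.rpow_mul (by norm_num), mul_comm,
                Real.rpow_mul (by norm_num), Real.rpow_natCast]
            rw [hq, show N * (2 ^ i * α) = 2 ^ i * (N * α) by ring,
              Real.mul_rpow (by positivity) (by positivity), hpow, Real.rpow_neg (by norm_num),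
              inv_pow]
            field_simp
    · have : E i = ∅ := by
        ext ω
        simp only [E, mem_ofPred_eq, mem_empty_iff_false, iff_false]
        exact fun h => hi h.1
      rw [this]
      simp
  have hsub : {ω | ∃ c ∈ Icc α β, ε < |∑ j, Y ω j * φ j c| / DL l v c} ⊆ ⋃ i, E i := by
    rintro ω ⟨c, hc, hlt⟩
    obtain ⟨i, hi, hi'⟩ := exists_nat_pow_near (x := c / α) (y := 2)
      ((one_le_div hα).2 hc.1) (by norm_num)
    rw [le_div_iff₀ hα] at hi
    rw [div_lt_iff₀ hα, pow_succ] at hi'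
    exact mem_iUnion.2 ⟨i, hi.trans hc.2, c, ⟨hi, by linarith⟩, hlt⟩
  calc P {ω | ∃ c ∈ Icc α β, ε < |∑ j, Y ω j * φ j c| / DL l v c}
      ≤ ∑' i, P (E i) := (measure_mono hsub).trans (measure_iUnion_le _)
    _ ≤ ∑' i, ENNReal.ofReal (q * (2 ^ (-p)) ^ i) := ENNReal.tsum_le_tsum hE
    _ = ENNReal.ofReal (∑' i, q * (2 ^ (-p)) ^ i) := by
        rw [ENNReal.ofReal_tsum_of_nonneg (fun i => by positivity)]
        exact (summable_geometric_of_lt_one hr0.le hr1).mul_left q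
    _ = _ := by rw [tsum_mul_left, tsum_geometric_of_lt_one hr0.le hr1]

end Uniform

section Asymptotic

variable {Ω : Type*} [MeasurableSpace Ω] {P : Measure Ω} {I : ℕ → Set ℝ}

lemma SupTendstoZeroInProb.mono {F G : ℕ → ℝ → Ω → ℝ} (hF : SupTendstoZeroInProb P I F)
    {C : ℝ} (hC : 0 < C) (h : ∀ᶠ k in atTop, ∀ c ∈ I k, ∀ ω, G k c ω ≤ C * F k c ω) :
    SupTendstoZeroInProb P I G := by
  intro ε hε
  refine tendsto_of_tendsto_of_tendsto_of_le_of_le' tendsto_const_nhds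
    (hF (ε / C) (by positivity)) (Eventually.of_forall fun _ => bot_le) ?_
  filter_upwards [h] with k hk
  refine measure_mono ?_
  rintro ω ⟨c, hc, hlt⟩
  refine ⟨c, hc, ?_⟩
  rw [div_lt_iff₀' hC]
  exact hlt.trans_le (hk c hc ω)

lemma SupTendstoZeroInProb.add {F G : ℕ → ℝ → Ω → ℝ} (hF : SupTendstoZeroInProb P I F)
    (hG : SupTendstoZeroInProb P I G) :
    SupTendstoZeroInProb P I (fun k c ω => F k c ω + G k c ω) := by
  intro ε hε
  have h := tendsto_measure_union_zero (hF (ε / 2) (by positivity)) (hG (ε / 2) (by positivity))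
  refine tendsto_of_tendsto_of_tendsto_of_le_of_le tendsto_const_nhds h (fun _ => bot_le) ?_
  intro k
  refine measure_mono ?_
  rintro ω ⟨c, hc, hlt⟩
  by_cases h : ε / 2 < F k c ω
  · exact Or.inl ⟨c, hc, h⟩
  · exact Or.inr ⟨c, hc, by linarith⟩

/-- At the left end of the interval n c = log n, so the geometric sum of block bounds is of order
(log n)^(-p). -/
lemma supTendstoZeroInProb_of_orthogonal [IsFiniteMeasure P] {N : ℕ → ℕ}
    (hN : Tendsto N atTop atTop) {m δ p w : ℝ} (hδ : 0 < δ) (hp : 0 < p) (hw : 0 ≤ w)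
    {l v : ∀ k, Fin (N k) → ℝ} (hl : ∀ k j, 0 ≤ l k j) {Y : ∀ k, Ω → Fin (N k) → ℝ}
    (hY : ∀ k, IsOrthogonalFamily P (Y k) w) {φ φ' : ∀ k, Fin (N k) → ℝ → ℝ}
    (hφ : ∀ k, IsDominatedByDL (l k) (v k) (φ k) (φ' k))
    (hD : ∀ᶠ k in atTop, ∀ c ∈ scaleInterval m (N k), δ * (N k * c) ^ p ≤ D2L (l k) c) :
    SupTendstoZeroInProb P (fun k => scaleInterval m (N k)) (fun k c ω =>
      |∑ j, Y k ω j * φ k j c| / DL (l k) (v k) c) := by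
  intro ε hε
  have hNreal : Tendsto (fun k => (N k : ℝ)) atTop atTop := tendsto_natCast_atTop_atTop.comp hN
  have hlogN : Tendsto (fun k => Real.log (N k)) atTop atTop := Real.tendsto_log_atTop.comp hNreal
  have hlim : Tendsto (fun k => ENNReal.ofReal
      (384 * w / ε ^ 2 / (δ * Real.log (N k) ^ p) * (1 - 2 ^ (-p))⁻¹)) atTop (𝓝 0) := by
    have h1 : Tendsto (fun k => δ * Real.log (N k) ^ p) atTop atTop :=
      ((tendsto_rpow_atTop hp).comp hlogN).const_mul_atTop hδ
    have h2 := (h1.const_div_atTop (384 * w / ε ^ 2)).mul_const (1 - (2 : ℝ) ^ (-p))⁻¹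
    rw [zero_mul] at h2
    have h3 := (ENNReal.continuous_ofReal.tendsto 0).comp h2
    rw [ENNReal.ofReal_zero] at h3
    exact h3
  refine tendsto_of_tendsto_of_tendsto_of_le_of_le' tendsto_const_nhds hlim
    (Eventually.of_forall fun _ => bot_le) ?_
  filter_upwards [hD, hlogN.eventually_gt_atTop 0, hNreal.eventually_gt_atTop 0] with k hk hlog hN0
  have := measure_exists_lt_div_DL_le (hl k) (hY k) hw (hφ k) (div_pos hlog hN0) hδ hp hN0 hε hk
  rwa [mul_div_cancel₀ _ hN0.ne'] at this

end Asymptotic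

/-! ### Coefficient functions of the four stochastic terms -/

section Coefficients

variable {ι : Type*} [Fintype ι] {l v : ι → ℝ}

lemma hasDerivAt_one_add_mul (a c : ℝ) : HasDerivAt (fun c => 1 + c * a) a c := by
  simpa using ((hasDerivAt_id c).mul_const a).const_add 1

lemma continuousOn_div_one_add_pow {a : ℝ} (ha : 0 ≤ a) {g : ℝ → ℝ} (hg : Continuous g) (i : ℕ) :
    ContinuousOn (fun c => g c / (1 + c * a) ^ i) (Ioi 0) := by
  refine hg.continuousOn.div (by fun_prop) fun c hc => ?_
  have : 0 < c := hc
  positivity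

lemma sum_le_eight_mul_DL {c : ℝ} {ψ : ι → ℝ}
    (h : ∀ j, ψ j ≤ 8 * (v j ^ 2 / (1 + c * l j) + logGap (c * l j))) :
    ∑ j, ψ j ≤ 8 * DL l v c := by
  rw [DL, D1L, D2L_eq_sum_logGap, ← Finset.sum_add_distrib, Finset.mul_sum]
  exact Finset.sum_le_sum fun j _ => h j

lemma le_of_le_bias_coefficient {x b y : ℝ} (hx : 0 ≤ x) (h : y ≤ 4 * (b ^ 2 / (1 + x))) :
    y ≤ 8 * (b ^ 2 / (1 + x) + logGap x) := by
  have h1 := logGap_nonneg hx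
  have h2 : 0 ≤ b ^ 2 / (1 + x) := by positivity
  linarith

/-- The 8 comes from the factor 1/2 in `half_sq_le_logGap`. -/
lemma le_of_le_variance_coefficient {x b y : ℝ} (hx : 0 ≤ x) (h : y ≤ 4 * (x / (1 + x)) ^ 2) :
    y ≤ 8 * (b ^ 2 / (1 + x) + logGap x) := by
  have h1 := half_sq_le_logGap hx
  have h2 : 0 ≤ b ^ 2 / (1 + x) := by positivity
  linarith

/-- The terms linear in Z are controlled by the bias summand v²/(1 + x) with x = cλ, and those in Z²
- 1 by (x/(1 + x))², hence by the variance summand. The operator c d/dc preserves both bounds. -/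
lemma isDominatedByDL_R1L (hl : ∀ j, 0 ≤ l j) :
    IsDominatedByDL l v (fun j c => 2 * v j / (1 + c * l j))
      (fun j c => -(2 * v j * l j) / (1 + c * l j) ^ 2) where
  hasDerivAt j c hc := by
    have h0 : 1 + c * l j ≠ 0 := by have := hl j; positivity
    refine ((hasDerivAt_const c (2 * v j)).fun_div
      (hasDerivAt_one_add_mul (l j) c) h0).congr_deriv ?_
    simp
  continuousOn j := continuousOn_div_one_add_pow (hl j) continuous_const 2
  sum_sq_le c hc := by
    refine sum_le_eight_mul_DL fun j => ?_
    have hx := mul_nonneg hc.le (hl j)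
    refine le_of_le_bias_coefficient hx ?_
    rw [div_pow, mul_div_assoc', div_le_div_iff₀ (by positivity) (by positivity)]
    have := mul_nonneg (mul_nonneg (sq_nonneg (v j)) hx) (by positivity : 0 ≤ 1 + c * l j)
    nlinarith
  sum_deriv_sq_le c hc := by
    refine sum_le_eight_mul_DL fun j => ?_
    have hx := mul_nonneg hc.le (hl j)
    refine le_of_le_bias_coefficient hx ?_
    rw [show c * (-(2 * v j * l j) / (1 + c * l j) ^ 2)
      = -(2 * v j * (c * l j)) / (1 + c * l j) ^ 2 by ring]
    generalize c * l j = x at hx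
    have h1 : (-(2 * v j * x) / (1 + x) ^ 2) ^ 2
        = 4 * (v j ^ 2 / (1 + x)) * (x ^ 2 / (1 + x) ^ 3) := by field_simp; ring
    rw [h1]
    refine mul_le_of_le_one_right (by positivity) ((div_le_one (by positivity)).2 ?_)
    nlinarith [pow_nonneg hx 3]

lemma isDominatedByDL_R2L (hl : ∀ j, 0 ≤ l j) :
    IsDominatedByDL l v (fun j c => c * l j / (1 + c * l j))
      (fun j c => l j / (1 + c * l j) ^ 2) where
  hasDerivAt j c hc := by
    have h0 : 1 + c * l j ≠ 0 := by have := hl j; positivity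
    refine (((hasDerivAt_id c).mul_const (l j)).fun_div
      (hasDerivAt_one_add_mul (l j) c) h0).congr_deriv ?_
    simp only [id]
    ring
  continuousOn j := continuousOn_div_one_add_pow (hl j) continuous_const 2
  sum_sq_le c hc := by
    refine sum_le_eight_mul_DL fun j => ?_
    have hx := mul_nonneg hc.le (hl j)
    refine le_of_le_variance_coefficient hx ?_
    have := sq_nonneg (c * l j / (1 + c * l j))
    linarith
  sum_deriv_sq_le c hc := by
    refine sum_le_eight_mul_DL fun j => ?_
    have hx := mul_nonneg hc.le (hl j)
    refine le_of_le_variance_coefficient hx ?_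
    rw [mul_div_assoc']
    generalize c * l j = x at hx
    have h1 : (x / (1 + x) ^ 2) ^ 2 = (x / (1 + x)) ^ 2 * (1 / (1 + x) ^ 2) := by
      field_simp
    have h2 : 1 / (1 + x) ^ 2 ≤ 1 := (div_le_one (by positivity)).2 (by nlinarith)
    rw [h1]
    nlinarith [sq_nonneg (x / (1 + x))]

lemma isDominatedByDL_R3 (hl : ∀ j, 0 ≤ l j) :
    IsDominatedByDL l v (fun j c => 2 * v j * (c * l j) / (1 + c * l j) ^ 2)
      (fun j c => 2 * v j * l j * (1 - c * l j) / (1 + c * l j) ^ 3) where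
  hasDerivAt j c hc := by
    have h0 : 1 + c * l j ≠ 0 := by have := hl j; positivity
    refine ((((hasDerivAt_id c).mul_const (l j)).const_mul (2 * v j)).fun_div
      ((hasDerivAt_one_add_mul (l j) c).fun_pow 2) (pow_ne_zero 2 h0)).congr_deriv ?_
    rw [div_eq_div_iff (pow_ne_zero _ (pow_ne_zero _ h0)) (pow_ne_zero _ h0)]
    simp only [id]
    push_cast
    ring
  continuousOn j := continuousOn_div_one_add_pow (hl j) (by fun_prop) 3
  sum_sq_le c hc := by
    refine sum_le_eight_mul_DL fun j => ?_
    have hx := mul_nonneg hc.le (hl j)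
    refine le_of_le_bias_coefficient hx ?_
    generalize c * l j = x at hx
    have h1 : (2 * v j * x / (1 + x) ^ 2) ^ 2
        = 4 * (v j ^ 2 / (1 + x)) * (x ^ 2 / (1 + x) ^ 3) := by field_simp; ring
    rw [h1]
    refine mul_le_of_le_one_right (by positivity) ((div_le_one (by positivity)).2 ?_)
    nlinarith [pow_nonneg hx 3]
  sum_deriv_sq_le c hc := by
    refine sum_le_eight_mul_DL fun j => ?_
    have hx := mul_nonneg hc.le (hl j)
    refine le_of_le_bias_coefficient hx ?_
    rw [show c * (2 * v j * l j * (1 - c * l j) / (1 + c * l j) ^ 3)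
      = 2 * v j * (c * l j) * (1 - c * l j) / (1 + c * l j) ^ 3 by ring]
    generalize c * l j = x at hx
    have h1 : (2 * v j * x * (1 - x) / (1 + x) ^ 3) ^ 2
        = 4 * (v j ^ 2 / (1 + x)) * (x ^ 2 * (1 - x) ^ 2 / (1 + x) ^ 5) := by field_simp; ring
    rw [h1]
    refine mul_le_of_le_one_right (by positivity) ((div_le_one (by positivity)).2 ?_)
    have h2 : x ^ 2 ≤ (1 + x) ^ 2 := by nlinarith
    have h3 : (1 - x) ^ 2 ≤ (1 + x) ^ 2 := by nlinarith
    calc x ^ 2 * (1 - x) ^ 2 ≤ (1 + x) ^ 2 * (1 + x) ^ 2 := by gcongr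
      _ = (1 + x) ^ 4 := by ring
      _ ≤ (1 + x) ^ 5 := pow_le_pow_right₀ (by linarith) (by norm_num)

lemma isDominatedByDL_R4 (hl : ∀ j, 0 ≤ l j) :
    IsDominatedByDL l v (fun j c => (c * l j) ^ 2 / (1 + c * l j) ^ 2)
      (fun j c => 2 * l j * (c * l j) / (1 + c * l j) ^ 3) where
  hasDerivAt j c hc := by
    have h0 : 1 + c * l j ≠ 0 := by have := hl j; positivity
    refine ((((hasDerivAt_id c).mul_const (l j)).fun_pow 2).fun_div
      ((hasDerivAt_one_add_mul (l j) c).fun_pow 2) (pow_ne_zero 2 h0)).congr_deriv ?_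
    simp only [id]
    field_simp
    ring
  continuousOn j := continuousOn_div_one_add_pow (hl j) (by fun_prop) 3
  sum_sq_le c hc := by
    refine sum_le_eight_mul_DL fun j => ?_
    have hx := mul_nonneg hc.le (hl j)
    refine le_of_le_variance_coefficient hx ?_
    generalize c * l j = x at hx
    rw [← div_pow, ← pow_mul]
    have h1 : x / (1 + x) ≤ 1 := (div_le_one (by positivity)).2 (by linarith)
    have h2 : (x / (1 + x)) ^ (2 * 2) ≤ (x / (1 + x)) ^ 2 :=
      pow_le_pow_of_le_one (by positivity) h1 (by norm_num)
    have := sq_nonneg (x / (1 + x))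
    linarith
  sum_deriv_sq_le c hc := by
    refine sum_le_eight_mul_DL fun j => ?_
    have hx := mul_nonneg hc.le (hl j)
    refine le_of_le_variance_coefficient hx ?_
    rw [show c * (2 * l j * (c * l j) / (1 + c * l j) ^ 3)
      = 2 * (c * l j) * (c * l j) / (1 + c * l j) ^ 3 by ring]
    generalize c * l j = x at hx
    have h1 : (2 * x * x / (1 + x) ^ 3) ^ 2
        = 4 * (x / (1 + x)) ^ 2 * (x ^ 2 / (1 + x) ^ 4) := by field_simp; ring
    rw [h1]
    refine mul_le_of_le_one_right (by positivity) ((div_le_one (by positivity)).2 ?_)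
    calc x ^ 2 ≤ (1 + x) ^ 2 := by nlinarith
      _ ≤ (1 + x) ^ 4 := pow_le_pow_right₀ (by linarith) (by norm_num)

end Coefficients

/-! ### The stochastic conditions under polynomial growth -/

section StochasticConditions

variable {Ω : Type*} [MeasurableSpace Ω] {P : Measure Ω} {N : ℕ → ℕ}
  {m δ p : ℝ} {l v : ∀ k, Fin (N k) → ℝ} {Z : ∀ k, Ω → Fin (N k) → ℝ}

lemma isOrthogonalFamily_gaussian {k : ℕ}
    (hZ : HasLaw (Z k) (Measure.pi fun _ => gaussianReal 0 1) P) :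
    IsOrthogonalFamily P (Z k) (∫ x, x * x ∂gaussianReal 0 1) :=
  isOrthogonalFamily_comp hZ (g := fun x => x) (memLp_id_gaussianReal' 2 (by simp))
    measurable_id (by simp)

lemma isOrthogonalFamily_gaussian_sq {k : ℕ}
    (hZ : HasLaw (Z k) (Measure.pi fun _ => gaussianReal 0 1) P) :
    IsOrthogonalFamily P (fun ω j => Z k ω j ^ 2 - 1)
      (∫ x, (x ^ 2 - 1) * (x ^ 2 - 1) ∂gaussianReal 0 1) :=
  isOrthogonalFamily_comp hZ (g := fun x => x ^ 2 - 1) memLp_sq_sub_one (by fun_prop)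
    integral_sq_sub_one

lemma R1L_eq {ι : Type*} [Fintype ι] (l v Z : ι → ℝ) (c : ℝ) :
    R1L l v Z c = ∑ j, Z j * (2 * v j / (1 + c * l j)) := by
  rw [R1L, Finset.mul_sum]
  exact Finset.sum_congr rfl fun j _ => by ring

lemma R2L_eq {ι : Type*} [Fintype ι] (l Z : ι → ℝ) (c : ℝ) :
    R2L l Z c = -∑ j, (Z j ^ 2 - 1) * (c * l j / (1 + c * l j)) := by
  simp only [R2L, mul_div_assoc]

lemma R3_eq {ι : Type*} [Fintype ι] (l v Z : ι → ℝ) (c : ℝ) :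
    R3 l v Z c = -∑ j, Z j * (2 * v j * (c * l j) / (1 + c * l j) ^ 2) := by
  rw [R3, neg_mul, Finset.mul_sum]
  exact congrArg _ (Finset.sum_congr rfl fun j _ => by ring)

lemma R4_eq {ι : Type*} [Fintype ι] (l Z : ι → ℝ) (c : ℝ) :
    R4 l Z c = ∑ j, (Z j ^ 2 - 1) * ((c * l j) ^ 2 / (1 + c * l j) ^ 2) :=
  Finset.sum_congr rfl fun j _ => by ring

/-- The stochastic terms of the log likelihood and of the squared error are uniformly negligible
as soon as the variance term grows polynomially. -/
lemma stochastic_terms_negligible [IsFiniteMeasure P] (hN : Tendsto N atTop atTop)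
    (hδ : 0 < δ) (hp : 0 < p)
    (hl : ∀ k j, 0 ≤ l k j) (hZ : ∀ k, HasLaw (Z k) (Measure.pi fun _ => gaussianReal 0 1) P)
    (hD : ∀ᶠ k in atTop, ∀ c ∈ scaleInterval m (N k), δ * (N k * c) ^ p ≤ D2L (l k) c) :
    SupTendstoZeroInProb P (fun k => scaleInterval m (N k)) (fun k c ω =>
      (|R1L (l k) (v k) (Z k ω) c| + |R2L (l k) (Z k ω) c|) / DL (l k) (v k) c) ∧
    SupTendstoZeroInProb P (fun k => scaleInterval m (N k)) (fun k c ω =>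
      (|R3 (l k) (v k) (Z k ω) c| + |R4 (l k) (Z k ω) c|) / DL (l k) (v k) c) := by
  have hw1 : 0 ≤ ∫ x : ℝ, x * x ∂gaussianReal 0 1 := integral_nonneg fun x => mul_self_nonneg x
  have hw2 : 0 ≤ ∫ x : ℝ, (x ^ 2 - 1) * (x ^ 2 - 1) ∂gaussianReal 0 1 :=
    integral_nonneg fun x => mul_self_nonneg _
  have hY1 := fun k => isOrthogonalFamily_gaussian (hZ k)
  have hY2 := fun k => isOrthogonalFamily_gaussian_sq (hZ k)
  have h1 := supTendstoZeroInProb_of_orthogonal hN hδ hp hw1 hl hY1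
    (fun k => isDominatedByDL_R1L (v := v k) (hl k)) hD
  have h2 := supTendstoZeroInProb_of_orthogonal hN hδ hp hw2 hl hY2
    (fun k => isDominatedByDL_R2L (v := v k) (hl k)) hD
  have h3 := supTendstoZeroInProb_of_orthogonal hN hδ hp hw1 hl hY1
    (fun k => isDominatedByDL_R3 (v := v k) (hl k)) hD
  have h4 := supTendstoZeroInProb_of_orthogonal hN hδ hp hw2 hl hY2
    (fun k => isDominatedByDL_R4 (v := v k) (hl k)) hD
  refine ⟨(h1.add h2).mono one_pos (Eventually.of_forall fun k c _ ω => ?_),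
    (h3.add h4).mono one_pos (Eventually.of_forall fun k c _ ω => ?_)⟩
  · rw [one_mul, add_div, R1L_eq, R2L_eq, abs_neg]
  · rw [one_mul, add_div, R3_eq, R4_eq, abs_neg]

lemma normSqVar_sub_postVar {ι : Type*} [Fintype ι] (l Z : ι → ℝ) (c : ℝ) :
    normSqVar l Z c - postVar l c = ∑ j, (Z j ^ 2 - 1) * (c * l j / (1 + c * l j)) := by
  rw [normSqVar, postVar, ← Finset.sum_sub_distrib]
  refine Finset.sum_congr rfl fun j _ => ?_
  ring

/-- The squared norm of the centred posterior concentrates uniformly around the posterior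
variance. -/
lemma normSqVar_concentrates [IsFiniteMeasure P] (hN : Tendsto N atTop atTop)
    (hδ : 0 < δ) (hp : 0 < p)
    (hl : ∀ k j, 0 ≤ l k j) (hZ : ∀ k, HasLaw (Z k) (Measure.pi fun _ => gaussianReal 0 1) P)
    (hD : ∀ᶠ k in atTop, ∀ c ∈ scaleInterval m (N k), δ * (N k * c) ^ p ≤ D2L (l k) c)
    (hvar : ∃ C : ℝ, 0 < C ∧ ∀ᶠ k in atTop, ∀ c ∈ scaleInterval m (N k),
      D2L (l k) c ≤ C * postVar (l k) c) :
    SupTendstoZeroInProb P (fun k => scaleInterval m (N k)) (fun k c ω =>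
      |normSqVar (l k) (Z k ω) c / postVar (l k) c - 1|) := by
  obtain ⟨C, hC, hvar⟩ := hvar
  have hw2 : 0 ≤ ∫ x : ℝ, (x ^ 2 - 1) * (x ^ 2 - 1) ∂gaussianReal 0 1 :=
    integral_nonneg fun x => mul_self_nonneg _
  -- With `v := 0` the denominator `DL` becomes `D2L`, which is comparable to the posterior
  -- variance.
  have h2 := supTendstoZeroInProb_of_orthogonal hN hδ hp hw2 hl
    (fun k => isOrthogonalFamily_gaussian_sq (hZ k))
    (fun k => isDominatedByDL_R2L (v := 0) (hl k)) hD
  have hNreal : Tendsto (fun k => (N k : ℝ)) atTop atTop := tendsto_natCast_atTop_atTop.comp hN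
  refine h2.mono hC ?_
  filter_upwards [hvar, hD, hNreal.eventually_gt_atTop 1] with k hk hDk hN1 c hc ω
  have hc0 : 0 < c := (div_pos (Real.log_pos hN1) (by linarith)).trans_le hc.1
  have hD0 : 0 < D2L (l k) c := lt_of_lt_of_le (by positivity) (hDk c hc)
  have hs : 0 < postVar (l k) c := pos_of_mul_pos_right (hD0.trans_le (hk c hc)) hC.le
  have h0 : DL (l k) 0 c = D2L (l k) c := by simp [DL, D1L]
  rw [div_sub_one hs.ne', normSqVar_sub_postVar, abs_div, abs_of_pos hs, h0, mul_div_assoc',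
    div_le_div_iff₀ hs hD0]
  have := mul_le_mul_of_nonneg_left (hk c hc)
    (abs_nonneg (∑ j, (Z k ω j ^ 2 - 1) * (c * l k j / (1 + c * l k j))))
  linarith

end StochasticConditions

/-! ### Variance terms and counting functions -/

section Counting

variable {ι : Type*} [Fintype ι] {q l : ι → ℝ} {n m c₀ C₀ δ Δ x c : ℝ}

open scoped Classical in
/-- The number of indices with `q j ≤ x`. -/
noncomputable def countLE (q : ι → ℝ) (x : ℝ) : ℝ := ∑ j, if q j ≤ x then 1 else 0

/-- Regular variation of the counting function of `q`. -/
structure RegularCounting (q : ι → ℝ) (n c₀ C₀ : ℝ) : Prop where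
  pos : ∀ j, 0 < q j
  lower : ∀ x, 2 ≤ x → x ≤ n → c₀ * x ≤ countLE q x
  growth : ∀ x r, 2 ≤ x → x ≤ n → 1 ≤ r → countLE q (r * x) ≤ C₀ * (r * √r) * countLE q x
  decay : ∀ x r, 2 ≤ x → x ≤ n → 1 ≤ r → √r * countLE q (x / r) ≤ C₀ * countLE q x

lemma countLE_nonneg : 0 ≤ countLE q x :=
  Finset.sum_nonneg fun j _ => by split_ifs <;> norm_num

lemma countLE_comp_equiv {ι' : Type*} [Fintype ι'] (σ : ι' ≃ ι) :
    countLE (fun j => q (σ j)) x = countLE q x :=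
  Equiv.sum_comp σ fun j => if q j ≤ x then (1 : ℝ) else 0

lemma RegularCounting.comp_equiv (h : RegularCounting q n c₀ C₀) {ι' : Type*} [Fintype ι']
    (σ : ι' ≃ ι) : RegularCounting (fun j => q (σ j)) n c₀ C₀ where
  pos j := h.pos _
  lower := by simpa only [countLE_comp_equiv] using h.lower
  growth := by simpa only [countLE_comp_equiv] using h.growth
  decay := by simpa only [countLE_comp_equiv] using h.decay

open scoped Classical in
lemma countLE_eq_card : countLE q x = ((Finset.univ.filter fun j => q j ≤ x).card : ℝ) := by
  rw [countLE, Finset.sum_boole]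

/-- Summation over the level sets of a function with geometrically decreasing weights. -/
lemma sum_comp_le_geometric {ι : Type*} {J : Finset ι} {s : ι → ℕ} {g : ℕ → ℝ} {B r : ℝ}
    (hB : 0 ≤ B) (hr0 : 0 ≤ r) (hr1 : r < 1)
    (h : ∀ t, ((J.filter fun j => s j = t).card : ℝ) * g t ≤ B * r ^ t) :
    ∑ j ∈ J, g (s j) ≤ B * (1 - r)⁻¹ := by
  rw [Finset.sum_comp g s]
  calc ∑ t ∈ J.image s, (J.filter fun j => s j = t).card • g t
      ≤ ∑ t ∈ J.image s, B * r ^ t := Finset.sum_le_sum fun t _ => by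
        rw [nsmul_eq_mul]; exact h t
    _ ≤ ∑' t, B * r ^ t := ((summable_geometric_of_lt_one hr0 hr1).mul_left B).sum_le_tsum _
        fun t _ => by positivity
    _ = B * (1 - r)⁻¹ := by rw [tsum_mul_left, tsum_geometric_of_lt_one hr0 hr1]

lemma sqrt_two_pow (t : ℕ) : √((2 : ℝ) ^ t) = √2 ^ t := by
  rw [Real.sqrt_eq_iff_mul_self_eq (by positivity) (by positivity), ← mul_pow,
    Real.mul_self_sqrt (by norm_num)]

open scoped Classical in
-- On the level x/q ≈ 2^t the weight is about 2^(t/4), while `decay` bounds the count by a multiple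
-- of 2^(-t/2); the ratio is 2^(-1/4).
lemma RegularCounting.sum_near_le (h : RegularCounting q n c₀ C₀) (hC₀ : 0 ≤ C₀) (hx : 2 ≤ x)
    (hxn : x ≤ n) :
    ∑ j ∈ Finset.univ.filter (fun j => q j ≤ x), √√(x / q j)
      ≤ C₀ * √√2 * (1 - (√√2)⁻¹)⁻¹ * countLE q x := by
  have hs : ∀ j, ∃ t : ℕ, q j ≤ x → (2 : ℝ) ^ t ≤ x / q j ∧ x / q j < 2 ^ (t + 1) := by
    intro j
    by_cases hj : q j ≤ x
    · obtain ⟨t, ht⟩ := exists_nat_pow_near (x := x / q j) (y := 2) ((one_le_div (h.pos j)).2 hj)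
        (by norm_num)
      exact ⟨t, fun _ => ht⟩
    · exact ⟨0, fun h => absurd h hj⟩
  choose s hs using hs
  have he : 1 < √√(2 : ℝ) := by
    rw [Real.lt_sqrt (by norm_num), Real.lt_sqrt (by norm_num)]; norm_num
  have hee : √√(2 : ℝ) ^ 2 = √2 := Real.sq_sqrt (by positivity)
  have key := sum_comp_le_geometric (J := Finset.univ.filter fun j => q j ≤ x) (s := s)
    (g := fun t => √√2 * √√2 ^ t) (B := C₀ * √√2 * countLE q x) (r := (√√2)⁻¹)
    (mul_nonneg (by positivity) countLE_nonneg)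
    (by positivity) (inv_lt_one_of_one_lt₀ he) ?_
  · refine le_trans (Finset.sum_le_sum fun j hj => ?_) (key.trans (le_of_eq (by ring)))
    have h1 := (hs j (Finset.mem_filter.1 hj).2).2.le
    have h2 := Real.sqrt_le_sqrt (Real.sqrt_le_sqrt h1)
    rw [sqrt_two_pow] at h2
    refine h2.trans (le_of_eq ?_)
    rw [← pow_succ', Real.sqrt_eq_iff_mul_self_eq (by positivity) (by positivity), ← mul_pow,
      Real.mul_self_sqrt (by positivity)]
  · intro t
    have h1 : (((Finset.univ.filter fun j => q j ≤ x).filter fun j => s j = t).card : ℝ)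
        ≤ countLE q (x / 2 ^ t) := by
      rw [countLE_eq_card]
      refine Nat.cast_le.2 (Finset.card_le_card fun j hj => ?_)
      simp only [Finset.mem_filter, Finset.mem_univ, true_and] at hj ⊢
      have h2 := (hs j hj.1).1
      rw [hj.2, le_div_iff₀ (h.pos j)] at h2
      rw [le_div_iff₀ (by positivity)]
      linarith
    have h2 := h.decay x (2 ^ t) hx hxn (one_le_pow₀ (by norm_num))
    rw [sqrt_two_pow] at h2
    have h3 : √√(2 : ℝ) * √√2 ^ t = √√2 * (√√2)⁻¹ ^ t * √2 ^ t := by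
      have h4 : √(2 : ℝ) ^ t = √√2 ^ t * √√2 ^ t := by rw [← mul_pow, ← pow_two, hee]
      rw [h4, inv_pow]
      field_simp
    calc _ ≤ countLE q (x / 2 ^ t) * (√√2 * √√2 ^ t) := by gcongr
      _ = √√2 * (√√2)⁻¹ ^ t * (√2 ^ t * countLE q (x / 2 ^ t)) := by rw [h3]; ring
      _ ≤ √√2 * (√√2)⁻¹ ^ t * (C₀ * countLE q x) := by gcongr
      _ = _ := by ring

open scoped Classical in
-- On the level q/x ≈ 2^t the weight is at most 4^(-t), while `growth` bounds the count by a
-- multiple of 2^(3t/2); the ratio is 2^(-1/2).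
lemma RegularCounting.sum_far_le (h : RegularCounting q n c₀ C₀) (hC₀ : 0 ≤ C₀) (hx : 2 ≤ x)
    (hxn : x ≤ n) :
    ∑ j ∈ Finset.univ.filter (fun j => ¬ q j ≤ x), (x / q j) ^ 2
      ≤ C₀ * (2 * √2) * (1 - √2 / 2)⁻¹ * countLE q x := by
  have hx0 : 0 < x := by linarith
  have hs : ∀ j, ∃ t : ℕ, ¬ q j ≤ x → (2 : ℝ) ^ t ≤ q j / x ∧ q j / x < 2 ^ (t + 1) := by
    intro j
    by_cases hj : q j ≤ x
    · exact ⟨0, fun h => absurd hj h⟩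
    · obtain ⟨t, ht⟩ := exists_nat_pow_near (x := q j / x) (y := 2)
        ((one_le_div hx0).2 (not_le.1 hj).le) (by norm_num)
      exact ⟨t, fun _ => ht⟩
  choose s hs using hs
  have he : √(2 : ℝ) / 2 < 1 := by
    rw [div_lt_one (by norm_num), Real.sqrt_lt' (by norm_num)]; norm_num
  have key := sum_comp_le_geometric (J := Finset.univ.filter fun j => ¬ q j ≤ x) (s := s)
    (g := fun t => ((4 : ℝ) ^ t)⁻¹) (B := C₀ * (2 * √2) * countLE q x) (r := √2 / 2)
    (mul_nonneg (by positivity) countLE_nonneg) (by positivity) he ?_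
  · refine le_trans (Finset.sum_le_sum fun j hj => ?_) (key.trans (le_of_eq (by ring)))
    have h1 := (hs j (Finset.mem_filter.1 hj).2).1
    have hq := h.pos j
    rw [← inv_div, inv_pow, show (4 : ℝ) = 2 ^ 2 by norm_num, ← pow_mul, mul_comm 2, pow_mul]
    gcongr
  · intro t
    have h1 : (((Finset.univ.filter fun j => ¬ q j ≤ x).filter fun j => s j = t).card : ℝ)
        ≤ countLE q (2 ^ (t + 1) * x) := by
      rw [countLE_eq_card]
      refine Nat.cast_le.2 (Finset.card_le_card fun j hj => ?_)
      simp only [Finset.mem_filter, Finset.mem_univ, true_and] at hj ⊢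
      have h2 := (hs j hj.1).2
      rw [hj.2, div_lt_iff₀ hx0] at h2
      exact h2.le
    have h2 := h.growth x (2 ^ (t + 1)) hx hxn (one_le_pow₀ (by norm_num))
    rw [sqrt_two_pow] at h2
    calc _ ≤ C₀ * (2 ^ (t + 1) * √2 ^ (t + 1)) * countLE q x * ((4 : ℝ) ^ t)⁻¹ := by
          gcongr
          exact h1.trans h2
      _ = _ := by
          rw [div_pow, show (4 : ℝ) = 2 * 2 by norm_num, mul_pow]
          field_simp
          ring

/-- The gap is only logarithmic in t, and log t ≤ 4 t^(1/4). The quarter power is weak enough to be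
summed against the decay rate √r. -/
lemma logGap_le_sqrt_sqrt {y t : ℝ} (hm : 1 ≤ m) (hΔ : 0 < Δ) (hy : 0 ≤ y) (ht : 1 ≤ t)
    (hyt : y ≤ Δ * t ^ m) : logGap y ≤ (Real.log (1 + Δ) + 4 * m) * √√t := by
  have ht0 : 0 < t := by linarith
  have h1 : 1 ≤ t ^ m := Real.one_le_rpow ht (by linarith)
  have h2 : 1 + y ≤ (1 + Δ) * t ^ m := by nlinarith
  have h3 : 1 ≤ √√t := by
    rw [Real.one_le_sqrt, Real.one_le_sqrt]; exact ht
  have h4 : Real.log t ≤ 4 * √√t := by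
    have h5 := Real.log_le_sub_one_of_pos (x := √√t) (by linarith)
    rw [Real.log_sqrt (by positivity), Real.log_sqrt ht0.le] at h5
    linarith
  have h6 : 0 ≤ Real.log (1 + Δ) := Real.log_nonneg (by linarith)
  calc logGap y ≤ Real.log (1 + y) := logGap_le_log hy
    _ ≤ Real.log ((1 + Δ) * t ^ m) := Real.log_le_log (by linarith) h2
    _ = Real.log (1 + Δ) + m * Real.log t := by
        rw [Real.log_mul (by linarith) (by positivity), Real.log_rpow ht0]
    _ ≤ Real.log (1 + Δ) * √√t + m * (4 * √√t) := by
        gcongr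
        exact le_mul_of_one_le_right h6 h3
    _ = _ := by ring

lemma logGap_le_sq_of_le_one {y t : ℝ} (hm : 1 ≤ m) (hΔ : 0 < Δ) (hy : 0 ≤ y) (ht0 : 0 < t)
    (ht : t ≤ 1) (hyt : y ≤ Δ * t ^ m) : logGap y ≤ Δ ^ 2 * t ^ 2 := by
  have h1 : t ^ m ≤ t := by
    simpa using Real.rpow_le_rpow_of_exponent_ge ht0 ht hm
  calc logGap y ≤ y ^ 2 := logGap_le_sq hy
    _ ≤ (Δ * t) ^ 2 := by
        gcongr
        exact hyt.trans (by gcongr)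
    _ = _ := by ring

/-- The variance term is at most of the order of the counting function. -/
lemma RegularCounting.exists_D2L_le (hm : 1 ≤ m) (hΔ : 0 < Δ) (hC₀ : 0 < C₀) :
    ∃ C : ℝ, 0 < C ∧ ∀ {ι : Type} [Fintype ι] {q l : ι → ℝ} {n c₀ x c : ℝ},
      RegularCounting q n c₀ C₀ → 2 ≤ x → x ≤ n → (∀ j, 0 ≤ c * l j) →
      (∀ j, c * l j ≤ Δ * (x / q j) ^ m) → D2L l c ≤ C * countLE q x := by
  have he : 1 < √√(2 : ℝ) := by
    rw [Real.lt_sqrt (by norm_num), Real.lt_sqrt (by norm_num)]; norm_num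
  have he2 : √(2 : ℝ) / 2 < 1 := by
    rw [div_lt_one (by norm_num), Real.sqrt_lt' (by norm_num)]; norm_num
  have h1 : 0 < (1 - (√√(2 : ℝ))⁻¹)⁻¹ :=
    inv_pos.2 (sub_pos.2 (inv_lt_one_of_one_lt₀ he))
  have h2 : 0 < (1 - √(2 : ℝ) / 2)⁻¹ := inv_pos.2 (sub_pos.2 he2)
  have h3 : 0 ≤ Real.log (1 + Δ) := Real.log_nonneg (by linarith)
  refine ⟨(Real.log (1 + Δ) + 4 * m) * (C₀ * √√2 * (1 - (√√2)⁻¹)⁻¹) +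
    Δ ^ 2 * (C₀ * (2 * √2) * (1 - √2 / 2)⁻¹), by positivity, ?_⟩
  intro ι _ q l n c₀ x c h hx hxn hl hlx
  classical
  have hx0 : 0 < x := by linarith
  rw [D2L_eq_sum_logGap, ← Finset.sum_filter_add_sum_filter_not _ fun j => q j ≤ x, add_mul,
    mul_assoc (Real.log (1 + Δ) + 4 * m), mul_assoc (Δ ^ 2)]
  refine add_le_add ?_ ?_
  · refine le_trans ?_ (mul_le_mul_of_nonneg_left (h.sum_near_le hC₀.le hx hxn) (by positivity))
    rw [Finset.mul_sum]
    refine Finset.sum_le_sum fun j hj => ?_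
    exact logGap_le_sqrt_sqrt hm hΔ (hl j)
      ((one_le_div (h.pos j)).2 (Finset.mem_filter.1 hj).2) (hlx j)
  · refine le_trans ?_ (mul_le_mul_of_nonneg_left (h.sum_far_le hC₀.le hx hxn) (by positivity))
    rw [Finset.mul_sum]
    refine Finset.sum_le_sum fun j hj => ?_
    exact logGap_le_sq_of_le_one hm hΔ (hl j) (div_pos hx0 (h.pos j))
      ((div_le_one (h.pos j)).2 (not_le.1 (Finset.mem_filter.1 hj).2).le) (hlx j)

lemma le_of_countLE {ψ : ι → ℝ} {b : ℝ} (h0 : ∀ j, 0 ≤ ψ j) (h : ∀ j, q j ≤ x → b ≤ ψ j) :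
    b * countLE q x ≤ ∑ j, ψ j := by
  rw [countLE, Finset.mul_sum]
  refine Finset.sum_le_sum fun j _ => ?_
  split_ifs with hj
  · simpa using h j hj
  · simpa using h0 j

lemma le_mul_of_le {ι : Type*} {q l : ι → ℝ} (hm : 0 ≤ m) (hδ : 0 < δ) (hq : ∀ j, 0 < q j)
    (hlx : ∀ j, δ * (x / q j) ^ m ≤ c * l j) (j : ι) (hj : q j ≤ x) : δ ≤ c * l j :=
  (le_mul_of_one_le_right hδ.le
    (Real.one_le_rpow ((one_le_div (hq j)).2 hj) hm)).trans (hlx j)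

/-- The variance term is at least of the order of the counting function. -/
lemma countLE_le_D2L (hm : 0 ≤ m) (hδ : 0 < δ) (hq : ∀ j, 0 < q j) (hl : ∀ j, 0 ≤ c * l j)
    (hlx : ∀ j, δ * (x / q j) ^ m ≤ c * l j) : logGap δ * countLE q x ≤ D2L l c :=
  le_of_countLE (fun j => logGap_nonneg (hl j)) fun j hj =>
    logGap_mono hδ.le (le_mul_of_le hm hδ hq hlx j hj)

/-- The posterior variance is at least of the order of the counting function. -/
lemma countLE_le_postVar (hm : 0 ≤ m) (hδ : 0 < δ) (hq : ∀ j, 0 < q j) (hl : ∀ j, 0 ≤ c * l j)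
    (hlx : ∀ j, δ * (x / q j) ^ m ≤ c * l j) : δ / (1 + δ) * countLE q x ≤ postVar l c := by
  refine le_of_countLE (fun j => by have := hl j; positivity) fun j hj => ?_
  have h1 := le_mul_of_le hm hδ hq hlx j hj
  have h2 := hl j
  rw [div_le_div_iff₀ (by positivity) (by positivity)]
  nlinarith

end Counting

/-! ### Counting functions of the three index families -/

section Sequences

variable {ι : Type*} [Fintype ι] {q : ι → ℝ} {n c₀ C x y r : ℝ} {k : ℕ}

/-- A count of exact linear order satisfies both comparisons because r ≤ r√r and √r ≤ r for r ≥ 1.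
-/
lemma regularCounting_of_linear (hq : ∀ j, 0 < q j) (hc₀ : 0 < c₀)
    (hlow : ∀ x, 2 ≤ x → x ≤ n → c₀ * x ≤ countLE q x)
    (hup : ∀ x, 0 ≤ x → countLE q x ≤ x) : RegularCounting q n c₀ c₀⁻¹ where
  pos := hq
  lower := hlow
  growth x r hx hxn hr := by
    have h1 : x ≤ c₀⁻¹ * countLE q x := by
      rw [inv_mul_eq_div, le_div_iff₀' hc₀]; exact hlow x hx hxn
    have h2 : 1 ≤ √r := Real.one_le_sqrt.2 hr
    have h0 : 0 ≤ r * x := by positivity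
    calc countLE q (r * x) ≤ r * x := hup _ h0
      _ ≤ r * √r * x := by
          rw [mul_right_comm]
          exact le_mul_of_one_le_right h0 h2
      _ ≤ r * √r * (c₀⁻¹ * countLE q x) := by gcongr
      _ = _ := by ring
  decay x r hx hxn hr := by
    have hr0 : 0 < r := by linarith
    have hsq : √r ≤ r := Real.sqrt_le_self_iff.2 (Or.inr hr)
    calc √r * countLE q (x / r) ≤ r * (x / r) := by
          gcongr
          · exact countLE_nonneg
          · exact hup _ (by positivity)
      _ = x := by field_simp
      _ ≤ _ := by rw [inv_mul_eq_div, le_div_iff₀' hc₀]; exact hlow x hx hxn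

/-- The counting function of `1, …, k`. -/
lemma countLE_fin (k : ℕ) (y : ℝ) :
    countLE (fun j : Fin k => (j : ℝ) + 1) y = min (k : ℝ) ⌊y⌋₊ := by
  classical
  rw [countLE_eq_card, ← Nat.cast_min, ← Fin.card_filter_val_lt]
  congr 2
  ext j
  simp only [Finset.mem_filter, Finset.mem_univ, true_and]
  rw [Nat.lt_iff_add_one_le, Nat.le_floor_iff' (by omega)]
  push_cast
  rfl

lemma countLE_fin_le (k : ℕ) (hy : 0 ≤ y) : countLE (fun j : Fin k => (j : ℝ) + 1) y ≤ y := by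
  rw [countLE_fin]
  exact (min_le_right _ _).trans (Nat.floor_le hy)

lemma countLE_fin_le_card (k : ℕ) (y : ℝ) : countLE (fun j : Fin k => (j : ℝ) + 1) y ≤ k := by
  rw [countLE_fin]
  exact min_le_left _ _

lemma countLE_fin_eq_zero (k : ℕ) (hy : y < 1) : countLE (fun j : Fin k => (j : ℝ) + 1) y = 0 := by
  rw [countLE_fin, Nat.floor_eq_zero.2 hy]
  simp

lemma half_min_le_countLE_fin (k : ℕ) (hy : 1 ≤ y) :
    min (k : ℝ) y ≤ 2 * countLE (fun j : Fin k => (j : ℝ) + 1) y := by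
  rw [countLE_fin]
  have h1 := Nat.lt_floor_add_one y
  have h2 : (1 : ℝ) ≤ ⌊y⌋₊ := by
    exact_mod_cast (Nat.one_le_floor_iff y).2 hy
  rw [mul_min_of_nonneg _ _ (by norm_num : (0 : ℝ) ≤ 2)]
  have h3 : (0 : ℝ) ≤ k := Nat.cast_nonneg k
  exact min_le_min (by linarith) (by linarith)

lemma regularCounting_fin (k : ℕ) :
    RegularCounting (fun j : Fin k => (j : ℝ) + 1) k (1 / 2) (1 / 2)⁻¹ := by
  refine regularCounting_of_linear (fun j => by positivity) (by norm_num) (fun x hx hxk => ?_)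
    fun x hx => countLE_fin_le k hx
  have := half_min_le_countLE_fin k (y := x) (by linarith)
  rw [min_eq_right hxk] at this
  linarith

/-- Rectangles below a level set. -/
lemma countLE_mul_countLE_le {ι' : Type*} [Fintype ι'] {q' : ι' → ℝ} {Q : ι × ι' → ℝ} {a b : ℝ}
    (h : ∀ i j, q i ≤ a → q' j ≤ b → Q (i, j) ≤ x) :
    countLE q a * countLE q' b ≤ countLE Q x := by
  rw [countLE, countLE, countLE, Finset.sum_mul_sum, Fintype.sum_prod_type]
  refine Finset.sum_le_sum fun i _ => Finset.sum_le_sum fun j _ => ?_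
  split_ifs with h1 h2 h3 <;> simp_all

/-- Rectangles covering a level set. -/
lemma countLE_le_countLE_mul {ι' : Type*} [Fintype ι'] {q' : ι' → ℝ} {Q : ι × ι' → ℝ} {a b : ℝ}
    (h : ∀ i j, Q (i, j) ≤ x → q i ≤ a ∧ q' j ≤ b) :
    countLE Q x ≤ countLE q a * countLE q' b := by
  rw [countLE, countLE, countLE, Finset.sum_mul_sum, Fintype.sum_prod_type]
  refine Finset.sum_le_sum fun i _ => Finset.sum_le_sum fun j _ => ?_
  by_cases hQ : Q (i, j) ≤ x
  · simp [hQ, (h i j hQ).1, (h i j hQ).2]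
  · rw [if_neg hQ]
    split_ifs <;> norm_num

/-- The level set lies between squares of sides √(x/2) and √x. The smallest value of the family is
2, which is why the lower bounds start at x = 2. -/
lemma regularCounting_sobolev (k : ℕ) :
    RegularCounting (fun p : Fin k × Fin k => ((p.1 : ℝ) + 1) ^ 2 + ((p.2 : ℝ) + 1) ^ 2)
      ((k : ℝ) ^ 2) (1 / 8) (1 / 8)⁻¹ := by
  refine regularCounting_of_linear (fun p => by positivity) (by norm_num) (fun x hx hxk => ?_)
    fun x hx => ?_
  · have h1 : 1 ≤ √(x / 2) := Real.one_le_sqrt.2 (by linarith)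
    have h2 := half_min_le_countLE_fin k h1
    have h3 : √(x / 2) ≤ k := by
      rw [Real.sqrt_le_left (by positivity)]
      linarith
    rw [min_eq_right h3] at h2
    have h4 := countLE_mul_countLE_le (q := fun j : Fin k => (j : ℝ) + 1)
      (q' := fun j : Fin k => (j : ℝ) + 1) (x := x) (a := √(x / 2)) (b := √(x / 2))
      (Q := fun p : Fin k × Fin k => ((p.1 : ℝ) + 1) ^ 2 + ((p.2 : ℝ) + 1) ^ 2)
      fun i j hi hj => by
        have hi2 := (Real.le_sqrt' (by positivity)).1 hi
        have hj2 := (Real.le_sqrt' (by positivity)).1 hj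
        simp only
        linarith
    have h5 : √(x / 2) * √(x / 2) = x / 2 := Real.mul_self_sqrt (by linarith)
    nlinarith
  · have h4 := countLE_le_countLE_mul (q := fun j : Fin k => (j : ℝ) + 1)
      (q' := fun j : Fin k => (j : ℝ) + 1) (x := x) (a := √x) (b := √x)
      (Q := fun p : Fin k × Fin k => ((p.1 : ℝ) + 1) ^ 2 + ((p.2 : ℝ) + 1) ^ 2)
      fun i j hij => by
        simp only at hij
        constructor
        · exact Real.le_sqrt_of_sq_le (by nlinarith [sq_nonneg ((j : ℝ) + 1)])
        · exact Real.le_sqrt_of_sq_le (by nlinarith [sq_nonneg ((i : ℝ) + 1)])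
    have h5 := countLE_fin_le k (Real.sqrt_nonneg x)
    have h6 : √x * √x = x := Real.mul_self_sqrt hx
    have h7 := countLE_nonneg (q := fun j : Fin k => (j : ℝ) + 1) (x := √x)
    nlinarith

open scoped Classical in
-- The summands telescope: 1/√(N + 1) ≤ 2(√(N + 1) - √N).
lemma sum_inv_sqrt_le (k : ℕ) (hy : 0 ≤ y) :
    ∑ i : Fin k, (if (i : ℝ) + 1 ≤ y then 1 / √((i : ℝ) + 1) else 0) ≤ 2 * √y := by
  have h1 : ∀ N : ℕ, ∑ i ∈ Finset.range N, 1 / √((i : ℝ) + 1) ≤ 2 * √N := by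
    intro N
    induction N with
    | zero => simp
    | succ N ih =>
      rw [Finset.sum_range_succ]
      push_cast
      have hs : 0 < √((N : ℝ) + 1) := Real.sqrt_pos.2 (by positivity)
      have h2 : 1 / √((N : ℝ) + 1) ≤ 2 * √((N : ℝ) + 1) - 2 * √N := by
        rw [div_le_iff₀ hs]
        have h3 := Real.mul_self_sqrt (by positivity : (0 : ℝ) ≤ (N : ℝ) + 1)
        have h4 := Real.mul_self_sqrt (Nat.cast_nonneg N : (0 : ℝ) ≤ N)
        nlinarith [sq_nonneg (√((N : ℝ) + 1) - √N)]
      linarith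
  rw [Fin.sum_univ_eq_sum_range (fun i => if (i : ℝ) + 1 ≤ y then 1 / √((i : ℝ) + 1) else 0) k,
    ← Finset.sum_filter]
  refine le_trans ?_ ((h1 ⌊y⌋₊).trans ?_)
  · refine Finset.sum_le_sum_of_subset_of_nonneg (fun i hi => ?_) fun i _ _ => by positivity
    rw [Finset.mem_filter] at hi
    rw [Finset.mem_range, Nat.lt_iff_add_one_le, Nat.le_floor_iff' (by omega)]
    exact_mod_cast hi.2
  · gcongr
    exact Nat.floor_le hy

lemma countLE_tensor (k : ℕ) (x : ℝ) :
    countLE (fun p : Fin k × Fin k => ((p.1 : ℝ) + 1) * ((p.2 : ℝ) + 1)) x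
      = ∑ i : Fin k, countLE (fun j : Fin k => (j : ℝ) + 1) (x / ((i : ℝ) + 1)) := by
  rw [countLE, Fintype.sum_prod_type]
  refine Finset.sum_congr rfl fun i _ => Finset.sum_congr rfl fun j _ => ?_
  have : ((i : ℝ) + 1) * ((j : ℝ) + 1) ≤ x ↔ (j : ℝ) + 1 ≤ x / ((i : ℝ) + 1) := by
    rw [le_div_iff₀' (by positivity)]
  simp only [this]

lemma le_countLE_tensor (hx : 2 ≤ x) (hxk : x ≤ (k : ℝ) ^ 2) :
    1 / 4 * x ≤ countLE (fun p : Fin k × Fin k => ((p.1 : ℝ) + 1) * ((p.2 : ℝ) + 1)) x := by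
  have hk : (1 : ℝ) ≤ k := by
    have : (0 : ℝ) ≤ k := Nat.cast_nonneg k
    nlinarith
  have key : ∀ a b : ℝ, 1 ≤ a → a ≤ k → 1 ≤ b → b ≤ k → a * b = x →
      1 / 4 * x ≤ countLE (fun p : Fin k × Fin k => ((p.1 : ℝ) + 1) * ((p.2 : ℝ) + 1)) x := by
    intro a b ha hak hb hbk hab
    have h1 := half_min_le_countLE_fin k ha
    have h2 := half_min_le_countLE_fin k hb
    rw [min_eq_right hak] at h1
    rw [min_eq_right hbk] at h2
    have h4 := countLE_mul_countLE_le (q := fun j : Fin k => (j : ℝ) + 1)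
      (q' := fun j : Fin k => (j : ℝ) + 1) (x := x) (a := a) (b := b)
      (Q := fun p : Fin k × Fin k => ((p.1 : ℝ) + 1) * ((p.2 : ℝ) + 1))
      fun i j hi hj => by
        rw [← hab]
        exact mul_le_mul hi hj (by positivity) (by linarith)
    nlinarith
  -- The region under the hyperbola contains an a × b rectangle with ab = x and both sides in [1,
  -- k]; flooring each side costs at most a factor 2.
  rcases le_total x k with h | h
  · exact key 1 x le_rfl hk (by linarith) h (one_mul x)
  · refine key k (x / k) hk le_rfl ((one_le_div (by linarith)).2 h) ?_ ?_
    · rw [div_le_iff₀ (by linarith)]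
      linarith
    · field_simp

open scoped Classical in
-- A row with i + 1 ≤ x grows by at most a factor 2r. A row empty at level x but not at r x has at
-- most r x/(i + 1) ≤ r√x/√(i + 1) points, a form that can be summed over i without a logarithm.
lemma countLE_tensor_growth_term (hx : 2 ≤ x) (hr : 1 ≤ r) (i : Fin k) :
    countLE (fun j : Fin k => (j : ℝ) + 1) (r * x / ((i : ℝ) + 1)) ≤
      2 * r * countLE (fun j : Fin k => (j : ℝ) + 1) (x / ((i : ℝ) + 1)) +
        r * √x * (if (i : ℝ) + 1 ≤ r * x then 1 / √((i : ℝ) + 1) else 0) := by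
  have hr0 : 0 < r := by linarith
  have hx0 : 0 < x := by linarith
  have hi : (0 : ℝ) < (i : ℝ) + 1 := by positivity
  have hT := countLE_nonneg (q := fun j : Fin k => (j : ℝ) + 1) (x := x / ((i : ℝ) + 1))
  have hsecond : 0 ≤ r * √x * (if (i : ℝ) + 1 ≤ r * x then 1 / √((i : ℝ) + 1) else 0) := by
    split_ifs <;> positivity
  by_cases h1 : (i : ℝ) + 1 ≤ x
  · have h2 := half_min_le_countLE_fin k ((one_le_div hi).2 h1)
    have h3 : countLE (fun j : Fin k => (j : ℝ) + 1) (r * x / ((i : ℝ) + 1))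
        ≤ r * min (k : ℝ) (x / ((i : ℝ) + 1)) := by
      rw [mul_min_of_nonneg _ _ hr0.le]
      refine le_min ((countLE_fin_le_card k _).trans
        (le_mul_of_one_le_left (Nat.cast_nonneg k) hr)) ?_
      rw [← mul_div_assoc]
      exact countLE_fin_le k (by positivity)
    nlinarith
  · push Not at h1
    by_cases h2 : (i : ℝ) + 1 ≤ r * x
    · rw [if_pos h2]
      have h3 := countLE_fin_le k (y := r * x / ((i : ℝ) + 1)) (by positivity)
      have h4 : r * x / ((i : ℝ) + 1) ≤ r * √x * (1 / √((i : ℝ) + 1)) := by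
        have h5 : √x ≤ √((i : ℝ) + 1) := Real.sqrt_le_sqrt h1.le
        have h6 := Real.mul_self_sqrt hx0.le
        have h7 := Real.mul_self_sqrt hi.le
        have h8 : 0 < √((i : ℝ) + 1) := Real.sqrt_pos.2 hi
        have e1 : r * x * √((i : ℝ) + 1) = r * (√x * √x) * √((i : ℝ) + 1) := by rw [h6]
        have e2 : r * √x * ((i : ℝ) + 1) = r * √x * (√((i : ℝ) + 1) * √((i : ℝ) + 1)) := by
          rw [h7]
        rw [mul_one_div, div_le_div_iff₀ hi h8, e1, e2]
        have h9 := mul_le_mul_of_nonneg_left h5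
          (by positivity : 0 ≤ r * √x * √((i : ℝ) + 1))
        linarith
      have : 0 ≤ 2 * r * countLE (fun j : Fin k => (j : ℝ) + 1) (x / ((i : ℝ) + 1)) := by
        positivity
      linarith
    · rw [countLE_fin_eq_zero k (y := r * x / ((i : ℝ) + 1))
        ((div_lt_one hi).2 (not_le.1 h2))]
      positivity

open scoped Classical in
-- Rows not saturated at level x shrink by a factor r, up to 2. In a saturated row the count is at
-- most k and at most x/(r(i + 1)), hence at most their geometric mean.
lemma countLE_tensor_decay_term (hx : 2 ≤ x) (hr : 1 ≤ r) (i : Fin k) :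
    countLE (fun j : Fin k => (j : ℝ) + 1) (x / r / ((i : ℝ) + 1)) ≤
      2 / r * countLE (fun j : Fin k => (j : ℝ) + 1) (x / ((i : ℝ) + 1)) +
        √(k * x / r) * (if (i : ℝ) + 1 ≤ x / k then 1 / √((i : ℝ) + 1) else 0) := by
  have hr0 : 0 < r := by linarith
  have hx0 : 0 < x := by linarith
  have hi : (0 : ℝ) < (i : ℝ) + 1 := by positivity
  have hk : (0 : ℝ) < k := by exact_mod_cast i.pos
  have hT := countLE_nonneg (q := fun j : Fin k => (j : ℝ) + 1) (x := x / ((i : ℝ) + 1))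
  have hT' : 0 ≤ 2 / r * countLE (fun j : Fin k => (j : ℝ) + 1) (x / ((i : ℝ) + 1)) := by
    positivity
  have h0 := countLE_fin_le k (y := x / r / ((i : ℝ) + 1)) (by positivity)
  by_cases h1 : (i : ℝ) + 1 ≤ x / k
  · rw [if_pos h1]
    have h2 := countLE_fin_le_card k (x / r / ((i : ℝ) + 1))
    have h3 : countLE (fun j : Fin k => (j : ℝ) + 1) (x / r / ((i : ℝ) + 1))
        ≤ √(k * x / r) * (1 / √((i : ℝ) + 1)) := by
      rw [mul_one_div, ← Real.sqrt_div (by positivity)]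
      refine Real.le_sqrt_of_sq_le ?_
      have h4 := countLE_nonneg (q := fun j : Fin k => (j : ℝ) + 1) (x := x / r / ((i : ℝ) + 1))
      calc _ = countLE (fun j : Fin k => (j : ℝ) + 1) (x / r / ((i : ℝ) + 1)) *
            countLE (fun j : Fin k => (j : ℝ) + 1) (x / r / ((i : ℝ) + 1)) := pow_two _
        _ ≤ k * (x / r / ((i : ℝ) + 1)) := by gcongr
        _ = _ := by ring
    linarith
  · rw [if_neg h1, mul_zero, add_zero]
    by_cases h2 : (i : ℝ) + 1 ≤ x
    · have h3 := half_min_le_countLE_fin k ((one_le_div hi).2 h2)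
      have h4 : x / ((i : ℝ) + 1) ≤ k := by
        rw [not_le, div_lt_iff₀ hk] at h1
        rw [div_le_iff₀ hi]
        linarith
      rw [min_eq_right h4] at h3
      have h5 : x / r / ((i : ℝ) + 1) = 1 / r * (x / ((i : ℝ) + 1)) := by ring
      have h6 : 1 / r * (x / ((i : ℝ) + 1)) ≤
          1 / r * (2 * countLE (fun j : Fin k => (j : ℝ) + 1) (x / ((i : ℝ) + 1))) := by gcongr
      calc _ ≤ _ := h0
        _ ≤ _ := h5.le.trans h6
        _ = _ := by ring
    · have h3 : x / r / ((i : ℝ) + 1) < 1 := by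
        rw [div_lt_one hi]
        exact (div_le_self hx0.le hr).trans_lt (not_le.1 h2)
      rw [countLE_fin_eq_zero k h3]
      exact hT'

/-- The count can exceed linear order by a logarithm, which the slack √r in both comparisons
absorbs. The 10 is 2 from the rows compared directly plus 8 from the remaining ones, via x ≤ 4 times
the count. -/
lemma regularCounting_tensor (k : ℕ) :
    RegularCounting (fun p : Fin k × Fin k => ((p.1 : ℝ) + 1) * ((p.2 : ℝ) + 1))
      ((k : ℝ) ^ 2) (1 / 4) 10 where
  pos p := by positivity
  lower x hx hxk := le_countLE_tensor hx hxk
  growth x r hx hxk hr := by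
    classical
    have hr0 : 0 < r := by linarith
    have hx0 : 0 < x := by linarith
    have hlow := le_countLE_tensor hx hxk
    have h1 : countLE (fun p : Fin k × Fin k => ((p.1 : ℝ) + 1) * ((p.2 : ℝ) + 1)) (r * x)
        ≤ 2 * r * countLE (fun p : Fin k × Fin k => ((p.1 : ℝ) + 1) * ((p.2 : ℝ) + 1)) x
          + r * √x * (2 * √(r * x)) := by
      rw [countLE_tensor, countLE_tensor]
      refine (Finset.sum_le_sum fun i _ => countLE_tensor_growth_term hx hr i).trans ?_
      rw [Finset.sum_add_distrib, ← Finset.mul_sum, ← Finset.mul_sum]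
      gcongr
      exact sum_inv_sqrt_le k (by positivity)
    have h2 : r * √x * (2 * √(r * x)) = 2 * (r * √r) * x := by
      rw [Real.sqrt_mul hr0.le]
      have := Real.mul_self_sqrt hx0.le
      linear_combination 2 * r * √r * this
    have h3 : r ≤ r * √r := le_mul_of_one_le_right hr0.le (Real.one_le_sqrt.2 hr)
    rw [h2] at h1
    have hF := countLE_nonneg (x := x)
      (q := fun p : Fin k × Fin k => ((p.1 : ℝ) + 1) * ((p.2 : ℝ) + 1))
    have h4 := mul_le_mul_of_nonneg_right h3 hF
    have h5 := mul_le_mul_of_nonneg_left hlow (by positivity : 0 ≤ r * √r)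
    linarith
  decay x r hx hxk hr := by
    classical
    have hr0 : 0 < r := by linarith
    have hx0 : 0 < x := by linarith
    have hk : (0 : ℝ) < k := by
      rcases Nat.eq_zero_or_pos k with rfl | h
      · norm_num at hxk; linarith
      · exact_mod_cast h
    have hlow := le_countLE_tensor hx hxk
    have h1 : countLE (fun p : Fin k × Fin k => ((p.1 : ℝ) + 1) * ((p.2 : ℝ) + 1)) (x / r)
        ≤ 2 / r * countLE (fun p : Fin k × Fin k => ((p.1 : ℝ) + 1) * ((p.2 : ℝ) + 1)) x
          + √(k * x / r) * (2 * √(x / k)) := by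
      rw [countLE_tensor, countLE_tensor]
      refine (Finset.sum_le_sum fun i _ => countLE_tensor_decay_term hx hr i).trans ?_
      rw [Finset.sum_add_distrib, ← Finset.mul_sum, ← Finset.mul_sum]
      gcongr
      exact sum_inv_sqrt_le k (by positivity)
    have hs : 0 < √r := Real.sqrt_pos.2 hr0
    have hss := Real.mul_self_sqrt hr0.le
    have h2 : √(k * x / r) * (2 * √(x / k)) = 2 * x / √r := by
      rw [mul_left_comm, ← Real.sqrt_mul (by positivity),
        show k * x / r * (x / k) = x ^ 2 / r by field_simp, Real.sqrt_div (by positivity),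
        Real.sqrt_sq hx0.le]
      ring
    rw [h2] at h1
    have hF := countLE_nonneg (x := x)
      (q := fun p : Fin k × Fin k => ((p.1 : ℝ) + 1) * ((p.2 : ℝ) + 1))
    have h3 : √r * (2 / r) ≤ 2 := by
      rw [mul_div_assoc', div_le_iff₀ hr0]
      nlinarith [Real.one_le_sqrt.2 hr]
    have h4 := mul_le_mul_of_nonneg_left h1 hs.le
    have h5 : √r * (2 * x / √r) = 2 * x := by field_simp
    rw [mul_add, h5, ← mul_assoc] at h4
    have h6 := mul_le_mul_of_nonneg_right h3 hF
    linarith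

end Sequences

/-! ### From eigenvalue asymptotics to the abstract conditions -/

section EigenvalueConditions

variable {N : ℕ → ℕ} {m : ℝ} {l : ∀ k, Fin (N k) → ℝ}

/-- The eigenvalues behave like `n / q ^ m` for a regularly varying family `q`. -/
def EigRegular (m : ℝ) (N : ℕ → ℕ) (l : ∀ k, Fin (N k) → ℝ) : Prop :=
  ∃ δ Δ c₀ C₀ : ℝ, 0 < δ ∧ 0 < Δ ∧ 0 < c₀ ∧ 0 < C₀ ∧ ∀ᶠ k in atTop, ∃ q : Fin (N k) → ℝ,
    RegularCounting q (N k) c₀ C₀ ∧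
      ∀ j, δ * (N k / q j ^ m) ≤ l k j ∧ l k j ≤ Δ * (N k / q j ^ m)

lemma eigRegular_of_eigPoly (h : EigPoly m N l) : EigRegular m N l := by
  obtain ⟨δ, Δ, hδ, hΔ, h⟩ := h
  refine ⟨δ, Δ, 1 / 2, (1 / 2)⁻¹, hδ, hΔ, by norm_num, by norm_num, ?_⟩
  filter_upwards [h] with k hk
  exact ⟨_, regularCounting_fin (N k), hk⟩

lemma card_eq_sq {k n : ℕ} (σ : Fin k × Fin k ≃ Fin n) : (n : ℝ) = (k : ℝ) ^ 2 := by
  have h := Fintype.card_congr σ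
  simp only [Fintype.card_prod, Fintype.card_fin] at h
  rw [← h]
  push_cast
  ring

lemma eigRegular_of_eigTensor (h : EigTensor m N l) : EigRegular m N l := by
  obtain ⟨σ, δ, Δ, hδ, hΔ, h⟩ := h
  refine ⟨δ, Δ, 1 / 4, 10, hδ, hΔ, by norm_num, by norm_num, ?_⟩
  filter_upwards [h] with k hk
  refine ⟨_, by
    rw [card_eq_sq (σ k)]
    exact (regularCounting_tensor k).comp_equiv (σ k).symm, fun j => ?_⟩
  have := hk ((σ k).symm j).1 ((σ k).symm j).2
  rw [Prod.mk.eta, Equiv.apply_symm_apply] at this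
  rwa [card_eq_sq (σ k), Real.mul_rpow (by positivity) (by positivity)]

lemma eigRegular_of_eigSobolev (h : EigSobolev m N l) : EigRegular m N l := by
  obtain ⟨σ, δ, Δ, hδ, hΔ, h⟩ := h
  refine ⟨δ, Δ, 1 / 8, (1 / 8)⁻¹, hδ, hΔ, by norm_num, by norm_num, ?_⟩
  filter_upwards [h] with k hk
  refine ⟨_, by
    rw [card_eq_sq (σ k)]
    exact (regularCounting_sobolev k).comp_equiv (σ k).symm, fun j => ?_⟩
  have := hk ((σ k).symm j).1 ((σ k).symm j).2
  rw [Prod.mk.eta, Equiv.apply_symm_apply] at this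
  rwa [card_eq_sq (σ k)]

lemma log_le_of_mem_scaleInterval {n : ℕ} {c : ℝ} (hn : (0 : ℝ) < n)
    (hc : c ∈ scaleInterval m n) : Real.log n ≤ n * c := by
  have := hc.1
  rwa [div_le_iff₀' hn] at this

/-- With x = (nc)^(1/m) the endpoints of `I_n` give x ≥ 2 once log n ≥ 2^m, and x ≤ n. In this range
all variance terms are comparable to the counting function at x. -/
lemma EigRegular.conditions (h : EigRegular m N l) (hm : 1 ≤ m) (hN : Tendsto N atTop atTop)
    (hl : ∀ k j, 0 ≤ l k j) :
    (∃ δ : ℝ, 0 < δ ∧ ∀ᶠ k in atTop, ∀ c ∈ scaleInterval m (N k),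
      δ * (N k * c) ^ m⁻¹ ≤ D2L (l k) c) ∧
    (∃ K : ℝ, 1 < K ∧ ∀ᶠ k in atTop, ∀ c ∈ scaleInterval m (N k),
      c / K ∈ scaleInterval m (N k) → D2L (l k) (c / K) ≤ 1 / 2 * D2L (l k) c) ∧
    (∃ C : ℝ, 0 < C ∧ ∀ᶠ k in atTop, ∀ c ∈ scaleInterval m (N k),
      D2L (l k) c ≤ C * postVar (l k) c) := by
  obtain ⟨δ, Δ, c₀, C₀, hδ, hΔ, hc₀, hC₀, h⟩ := h
  have hm0 : 0 < m := by linarith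
  have hg := logGap_pos hδ
  obtain ⟨C, hC, hup⟩ := RegularCounting.exists_D2L_le hm hΔ hC₀
  have hNreal : Tendsto (fun k => (N k : ℝ)) atTop atTop := tendsto_natCast_atTop_atTop.comp hN
  have hlogN : Tendsto (fun k => Real.log (N k)) atTop atTop := Real.tendsto_log_atTop.comp hNreal
  have key : ∀ᶠ k in atTop, ∃ q : Fin (N k) → ℝ, RegularCounting q (N k) c₀ C₀ ∧
      ∀ c ∈ scaleInterval m (N k), 0 < c ∧ 2 ≤ (N k * c) ^ m⁻¹ ∧ (N k * c) ^ m⁻¹ ≤ N k ∧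
        D2L (l k) c ≤ C * countLE q ((N k * c) ^ m⁻¹) ∧
        logGap δ * countLE q ((N k * c) ^ m⁻¹) ≤ D2L (l k) c ∧
        δ / (1 + δ) * countLE q ((N k * c) ^ m⁻¹) ≤ postVar (l k) c := by
    filter_upwards [h, hlogN.eventually_ge_atTop (2 ^ m), hNreal.eventually_gt_atTop 0]
      with k hk hlog hN0
    obtain ⟨q, hq, hlq⟩ := hk
    refine ⟨q, hq, fun c hc => ?_⟩
    have hlog0 : 0 < Real.log (N k) := lt_of_lt_of_le (by positivity) hlog
    have hc0 : 0 < c := (div_pos hlog0 hN0).trans_le hc.1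
    have hNc := log_le_of_mem_scaleInterval hN0 hc
    have hNc0 : 0 < N k * c := by positivity
    have hx2 : 2 ≤ (N k * c) ^ m⁻¹ := by
      rw [Real.le_rpow_inv_iff_of_pos (by norm_num) hNc0.le hm0]
      exact hlog.trans hNc
    have hxN : (N k * c) ^ m⁻¹ ≤ N k := by
      rw [Real.rpow_inv_le_iff_of_pos hNc0.le hN0.le hm0]
      calc N k * c ≤ N k * (N k : ℝ) ^ (m - 1) := by
            gcongr
            exact hc.2
        _ = (N k : ℝ) ^ m := by
            rw [Real.rpow_sub_one hN0.ne']
            field_simp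
    have hxm : ∀ j, ((N k * c) ^ m⁻¹ / q j) ^ m = c * (N k / q j ^ m) := by
      intro j
      rw [Real.div_rpow (by positivity) (hq.pos j).le, Real.rpow_inv_rpow hNc0.le hm0.ne']
      ring
    have hcl : ∀ j, 0 ≤ c * l k j := fun j => mul_nonneg hc0.le (hl k j)
    have hlo : ∀ j, δ * ((N k * c) ^ m⁻¹ / q j) ^ m ≤ c * l k j := by
      intro j
      rw [hxm, mul_left_comm]
      exact mul_le_mul_of_nonneg_left (hlq j).1 hc0.le
    have hhi : ∀ j, c * l k j ≤ Δ * ((N k * c) ^ m⁻¹ / q j) ^ m := by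
      intro j
      rw [hxm, mul_left_comm]
      exact mul_le_mul_of_nonneg_left (hlq j).2 hc0.le
    exact ⟨hc0, hx2, hxN, hup hq hx2 hxN hcl hhi, countLE_le_D2L hm0.le hδ hq.pos hcl hlo,
      countLE_le_postVar hm0.le hδ hq.pos hcl hlo⟩
  refine ⟨⟨logGap δ * c₀, by positivity, ?_⟩, ?_, ⟨C * ((1 + δ) / δ), by positivity, ?_⟩⟩
  · filter_upwards [key] with k ⟨q, hq, hk⟩ c hc
    obtain ⟨-, hx2, hxN, -, h2, -⟩ := hk c hc
    rw [mul_assoc]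
    exact (mul_le_mul_of_nonneg_left (hq.lower _ hx2 hxN) hg.le).trans h2
  -- Dividing c by r^m divides x by r and the count by √r up to `C₀`; r is large enough that this
  -- beats the comparison constants and a factor 2.
  · set r : ℝ := (2 * C * C₀ / logGap δ) ^ 2 + 1 with hr
    have hr1 : 1 < r := by
      have : 0 < (2 * C * C₀ / logGap δ) ^ 2 := by positivity
      linarith
    have hr0 : 0 < r := by linarith
    have hsr : 2 * C * C₀ ≤ logGap δ * √r := by
      rw [← div_le_iff₀' hg]
      exact Real.le_sqrt_of_sq_le (by linarith)
    refine ⟨r ^ m, Real.one_lt_rpow hr1 hm0, ?_⟩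
    filter_upwards [key] with k ⟨q, hq, hk⟩ c hc hc'
    obtain ⟨hc0, hx2, hxN, -, h2, -⟩ := hk c hc
    obtain ⟨-, -, -, h1, -, -⟩ := hk _ hc'
    have hxr : (N k * (c / r ^ m)) ^ m⁻¹ = (N k * c) ^ m⁻¹ / r := by
      rw [← mul_div_assoc, Real.div_rpow (by positivity) (by positivity),
        Real.rpow_rpow_inv hr0.le hm0.ne']
    rw [hxr] at h1
    have h3 := hq.decay _ r hx2 hxN hr1.le
    have hF := countLE_nonneg (q := q) (x := (N k * c) ^ m⁻¹ / r)
    have h4 := mul_le_mul_of_nonneg_right hsr hF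
    have h5 := mul_le_mul_of_nonneg_left h3 hg.le
    have h6 := mul_le_mul_of_nonneg_left h2 hC₀.le
    have h7 : C₀ * (2 * (C * countLE q ((N k * c) ^ m⁻¹ / r))) ≤ C₀ * D2L (l k) c := by linarith
    have h8 := le_of_mul_le_mul_left h7 hC₀
    linarith
  · filter_upwards [key] with k ⟨q, hq, hk⟩ c hc
    obtain ⟨-, -, -, h1, -, h3⟩ := hk c hc
    refine h1.trans ?_
    rw [mul_assoc]
    refine mul_le_mul_of_nonneg_left ?_ hC.le
    rw [div_mul_eq_mul_div, div_le_iff₀ (by positivity)] at h3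
    rw [div_mul_eq_mul_div, le_div_iff₀ hδ]
    linarith

/-- Since n c ≥ log n tends to infinity uniformly on the interval, the logarithm is eventually below
any positive multiple of a power. -/
lemma eventually_log_le_D2L (hN : Tendsto N atTop atTop) {δ p : ℝ} (hδ : 0 < δ) (hp : 0 < p)
    (hD : ∀ᶠ k in atTop, ∀ c ∈ scaleInterval m (N k), δ * (N k * c) ^ p ≤ D2L (l k) c) :
    ∀ᶠ k in atTop, ∀ c ∈ scaleInterval m (N k), Real.log (N k * c) ≤ D2L (l k) c := by
  have hNreal : Tendsto (fun k => (N k : ℝ)) atTop atTop := tendsto_natCast_atTop_atTop.comp hN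
  have hlogN : Tendsto (fun k => Real.log (N k)) atTop atTop := Real.tendsto_log_atTop.comp hNreal
  have h1 := (isLittleO_log_rpow_atTop hp).def hδ
  obtain ⟨y₀, hy₀⟩ := eventually_atTop.1 h1
  filter_upwards [hD, hlogN.eventually_ge_atTop (max y₀ 1), hNreal.eventually_gt_atTop 0]
    with k hk hlog hN0 c hc
  have hNc := log_le_of_mem_scaleInterval hN0 hc
  have h2 := hy₀ (N k * c) ((le_max_left _ _).trans (hlog.trans hNc))
  have h3 : 0 ≤ N k * c := by linarith [le_max_right y₀ 1]
  rw [Real.norm_eq_abs, Real.norm_eq_abs, abs_of_nonneg (Real.rpow_nonneg h3 p)] at h2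
  exact (le_abs_self _).trans (h2.trans (hk c hc))

/-- It suffices to take K with B' K^(-b) ≤ 1/2. -/
lemma GoodVariance.exists_half {I : ℕ → Set ℝ} {D : ℕ → ℝ → ℝ} (h : GoodVariance I D)
    (hD : ∀ᶠ k in atTop, ∀ c ∈ I k, 0 < c ∧ 0 ≤ D k c) :
    ∃ K : ℝ, 1 < K ∧ ∀ᶠ k in atTop, ∀ c ∈ I k, c / K ∈ I k → D k (c / K) ≤ 1 / 2 * D k c := by
  obtain ⟨b, B, B', hb, -, hB', h⟩ := h
  have hlim : Tendsto (fun K : ℝ => B' * K ^ (-b)) atTop (𝓝 0) := by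
    simpa using (tendsto_rpow_neg_atTop hb).const_mul B'
  obtain ⟨K, hK, hK1⟩ := ((hlim.eventually (ge_mem_nhds (by norm_num : (0 : ℝ) < 1 / 2))).and
    (eventually_gt_atTop 1)).exists
  refine ⟨K, hK1, ?_⟩
  have hK0 : 0 < K := by linarith
  filter_upwards [h, hD] with k hk hDk c hc hc'
  have h1 := (hk c hc K⁻¹ (inv_pos.2 hK0) (inv_lt_one_of_one_lt₀ hK1)
    (by rwa [inv_mul_eq_div])).2
  rw [inv_mul_eq_div, Real.inv_rpow hK0.le, ← Real.rpow_neg hK0.le] at h1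
  exact h1.trans (mul_le_mul_of_nonneg_right hK (hDk c hc).2)

end EigenvalueConditions

end HBayes

theorem mainTheorem9
    {𝒳 Ω Ω' : Type*} [MeasurableSpace Ω] [MeasurableSpace Ω']
    -- the unit scale prior process, a centred Gaussian process on `𝒳`
    (Q : Measure Ω') [IsProbabilityMeasure Q] (W : 𝒳 → Ω' → ℝ)
    (hW : IsGaussianProcess W Q) (hW0 : ∀ z, ∫ ω, W z ω ∂Q = 0)
    -- sample sizes and design points
    (N : ℕ → ℕ) (hN : Tendsto N atTop atTop) (x : ∀ k, Fin (N k) → 𝒳)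
    -- independent standard normal errors
    (P : Measure Ω) [IsProbabilityMeasure P] (ε : ∀ k, Fin (N k) → Ω → ℝ)
    (hε : ∀ k i, HasLaw (ε k i) (gaussianReal 0 1) P) (hindep : ∀ k, iIndepFun (ε k) P)
    -- the exponent of the intervals `I_n` and the parameters of the inverse gamma prior
    (m : ℝ) (hm : 1 ≤ m) (κ τ : ℝ) (hκ : 0 < κ) (hτ : 0 < τ)
    -- orthonormal eigenbases and eigenvalues of the prior covariance matrices
    (e : ∀ k, OrthonormalBasis (Fin (N k)) ℝ (EuclideanSpace ℝ (Fin (N k))))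
    (l : ∀ k, Fin (N k) → ℝ)
    (heig : ∀ k j, Matrix.toEuclideanLin (HBayes.priorCov W Q (x k)) (e k j) = l k j • e k j)
    -- the true regression function; its coordinates and those of the errors in the eigenbases
    (f : 𝒳 → ℝ) (v : ∀ k, Fin (N k) → ℝ)
    (hv : ∀ k j, v k j = inner ℝ (e k j) (HBayes.designVec (x k) f))
    (Z : ∀ k, Ω → Fin (N k) → ℝ)
    (hZ : ∀ k ω j, Z k ω j = inner ℝ (e k j) (WithLp.toLp 2 fun i => ε k i ω))
    (I : ℕ → Set ℝ) (hI : ∀ k, I k = HBayes.scaleInterval m (N k)) :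
    (HBayes.SupTendstoZeroInProb P I (fun k c ω =>
          (|HBayes.R1L (l k) (v k) (Z k ω) c| + |HBayes.R2L (l k) (Z k ω) c|) /
            HBayes.DL (l k) (v k) c) →
      HBayes.SupTendstoZeroInProb P I (fun k c ω =>
          (|HBayes.R3 (l k) (v k) (Z k ω) c| + |HBayes.R4 (l k) (Z k ω) c|) /
            HBayes.DL (l k) (v k) c) →
      HBayes.SupTendstoZeroInProb P I (fun k c ω =>
          |HBayes.normSqVar (l k) (Z k ω) c / HBayes.postVar (l k) c - 1|) →
      HBayes.GoodVariance I (fun k => HBayes.D2L (l k)) →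
      (∀ᶠ k in atTop, ∀ c ∈ I k, Real.log (N k * c) ≤ HBayes.D2L (l k) c) →
      HBayes.SuitableMinimizer I τ (fun k => HBayes.DL (l k) (v k)) →
      HBayes.AsympEquivOn I (fun k => HBayes.D2R (l k)) (fun k => HBayes.postVar (l k)) →
      HBayes.AsympEquivOn I (fun k => HBayes.D2L (l k)) (fun k => HBayes.postVar (l k)) →
      HBayes.GoodBias I (fun k => HBayes.D1L (l k) (v k)) →
      HBayes.CoverageHB P N x (fun k => HBayes.priorCov W Q (x k)) ε κ τ m f)
    ∧
    (HBayes.EigPoly m N l ∨ HBayes.EigTensor m N l ∨ HBayes.EigSobolev m N l →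
      HBayes.SuitableMinimizer I τ (fun k => HBayes.DL (l k) (v k)) →
      HBayes.GoodBias I (fun k => HBayes.D1L (l k) (v k)) →
      HBayes.CoverageHB P N x (fun k => HBayes.priorCov W Q (x k)) ε κ τ m f) := by
  have hl : ∀ k j, 0 ≤ l k j := fun k j =>
    HBayes.eigenvalue_nonneg_of_posSemidef (HBayes.posSemidef_priorCov hW (x k)) (heig k) j
  have hlaw := fun k => HBayes.hasLaw_toLp_stdGaussian (hε k) (hindep k)
  have hcover := HBayes.coverageHB_of_conditions N hN x (fun k => HBayes.priorCov W Q (x k)) P ε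
    hlaw m κ τ hκ hτ e l hl heig f v hv Z hZ I hI
  have hNreal : Tendsto (fun k => (N k : ℝ)) atTop atTop := tendsto_natCast_atTop_atTop.comp hN
  refine ⟨fun h1 h2 h3 hvar hlog hmin _ hequiv hbias => ?_, fun heigs hmin hbias => ?_⟩
  · obtain ⟨C₁, C₂, -, hC₂, hequiv⟩ := hequiv
    refine hcover h1 h2 h3 (hvar.exists_half ?_) hlog hmin
      ⟨C₂, hC₂, hequiv.mono fun k hk c hc => (hk c hc).2⟩ hbias
    filter_upwards [hNreal.eventually_gt_atTop 1] with k hN1 c hc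
    rw [hI] at hc
    have hc0 : 0 < c := (div_pos (Real.log_pos hN1) (by linarith)).trans_le hc.1
    exact ⟨hc0, HBayes.D2L_nonneg (hl k) hc0.le⟩
  · have hreg : HBayes.EigRegular m N l := by
      rcases heigs with h | h | h
      · exact HBayes.eigRegular_of_eigPoly h
      · exact HBayes.eigRegular_of_eigTensor h
      · exact HBayes.eigRegular_of_eigSobolev h
    obtain ⟨⟨δ, hδ, hD⟩, hgrowth, hpost⟩ := hreg.conditions hm hN hl
    have hp : 0 < m⁻¹ := inv_pos.2 (by linarith)
    have hZlaw : ∀ k, HasLaw (Z k) (Measure.pi fun _ => gaussianReal 0 1) P := fun k => by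
      have : Z k = fun ω j => inner ℝ (e k j) (WithLp.toLp 2 fun i => ε k i ω) :=
        funext fun ω => funext fun j => hZ k ω j
      rw [this]
      exact HBayes.hasLaw_coord (e k) (hlaw k)
    obtain rfl : I = fun k => HBayes.scaleInterval m (N k) := funext hI
    obtain ⟨h1, h2⟩ := HBayes.stochastic_terms_negligible (v := v) hN hδ hp hl hZlaw hD
    exact hcover h1 h2 (HBayes.normSqVar_concentrates hN hδ hp hl hZlaw hD hpost) hgrowth
      (HBayes.eventually_log_le_D2L hN hδ hp hD) hmin hpost hbias
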